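/- Let $Q$ be a connected, paracompact, Hausdorff $d$-dimensional manifold of class $C^{r+1}$, $r\ge 2$, and let $a_t$, $b_t$, $V(t,\cdot)$ ($t\in\mathbb R$) be a Riemannian metric, a 1-form and a function on $Q$, all of class $C^r$ in $(t,q)$ jointly. Put $$L(t,q,v)=\tfrac12 a_t(v,v)+b_t(v)-V(t,q),\qquad H(t,q,p)=\tfrac12 a_t^{-1}(p-b_t,p-b_t)+V(t,q),$$ and let $M=\mathbb R\times Q\times\mathbb R$, with points $(t,q,y)$, carry the Lorentzian metric $$g=a_t-dt\otimes(dy-b_t)-(dy-b_t)\otimes dt-2V\,dt^2,$$ time oriented by $\partial_t-(V-\frac12)\partial_y$. Let $n=\partial_y$, let $I\subset\mathbb R$ be a nonempty open interval and let $\pi(t,q,y)=(t,q)$. Inextendibility and maximality below refer to the part $\pi^{-1}(I\times Q)$ of $M$. (1) Let $S\subset \pi^{-1}(I\times Q)$ be an embedded $C^1$ hypersurface which meets each integral line $\{(t,q)\}\times\mathbb R$ of $n$, $t\in I$, exactly once, and transversally. Then $S=\{(t,q,u(t,q)):t\in I,\ q\in Q\}$ for some $C^1$ function $u:I\times Q\to\mathbb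 R$. Moreover $S$ is lightlike (the induced metric is degenerate on every tangent space) if and only if $\partial_t u+H(t,q,\partial_q u)=0$ on $I\times Q$, and $S$ has causal normals (each nonzero vector orthogonal to a tangent space of $S$ is timelike or lightlike) if and only if $\partial_t u+H(t,q,\partial_q u)\le 0$ on $I\times Q$. (2) Conversely, the graph of any $C^1$ function $u:I\times Q\to\mathbb R$ is an embedded $C^1$ hypersurface of $M$, and it is lightlike (respectively, has causal normals) if and only if $\partial_t u+H(t,q,\partial_q u)=0$ (respectively $\le 0$) on $I\times Q$. (3) Let $S$ be the graph of a $C^1$ function $u:I\times Q\to\mathbb R$ and suppose that $S$ is lightlike. Then $S$ is achronal. If $t_0<t_1$ and $[t_0,t_1]\subset I$, then for every $q_1\in Q$ $$u(t_1,q_1)\le \inf_{c}\Big[u(t_0,c(t_0))+\int_{t_0}^{t_1}L(t,c(t),\dot c(t))\,dt\Big],$$ the infimum (a finite number) being over the $C^1$ curves $c:[t_0,t_1]\to Q$ with $c(t_1)=q_1$. Further, for every $(t_1,q_1)\in I\times Q$ there are an open interval $A\subset I$ with $t_1\in A$ and a curve $q:A\to Q$ with $q(t_1)=q_1$ such that: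 * $t\mapsto (t,q(t),u(t,q(t)))$, $t\in A$, is an inextendible future directed lightlike geodesic (affinely parametrized by $t$) with achronal image (which lies in $S$); * $q$ is a maximal solution of the Euler–Lagrange equations of $L$, and it minimizes the action $\int L\,dt$ between any two of its points, among $C^1$ curves with the same endpoints; * $q$ is a characteristic, i.e. $\partial L/\partial v\,(t,q(t),\dot q(t))=\partial_q u(t,q(t))$ on $A$; and any other $C^1$ characteristic on an open subinterval of $I$ passing through $(t_1,q_1)$ is a restriction of it; * for every $t_0<t_1$ with $[t_0,t_1]\subset I$: the equality $u(t_1,q_1)=u(t_0,c(t_0))+\int_{t_0}^{t_1}L(t,c,\dot c)\,dt$ holds for some $C^1$ curve $c:[t_0,t_1]\to Q$ with $c(t_1)=q_1$ if and only if $t_0\in A$, i.e. if and only if the characteristic through $(t_1,q_1)$ extends to the past up to time $t_0$; in that case the infimum above equals $u(t_1,q_1)$ and is attained on $q|_{[t_0,t_1]}$, and every $C^1$ curve $c$ for which the equality holds coincides with $q$ on $[t_0,t_1]$. The condition $t_0\in A$ holds if the Euler–Lagrange flow is complete on $[t_0,t_1]$, i.e. if every maximal solution in $I\times Q$ of the Euler–Lagrange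 equations defined at some time of $[t_0,t_1]$ is defined on all of $[t_0,t_1]$. -/

import Mathlib

open Set Filter Topology
open scoped Manifold ContDiff

noncomputable section

namespace Brinkmann

variable {d : ℕ} {Q : Type*} [TopologicalSpace Q] [ChartedSpace (EuclideanSpace ℝ (Fin d)) Q]

/-- On a finite dimensional space an injective map to the dual is invertible. -/
theorem isInvertible_of_injective {E : Type*} [NormedAddCommGroup E] [NormedSpace ℝ E]
    [FiniteDimensional ℝ E] (f : E →L[ℝ] E →L[ℝ] ℝ) (hf : Function.Injective f) :
    f.IsInvertible := by
  have hdim : Module.finrank ℝ E = Module.finrank ℝ (E →L[ℝ] ℝ) := by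
    rw [← (LinearMap.toContinuousLinearMap (𝕜 := ℝ) (E := E) (F' := ℝ)).finrank_eq]
    exact (Subspace.dual_finrank_eq (K := ℝ) (V := E)).symm
  refine ⟨(LinearMap.linearEquivOfInjective (f : E →ₗ[ℝ] E →L[ℝ] ℝ) hf
    hdim).toContinuousLinearEquiv, ?_⟩
  ext v w
  rfl

/-- A time dependent Riemannian metric `a`, a time dependent 1-form `b` and a time dependent
potential `V` on the `d`-dimensional manifold `Q`, all of class `C^r` in `(t, q)` jointly.
For tensor fields this is expressed through the functions `(t, v) ↦ a_t(v, v)` and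
`(t, v) ↦ b_t(v)` on `ℝ × TQ`: in bundle charts these are `∑ a_{ij}(t, x) v^i v^j` and
`∑ b_i(t, x) v^i`, so they are `C^r` exactly when all the components are. -/
structure MechanicalData (d : ℕ) (Q : Type*) [TopologicalSpace Q]
    [ChartedSpace (EuclideanSpace ℝ (Fin d)) Q] [IsManifold (𝓡 d) 1 Q] (r : ℕ∞ω) where
  a : ℝ → ∀ q : Q, TangentSpace (𝓡 d) q →L[ℝ] TangentSpace (𝓡 d) q →L[ℝ] ℝ
  a_symm : ∀ t q v w, a t q v w = a t q w v
  a_pos : ∀ t q v, v ≠ 0 → 0 < a t q v v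
  b : ℝ → ∀ q : Q, TangentSpace (𝓡 d) q →L[ℝ] ℝ
  V : ℝ → Q → ℝ
  a_smooth : ContMDiff (𝓘(ℝ, ℝ).prod (𝓡 d).tangent) 𝓘(ℝ, ℝ) r
    (fun p : ℝ × TangentBundle (𝓡 d) Q => a p.1 p.2.proj p.2.snd p.2.snd)
  b_smooth : ContMDiff (𝓘(ℝ, ℝ).prod (𝓡 d).tangent) 𝓘(ℝ, ℝ) r
    (fun p : ℝ × TangentBundle (𝓡 d) Q => b p.1 p.2.proj p.2.snd)
  V_smooth : ContMDiff (𝓘(ℝ, ℝ).prod (𝓡 d)) 𝓘(ℝ, ℝ) r (fun p : ℝ × Q => V p.1 p.2)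

/-! ### Curves in `Q` -/

/-- The velocity at time `t` of a curve in `Q` defined near `t`. -/
def velocity (c : ℝ → Q) (t : ℝ) : TangentSpace (𝓡 d) (c t) :=
  mfderiv 𝓘(ℝ, ℝ) (𝓡 d) c t (1 : ℝ)

/-- The velocity at time `t` of a curve in `Q` defined on `[t₀, t₁]` (one-sided at the
endpoints). -/
def velocityOn (t₀ t₁ : ℝ) (c : ℝ → Q) (t : ℝ) : TangentSpace (𝓡 d) (c t) :=
  mfderivWithin 𝓘(ℝ, ℝ) (𝓡 d) c (Icc t₀ t₁) t (1 : ℝ)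

/-- The `C¹` curves `[t₀, t₁] → Q`; only the restriction of `c` to `[t₀, t₁]` matters. -/
def IsC1CurveOn (d : ℕ) {Q : Type*} [TopologicalSpace Q]
    [ChartedSpace (EuclideanSpace ℝ (Fin d)) Q] (t₀ t₁ : ℝ) (c : ℝ → Q) : Prop :=
  ContMDiffOn 𝓘(ℝ, ℝ) (𝓡 d) 1 c (Icc t₀ t₁)

/-- `A` is a nonempty open interval contained in `J`. -/
def IsOpenSubinterval (J A : Set ℝ) : Prop :=
  IsOpen A ∧ A.OrdConnected ∧ A.Nonempty ∧ A ⊆ J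

/-! ### Functions on `J × Q` -/

/-- `u` is of class `C¹` on `J × Q` (`J` open). -/
def IsC1On (d : ℕ) {Q : Type*} [TopologicalSpace Q]
    [ChartedSpace (EuclideanSpace ℝ (Fin d)) Q] (J : Set ℝ) (u : ℝ × Q → ℝ) : Prop :=
  ContMDiffOn (𝓘(ℝ, ℝ).prod (𝓡 d)) 𝓘(ℝ, ℝ) 1 u (J ×ˢ univ)

/-- `∂u/∂t`. -/
def timeDeriv (u : ℝ × Q → ℝ) (t : ℝ) (q : Q) : ℝ := deriv (fun s => u (s, q)) t

/-- `∂u/∂q`, a covector on `Q` at `q`. -/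
def spaceDeriv (u : ℝ × Q → ℝ) (t : ℝ) (q : Q) : TangentSpace (𝓡 d) q →L[ℝ] ℝ :=
  mfderiv (𝓡 d) 𝓘(ℝ, ℝ) (fun q' => u (t, q')) q

/-! ### The spacetime `M = ℝ × Q × ℝ`, with points `(t, q, y)` -/

/-- The manifold `ℝ × Q × ℝ`. -/
abbrev Spacetime (Q : Type*) : Type _ := ℝ × Q × ℝ

/-- The model with corners (without boundary) of `ℝ × Q × ℝ`. -/
abbrev model (d : ℕ) := 𝓘(ℝ, ℝ).prod ((𝓡 d).prod 𝓘(ℝ, ℝ))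

/-- The model vector space of `ℝ × Q × ℝ`. -/
abbrev ModelSpace (d : ℕ) : Type := ℝ × EuclideanSpace ℝ (Fin d) × ℝ

/-- The tangent space of `ℝ × Q × ℝ` at `x`; its elements are triples `(τ, v, η)`, standing for
`τ ∂_t + v + η ∂_y`. -/
abbrev Tangent (d : ℕ) {Q : Type*} [TopologicalSpace Q]
    [ChartedSpace (EuclideanSpace ℝ (Fin d)) Q] (x : Spacetime Q) : Type :=
  TangentSpace (model d) x

/-- The component along `∂_t`. -/
def tPart {x : Spacetime Q} (w : Tangent d x) : ℝ :=
  (show ℝ × EuclideanSpace ℝ (Fin d) × ℝ from w).1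

/-- The component tangent to `Q`. -/
def qPart {x : Spacetime Q} (w : Tangent d x) : TangentSpace (𝓡 d) x.2.1 :=
  (show ℝ × EuclideanSpace ℝ (Fin d) × ℝ from w).2.1

/-- The component along `∂_y`. -/
def yPart {x : Spacetime Q} (w : Tangent d x) : ℝ :=
  (show ℝ × EuclideanSpace ℝ (Fin d) × ℝ from w).2.2

/-- The vector field `n = ∂_y`. -/
def nField (d : ℕ) {Q : Type*} [TopologicalSpace Q]
    [ChartedSpace (EuclideanSpace ℝ (Fin d)) Q] (x : Spacetime Q) : Tangent d x :=
  (show ModelSpace d from (0, 0, 1))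

/-- The velocity of a curve in `M` defined near `s`. -/
def spVelocity (γ : ℝ → Spacetime Q) (s : ℝ) : Tangent d (γ s) :=
  mfderiv 𝓘(ℝ, ℝ) (model d) γ s (1 : ℝ)

/-- The velocity of a curve in `M` defined on `[s₀, s₁]`. -/
def spVelocityOn (s₀ s₁ : ℝ) (γ : ℝ → Spacetime Q) (s : ℝ) : Tangent d (γ s) :=
  mfderivWithin 𝓘(ℝ, ℝ) (model d) γ (Icc s₀ s₁) s (1 : ℝ)

/-- The portion `J × Q × ℝ` of the spacetime. -/
def slab (J : Set ℝ) : Set (Spacetime Q) := {x | x.1 ∈ J}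

/-! ### Hypersurfaces -/

/-- `S` is an embedded `C¹` submanifold of `M` of codimension one: the subspace `S` carries a
structure of `C¹` manifold of dimension `d + 1 = dim M - 1` for which the inclusion is a `C¹`
embedding. -/
def IsC1Hypersurface (d : ℕ) {Q : Type*} [TopologicalSpace Q]
    [ChartedSpace (EuclideanSpace ℝ (Fin d)) Q] (S : Set (Spacetime Q)) : Prop :=
  ∃ _ : ChartedSpace (EuclideanSpace ℝ (Fin (d + 1))) S,
    IsManifold (𝓡 (d + 1)) 1 S ∧
    Manifold.IsSmoothEmbedding (𝓡 (d + 1)) (model d) 1 (Subtype.val : S → Spacetime Q)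

/-- The vectors tangent to `S` at `x`: the velocities at `x` of the curves lying in `S`. -/
def tangentVectors (S : Set (Spacetime Q)) (x : Spacetime Q) : Set (Tangent d x) :=
  {w | ∃ γ : ℝ → Spacetime Q, γ 0 = x ∧ (∀ᶠ s in 𝓝 (0 : ℝ), γ s ∈ S) ∧
    MDifferentiableAt 𝓘(ℝ, ℝ) (model d) γ 0 ∧ (spVelocity γ 0 : Tangent d (γ 0)) = w}

/-- `S` meets each integral line `{(t, q)} × ℝ` of `n` with `t ∈ J` exactly once. -/
def MeetsLinesOnce (J : Set ℝ) (S : Set (Spacetime Q)) : Prop :=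
  ∀ t ∈ J, ∀ q : Q, ∃! y : ℝ, ((t, q, y) : Spacetime Q) ∈ S

/-- The hypersurface `S` is nowhere tangent to `n`. -/
def IsTransversal (d : ℕ) {Q : Type*} [TopologicalSpace Q]
    [ChartedSpace (EuclideanSpace ℝ (Fin d)) Q] (S : Set (Spacetime Q)) : Prop :=
  ∀ x ∈ S, nField d x ∉ tangentVectors S x

/-- The image of `J × Q` under `(t, q) ↦ (t, q, u(t, q))`. -/
def graphOver (J : Set ℝ) (u : ℝ × Q → ℝ) : Set (Spacetime Q) :=
  (fun e : ℝ × Q => ((e.1, e.2, u e) : Spacetime Q)) '' (J ×ˢ univ)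

namespace MechanicalData

variable [IsManifold (𝓡 d) 1 Q] {r : ℕ∞ω} (D : MechanicalData d Q r)

/-! ### Mechanics -/

/-- `L(t, q, v) = a_t(v, v)/2 + b_t(v) - V(t, q)`. -/
def lagrangian (t : ℝ) (q : Q) (v : TangentSpace (𝓡 d) q) : ℝ :=
  D.a t q v v / 2 + D.b t q v - D.V t q

/-- `∂L/∂v = a_t(·, v) + b_t`. -/
def momentum (t : ℝ) (q : Q) (v : TangentSpace (𝓡 d) q) : TangentSpace (𝓡 d) q →L[ℝ] ℝ :=
  D.a t q v + D.b t q

/-- `momentum` is the fibre derivative of the Lagrangian. -/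
theorem hasDerivAt_lagrangian (t : ℝ) (q : Q) (v w : TangentSpace (𝓡 d) q) :
    HasDerivAt (fun s : ℝ => D.lagrangian t q (v + s • w)) (D.momentum t q v w) 0 := by
  have h : (fun s : ℝ => D.lagrangian t q (v + s • w)) = fun s : ℝ =>
      D.lagrangian t q v + s * D.momentum t q v w + s ^ 2 * (D.a t q w w / 2) := by
    funext s
    simp only [lagrangian, momentum, map_add, map_smul, add_apply,
      smul_apply, smul_eq_mul, D.a_symm t q w v]
    ring
  rw [h]
  have h1 := ((hasDerivAt_id (0 : ℝ)).mul_const (D.momentum t q v w)).const_add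
    (D.lagrangian t q v)
  have h2 := ((hasDerivAt_id (0 : ℝ)).pow 2).mul_const (D.a t q w w / 2)
  refine ((h1.add h2).congr_deriv ?_).congr_of_eventuallyEq (Eventually.of_forall fun s => ?_)
  · simp
  · simp

/-- The metric `a_t` at `q` identifies vectors with covectors. -/
theorem isInvertible_a (t : ℝ) (q : Q) : (D.a t q).IsInvertible := by
  have hinj : Function.Injective (D.a t q) := by
    rw [injective_iff_map_eq_zero]
    intro v hv
    by_contra hne
    have := D.a_pos t q v hne
    rw [hv] at this
    simp at this
  exact isInvertible_of_injective (E := EuclideanSpace ℝ (Fin d)) (D.a t q) hinj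

/-- The inverse of `v ↦ a_t(v, ·)`. -/
def sharp (t : ℝ) (q : Q) (p : TangentSpace (𝓡 d) q →L[ℝ] ℝ) : TangentSpace (𝓡 d) q :=
  (D.a t q).inverse p

/-- `sharp` inverts `v ↦ a_t(v, ·)`. -/
theorem a_sharp (t : ℝ) (q : Q) (p : TangentSpace (𝓡 d) q →L[ℝ] ℝ) :
    D.a t q (D.sharp t q p) = p := by
  obtain ⟨e, he⟩ := D.isInvertible_a t q
  simp [sharp, ← he]

/-- `H(t, q, p) = a_t⁻¹(p - b_t, p - b_t)/2 + V(t, q)`. -/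
def hamiltonian (t : ℝ) (q : Q) (p : TangentSpace (𝓡 d) q →L[ℝ] ℝ) : ℝ :=
  (p - D.b t q) (D.sharp t q (p - D.b t q)) / 2 + D.V t q

/-- The action `∫_{t₀}^{t₁} L(t, c(t), ċ(t)) dt` of a `C¹` curve `c : [t₀, t₁] → Q`. -/
def action (t₀ t₁ : ℝ) (c : ℝ → Q) : ℝ :=
  ∫ t in t₀..t₁, D.lagrangian t (c t) (velocityOn t₀ t₁ c t)

/-- The Lagrangian in the preferred chart of `Q` around `z`. -/
def chartLagrangian (z : Q) (t : ℝ) (x ξ : EuclideanSpace ℝ (Fin d)) : ℝ :=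
  D.lagrangian t ((extChartAt (𝓡 d) z).symm x)
    (mfderiv (𝓡 d) (𝓡 d) (extChartAt (𝓡 d) z).symm x ξ)

/-- `c` is a solution on the open interval `A ⊆ J` of the Euler-Lagrange equations
`d/dt (∂L/∂v) = ∂L/∂x`, in every chart. -/
def IsELSolution (J A : Set ℝ) (c : ℝ → Q) : Prop :=
  IsOpenSubinterval J A ∧ ContMDiffOn 𝓘(ℝ, ℝ) (𝓡 d) 2 c A ∧
  ∀ z : Q, ∀ t ∈ A, c t ∈ (extChartAt (𝓡 d) z).source →
    HasDerivAt
      (fun s => fderiv ℝ (D.chartLagrangian z s (extChartAt (𝓡 d) z (c s)))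
        (deriv (fun s' => extChartAt (𝓡 d) z (c s')) s))
      (fderiv ℝ (fun x => D.chartLagrangian z t x
          (deriv (fun s' => extChartAt (𝓡 d) z (c s')) t))
        (extChartAt (𝓡 d) z (c t))) t

/-- A solution of the Euler-Lagrange equations that cannot be extended within `J × Q`. -/
def IsMaximalELSolution (J A : Set ℝ) (c : ℝ → Q) : Prop :=
  D.IsELSolution J A c ∧
  ∀ A' c', D.IsELSolution J A' c' → A ⊆ A' → EqOn c c' A → A' = A

/-- The Euler-Lagrange flow on `J × Q` is complete on `[t₀, t₁] ⊆ J`: a maximal solution that is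
defined at some time of `[t₀, t₁]` is defined at all times of `[t₀, t₁]`. -/
def IsELCompleteOn (J : Set ℝ) (t₀ t₁ : ℝ) : Prop :=
  ∀ A c, D.IsMaximalELSolution J A c → (A ∩ Icc t₀ t₁).Nonempty → Icc t₀ t₁ ⊆ A

/-- `c` minimizes the action between any two of its points, among `C¹` curves. -/
def IsActionMinimizing (A : Set ℝ) (c : ℝ → Q) : Prop :=
  ∀ t₀ ∈ A, ∀ t₁ ∈ A, t₀ < t₁ → ∀ c' : ℝ → Q, IsC1CurveOn d t₀ t₁ c' →
    c' t₀ = c t₀ → c' t₁ = c t₁ → D.action t₀ t₁ c ≤ D.action t₀ t₁ c'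

/-- `c` is a characteristic of `u` on the open interval `A ⊆ J`: a `C¹` curve along which
`∂L/∂v = ∂u/∂q`. -/
def IsCharacteristic (J : Set ℝ) (u : ℝ × Q → ℝ) (A : Set ℝ) (c : ℝ → Q) : Prop :=
  IsOpenSubinterval J A ∧ ContMDiffOn 𝓘(ℝ, ℝ) (𝓡 d) 1 c A ∧
  ∀ t ∈ A, D.momentum t (c t) (velocity c t) = spaceDeriv u t (c t)

/-- `u` satisfies `∂u/∂t + H(t, q, ∂u/∂q) = 0` on `J × Q`. -/
def IsHJSolution (J : Set ℝ) (u : ℝ × Q → ℝ) : Prop :=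
  ∀ t ∈ J, ∀ q : Q, timeDeriv u t q + D.hamiltonian t q (spaceDeriv u t q) = 0

/-- `u` satisfies `∂u/∂t + H(t, q, ∂u/∂q) ≤ 0` on `J × Q`. -/
def IsHJSubsolution (J : Set ℝ) (u : ℝ × Q → ℝ) : Prop :=
  ∀ t ∈ J, ∀ q : Q, timeDeriv u t q + D.hamiltonian t q (spaceDeriv u t q) ≤ 0

/-- The values `u(t₀, c(t₀)) + ∫_{t₀}^{t₁} L(t, c, ċ) dt`, for the `C¹` curves
`c : [t₀, t₁] → Q` with `c(t₁) = q₁`. -/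
def laxOleinikValues (u : ℝ × Q → ℝ) (t₀ t₁ : ℝ) (q₁ : Q) : Set ℝ :=
  {s | ∃ c : ℝ → Q, IsC1CurveOn d t₀ t₁ c ∧ c t₁ = q₁ ∧ s = u (t₀, c t₀) + D.action t₀ t₁ c}

/-! ### Geometry of the spacetime -/

/-- The metric `g = a_t - dt ⊗ (dy - b_t) - (dy - b_t) ⊗ dt - 2 V dt²`. -/
def g (x : Spacetime Q) (w z : Tangent d x) : ℝ :=
  D.a x.1 x.2.1 (qPart w) (qPart z)
    - tPart w * (yPart z - D.b x.1 x.2.1 (qPart z))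
    - (yPart w - D.b x.1 x.2.1 (qPart w)) * tPart z
    - 2 * D.V x.1 x.2.1 * tPart w * tPart z

/-- The timelike vector field `W = ∂_t - (V - 1/2) ∂_y`, which defines the time orientation. -/
def orientation (x : Spacetime Q) : Tangent d x :=
  (show ModelSpace d from (1, 0, -(D.V x.1 x.2.1 - 1 / 2)))

/-- Future directed timelike vectors. -/
def IsFutureTimelike {x : Spacetime Q} (w : Tangent d x) : Prop :=
  D.g x w w < 0 ∧ D.g x (D.orientation x) w < 0

/-- Future directed lightlike vectors. -/
def IsFutureLightlike {x : Spacetime Q} (w : Tangent d x) : Prop :=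
  w ≠ 0 ∧ D.g x w w = 0 ∧ D.g x (D.orientation x) w < 0

/-- `x ≪ y`: there is a future directed timelike `C¹` curve from `x` to `y`. -/
def ChronologicallyPrecedes (x y : Spacetime Q) : Prop :=
  ∃ (s₀ s₁ : ℝ) (γ : ℝ → Spacetime Q), s₀ < s₁ ∧
    ContMDiffOn 𝓘(ℝ, ℝ) (model d) 1 γ (Icc s₀ s₁) ∧ γ s₀ = x ∧ γ s₁ = y ∧
    ∀ s ∈ Icc s₀ s₁, D.IsFutureTimelike (spVelocityOn s₀ s₁ γ s)

/-- No two points of `X` are chronologically related. -/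
def IsAchronal (X : Set (Spacetime Q)) : Prop :=
  ∀ x ∈ X, ∀ y ∈ X, ¬ D.ChronologicallyPrecedes x y

/-- The coefficients of `g` in the preferred chart of `M` around `z`. -/
def chartMetric (z : Spacetime Q) (x w w' : ModelSpace d) : ℝ :=
  D.g ((extChartAt (model d) z).symm x)
    (mfderiv 𝓘(ℝ, ModelSpace d) (model d) (extChartAt (model d) z).symm x w)
    (mfderiv 𝓘(ℝ, ModelSpace d) (model d) (extChartAt (model d) z).symm x w')

/-- `γ` is an (affinely parametrized) geodesic of `g`, defined on the open interval `A` and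
contained in `J × Q × ℝ`. In a chart with metric coefficients `G` the equation is
`G_{kl} ẍ^k + (∂_i G_{jl} + ∂_j G_{il} - ∂_l G_{ij}) ẋ^i ẋ^j / 2 = 0` for every `l`, that is,
`g(∇_γ' γ', ·) = 0` for the Levi-Civita connection; the index `l` is contracted with `w`. -/
def IsGeodesic (J A : Set ℝ) (γ : ℝ → Spacetime Q) : Prop :=
  IsOpenSubinterval univ A ∧ MapsTo γ A (slab J) ∧
  ContMDiffOn 𝓘(ℝ, ℝ) (model d) 2 γ A ∧
  ∀ z : Spacetime Q, ∀ s ∈ A, γ s ∈ (extChartAt (model d) z).source →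
    let x : ℝ → ModelSpace d := fun s' => extChartAt (model d) z (γ s')
    ∀ w : ModelSpace d,
      D.chartMetric z (x s) (deriv (deriv x) s) w
        + fderiv ℝ (fun x' => D.chartMetric z x' (deriv x s) w) (x s) (deriv x s)
        - fderiv ℝ (fun x' => D.chartMetric z x' (deriv x s) (deriv x s)) (x s) w / 2 = 0

/-- A future directed lightlike geodesic that cannot be extended as a geodesic within
`J × Q × ℝ`. -/
def IsInextendibleLightlikeGeodesic (J A : Set ℝ) (γ : ℝ → Spacetime Q) : Prop :=
  D.IsGeodesic J A γ ∧ (∀ s ∈ A, D.IsFutureLightlike (spVelocity γ s)) ∧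
  ∀ A' γ', D.IsGeodesic J A' γ' → A ⊆ A' → EqOn γ γ' A → A' = A

/-- The hypersurface `S` is lightlike: the metric induced on each tangent space is degenerate. -/
def IsLightlikeHypersurface (S : Set (Spacetime Q)) : Prop :=
  ∀ x ∈ S, ∃ w ∈ tangentVectors S x, w ≠ 0 ∧ ∀ z ∈ tangentVectors S x, D.g x w z = 0

/-- The hypersurface `S` has causal normals: any nonzero vector orthogonal to a tangent space is
timelike or lightlike. -/
def HasCausalNormals (S : Set (Spacetime Q)) : Prop :=
  ∀ x ∈ S, ∀ w : Tangent d x, w ≠ 0 → (∀ z ∈ tangentVectors S x, D.g x w z = 0) →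
    D.g x w w ≤ 0

end MechanicalData

end Brinkmann

end

open Brinkmann

/-! The proof rests on one completed square. Let X = a⁻¹(∂_q u − b) (`charField`). Then L(t,q,v) −
∂_t u − ∂_q u(v) = a(v − X, v − X)/2 − (∂_t u + H) (`lagrangian_add_hamiltonian`). If u solves the
Hamilton-Jacobi equation, u grows along a curve at most at the rate L, with equality exactly for
velocity X. Integration gives the upper bound by the action and its equality case (`sub_le_action`,
`eq_action_iff`). The same inequality makes y − u strictly increase along future timelike curves, so
the graph, where y − u = 0, is achronal (`isAchronal_graph`). On the geometric side, the normals of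
the graph are the multiples of a vector (1, X, ·) whose square is 2(∂_t u + H)
(`orthogonal_graph_iff`, `g_normal`); this characterizes lightlike graphs and graphs with causal
normals. A hypersurface transverse to n projects locally diffeomorphically to ℝ × Q by the inverse
function theorem, hence is a graph (`exists_graph`).

The difficulty is that u is only C¹, so X is merely continuous. Integral curves exist by Peano's
theorem, but uniqueness is not automatic. It is recovered by `hasDerivAt_spaceDeriv_of_calibrated`:
along an integral curve the difference of u between the shifted and the original curve changes at
most at the rate of the corresponding difference of L. Dividing by the shift and using opposite
directions shows that ∂_q u is differentiable along the curve, with derivative ∂L/∂x. Integral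
curves are thus C² solutions of the Euler-Lagrange equations, and since their velocity is a function
of the position, they are determined by one point. They are glued to a maximal characteristic; an
Euler-Lagrange extension of a characteristic is again one (`isCharacteristic_of_isELSolution`), so
it is also maximal as an Euler-Lagrange solution.

Finally the lift (t, c, u(t,c)) has y-velocity L, which makes it lightlike and, by a coordinate
computation, geodesic. The ∂_y component of the geodesic equation says that t is affine, so any
geodesic extension projects to an Euler-Lagrange extension; hence the lift is inextendible. -/

noncomputable section

namespace Brinkmann

/-! ### Existence of solutions of ordinary differential equations with continuous right-hand side -/

section Peano

variable {E : Type*} [NormedAddCommGroup E] [NormedSpace ℝ E] [FiniteDimensional ℝ E]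

/-- A smooth bounded time dependent vector field has solutions on any given time interval. -/
theorem exists_solution_of_contDiff {g : ℝ × E → E} (hg : ContDiff ℝ 1 g) {C : ℝ}
    (hC : ∀ p, ‖g p‖ ≤ C) (t₀ : ℝ) (x₀ : E) :
    ∃ x : ℝ → E, x t₀ = x₀ ∧
      ∀ t ∈ Icc (t₀ - 1) (t₀ + 1),
        HasDerivWithinAt x (g (t, x t)) (Icc (t₀ - 1) (t₀ + 1)) t := by
  have hC0 : 0 ≤ C := (norm_nonneg _).trans (hC (t₀, x₀))
  set K : Set (ℝ × E) := Icc (t₀ - 1) (t₀ + 1) ×ˢ Metric.closedBall x₀ C with hK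
  have hKc : IsCompact K := isCompact_Icc.prod (isCompact_closedBall _ _)
  have hKconv : Convex ℝ K := (convex_Icc _ _).prod (convex_closedBall _ _)
  obtain ⟨B, hB⟩ := hKc.exists_bound_of_continuousOn
    (hg.continuous_fderiv one_ne_zero).continuousOn
  have hlip : LipschitzOnWith B.toNNReal g K :=
    hKconv.lipschitzOnWith_of_nnnorm_fderiv_le
      (fun p _ => (hg.differentiable one_ne_zero) p)
      (fun p hp => by
        rw [← NNReal.coe_le_coe, coe_nnnorm]
        exact (hB p hp).trans (Real.le_coe_toNNReal B))
  have hmem : t₀ ∈ Icc (t₀ - 1) (t₀ + 1) := by constructor <;> linarith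
  -- In unit time a solution moves by at most C, so a ball of radius C is large enough for the time
  -- interval of half-length 1.
  have hPL : IsPicardLindelof (fun t x => g (t, x)) ⟨t₀, hmem⟩ x₀ C.toNNReal 0 C.toNNReal
      B.toNNReal := by
    refine ⟨fun t ht => ?_, fun x _ => ?_, fun t _ x _ => ?_, ?_⟩
    · intro x hx y hy
      rw [Real.coe_toNNReal C hC0] at hx hy
      have := hlip (x := (t, x)) ⟨ht, hx⟩ (y := (t, y)) ⟨ht, hy⟩
      simpa [Prod.edist_eq] using this
    · exact (hg.continuous.comp (by fun_prop)).continuousOn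
    · rw [Real.coe_toNNReal C hC0]
      exact hC _
    · simp
  exact hPL.exists_eq_forall_mem_Icc_hasDerivWithinAt₀

/-- **Peano's theorem** for a bounded uniformly continuous vector field. -/
theorem exists_solution_of_uniformContinuous {f : ℝ × E → E} (hf : UniformContinuous f) {C : ℝ}
    (hC : ∀ p, ‖f p‖ ≤ C) (t₀ : ℝ) (x₀ : E) :
    ∃ x : ℝ → E, x t₀ = x₀ ∧
      ∀ t ∈ Ioo (t₀ - 1) (t₀ + 1), HasDerivAt x (f (t, x t)) t := by
  set I := Icc (t₀ - 1) (t₀ + 1) with hI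
  have hmem : t₀ ∈ I := by constructor <;> linarith
  have hC0 : 0 ≤ C := (norm_nonneg _).trans (hC (t₀, x₀))
  -- Smooth fields within 1/(n+1) of f are solved by Picard-Lindelöf; their solutions share the
  -- Lipschitz constant C + 1, and Arzelà-Ascoli extracts a uniform limit.
  choose g hg hgf using fun n : ℕ => hf.exists_contDiff_dist_le (Nat.one_div_pos_of_nat (n := n))
  have hgC : ∀ n p, ‖g n p‖ ≤ C + 1 := fun n p => by
    have h1 := (hgf n p).le
    rw [dist_eq_norm] at h1
    have h2 : (1 : ℝ) / (n + 1) ≤ 1 := by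
      rw [div_le_one (by positivity)]; linarith [n.cast_nonneg (α := ℝ)]
    calc ‖g n p‖ = ‖(g n p - f p) + f p‖ := by simp
      _ ≤ _ := norm_add_le _ _
      _ ≤ _ := by linarith [hC p]
  choose x hx0 hx using fun n => exists_solution_of_contDiff
    ((hg n).of_le (by exact_mod_cast le_top)) (hgC n) t₀ x₀
  have hxc : ∀ n, ContinuousOn (x n) I := fun n t ht => (hx n t ht).continuousWithinAt
  have hxl : ∀ n, LipschitzOnWith (C + 1).toNNReal (x n) I := fun n =>
    (convex_Icc _ _).lipschitzOnWith_of_nnnorm_hasDerivWithin_le (fun t ht => hx n t ht)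
      (fun t _ => by
        rw [← NNReal.coe_le_coe, coe_nnnorm, Real.coe_toNNReal _ (by linarith)]
        exact hgC _ _)
  let F : ℕ → C(I, E) := fun n => ⟨I.domRestrict (x n), (hxc n).domRestrict⟩
  let S : Set C(I, E) := {φ | φ ⟨t₀, hmem⟩ = x₀ ∧ LipschitzWith (C + 1).toNNReal φ}
  have hFS : ∀ n, F n ∈ S := fun n => ⟨hx0 n, (hxl n).to_restrict⟩
  have hS : IsCompact S := by
    refine ArzelaAscoli.isCompact_of_equicontinuous S ?_ ?_
    · have himg : ContinuousMap.toFun '' S =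
          {φ : I → E | φ ⟨t₀, hmem⟩ = x₀ ∧ LipschitzWith (C + 1).toNNReal φ} := by
        ext φ
        constructor
        · rintro ⟨ψ, hψ, rfl⟩
          exact hψ
        · rintro ⟨h1, h2⟩
          exact ⟨⟨φ, h2.continuous⟩, ⟨h1, h2⟩, rfl⟩
      rw [himg]
      refine IsCompact.of_isClosed_subset
        (isCompact_univ_pi fun _ : I => isCompact_closedBall x₀ (C + 1)) ?_ ?_
      · have : {φ : I → E | φ ⟨t₀, hmem⟩ = x₀ ∧ LipschitzWith (C + 1).toNNReal φ} =
            {φ : I → E | φ ⟨t₀, hmem⟩ = x₀} ∩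
              ⋂ (s : I) (t : I), {φ : I → E | dist (φ s) (φ t) ≤ (C + 1).toNNReal * dist s t} := by
          ext φ
          simp [lipschitzWith_iff_dist_le_mul]
        rw [this]
        refine (isClosed_eq (by fun_prop) (by fun_prop)).inter ?_
        exact isClosed_iInter fun s => isClosed_iInter fun t =>
          isClosed_le (by fun_prop) (by fun_prop)
      · rintro φ ⟨h1, h2⟩ t -
        rw [Metric.mem_closedBall, ← h1]
        refine (h2.dist_le_mul _ _).trans ?_
        rw [Real.coe_toNNReal _ (by linarith)]
        have ht : dist t ⟨t₀, hmem⟩ ≤ 1 := by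
          rw [Subtype.dist_eq, Real.dist_eq, abs_le]
          have := t.2
          simp only [hI, mem_Icc] at this
          constructor <;> linarith
        nlinarith
    · exact LipschitzWith.uniformEquicontinuous _ (C + 1).toNNReal (fun φ => φ.2.2)
        |>.equicontinuous
  obtain ⟨φ, hφS, ψ, hψ, hlim⟩ := hS.tendsto_subseq hFS
  have hunif : TendstoUniformlyOn (fun n t => x (ψ n) t) (IccExtend (by linarith : t₀ - 1 ≤ t₀ + 1) φ)
      atTop I := by
    rw [Metric.tendstoUniformlyOn_iff]
    intro ε hε
    filter_upwards [Metric.tendsto_nhds.1 hlim ε hε] with n hn t ht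
    have := (ContinuousMap.dist_lt_iff hε).1 hn ⟨t, ht⟩
    rw [IccExtend_of_mem _ _ ht, dist_comm]
    exact this
  refine ⟨IccExtend (by linarith : t₀ - 1 ≤ t₀ + 1) φ, ?_, ?_⟩
  · rw [IccExtend_of_mem _ _ hmem]
    exact hφS.1
  · intro t ht
    -- The derivatives also converge uniformly, by the uniform approximation of f and its uniform
    -- continuity, so the limit can be differentiated.
    refine hasDerivAt_of_tendstoUniformlyOn (l := atTop) (f := fun n t => x (ψ n) t)
      (f' := fun n t => g (ψ n) (t, x (ψ n) t))
      (g' := fun t => f (t, IccExtend (by linarith : t₀ - 1 ≤ t₀ + 1) φ t)) isOpen_Ioo ?_ ?_ ?_ ht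
    · rw [Metric.tendstoUniformlyOn_iff]
      intro ε hε
      obtain ⟨δ, hδ, hδf⟩ := Metric.uniformContinuous_iff.1 hf (ε / 2) (half_pos hε)
      have h1 : ∀ᶠ n : ℕ in atTop, 1 / ((ψ n : ℝ) + 1) < ε / 2 :=
        ((tendsto_one_div_add_atTop_nhds_zero_nat (𝕜 := ℝ)).comp hψ.tendsto_atTop).eventually_lt_const
          (half_pos hε)
      filter_upwards [h1, Metric.tendstoUniformlyOn_iff.1 hunif δ hδ] with n h1 h2 s hs
      have h3 := h2 s (Ioo_subset_Icc_self hs)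
      have h4 : dist (f (s, IccExtend (by linarith : t₀ - 1 ≤ t₀ + 1) φ s))
          (f (s, x (ψ n) s)) < ε / 2 := hδf (by simpa [Prod.dist_eq, hδ] using h3)
      have h5 := (hgf (ψ n) (s, x (ψ n) s)).trans h1
      rw [dist_comm] at h5
      exact (dist_triangle _ _ _).trans_lt (by linarith)
    · refine Eventually.of_forall fun n s hs => ?_
      exact (hx (ψ n) s (Ioo_subset_Icc_self hs)).hasDerivAt (Icc_mem_nhds hs.1 hs.2)
    · intro s hs
      exact hunif.tendsto_at (Ioo_subset_Icc_self hs)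

/-- **Peano's theorem**: local existence of solutions of `x' = f(t, x)` for continuous `f`. -/
theorem exists_hasDerivAt_of_continuousOn {f : ℝ × E → E} {Ω : Set (ℝ × E)} (hΩ : IsOpen Ω)
    (hf : ContinuousOn f Ω) {t₀ : ℝ} {x₀ : E} (h : (t₀, x₀) ∈ Ω) :
    ∃ x : ℝ → E, x t₀ = x₀ ∧ ∀ᶠ t in 𝓝 t₀, (t, x t) ∈ Ω ∧ HasDerivAt x (f (t, x t)) t := by
  obtain ⟨R, hR, hRΩ⟩ := Metric.isOpen_iff.1 hΩ _ h
  -- The cut-off makes the field bounded and uniformly continuous on the whole space without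
  -- changing it near the initial point.
  let χ : ContDiffBump ((t₀, x₀) : ℝ × E) := ⟨R / 4, R / 2, by linarith, by linarith⟩
  have htsupp : tsupport χ ⊆ Ω := by
    rw [χ.tsupport_eq]
    exact (Metric.closedBall_subset_ball (by simp only [χ]; linarith)).trans hRΩ
  have hcont : Continuous fun p => χ p • f p := by
    rw [continuous_iff_continuousAt]
    intro p
    by_cases hp : p ∈ Ω
    · exact χ.continuous.continuousAt.smul (hf.continuousAt (hΩ.mem_nhds hp))
    · have : (fun p => χ p • f p) =ᶠ[𝓝 p] fun _ => 0 := by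
        filter_upwards [(isClosed_tsupport χ).isOpen_compl.mem_nhds fun hp' => hp (htsupp hp')]
          with p' hp'
        rw [image_eq_zero_of_notMem_tsupport hp', zero_smul]
      exact continuousAt_const.congr this.symm
  have hsupp : HasCompactSupport fun p => χ p • f p := χ.hasCompactSupport.smul_right
  obtain ⟨C, hC⟩ := hsupp.exists_bound_of_continuous hcont
  obtain ⟨x, hx0, hx⟩ := exists_solution_of_uniformContinuous
    (hsupp.uniformContinuous_of_continuous hcont) hC t₀ x₀
  refine ⟨x, hx0, ?_⟩
  have hmem : t₀ ∈ Ioo (t₀ - 1) (t₀ + 1) := by constructor <;> linarith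
  have hxc : ContinuousAt (fun t => (t, x t)) t₀ := continuousAt_id.prodMk (hx t₀ hmem).continuousAt
  have hnear : ∀ᶠ p in 𝓝 (t₀, x t₀), p ∈ Metric.closedBall ((t₀, x₀) : ℝ × E) (R / 4) := by
    rw [hx0]
    exact Metric.closedBall_mem_nhds _ (by linarith)
  filter_upwards [hxc.eventually hnear, isOpen_Ioo.mem_nhds hmem] with t ht ht'
  refine ⟨hRΩ (Metric.closedBall_subset_ball (by linarith) ht), ?_⟩
  have := hx t ht'
  rwa [χ.one_of_mem_closedBall ht, one_smul] at this

end Peano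
end Brinkmann

/-! ### Mechanics on an open subset of a vector space -/

namespace Brinkmann

/-- A time dependent metric, 1-form and potential on an open subset of a vector space. -/
structure LocalSystem (E : Type*) [NormedAddCommGroup E] [NormedSpace ℝ E] where
  U : Set E
  isOpen_U : IsOpen U
  a : ℝ → E → E →L[ℝ] E →L[ℝ] ℝ
  b : ℝ → E → E →L[ℝ] ℝ
  V : ℝ → E → ℝ
  a_symm : ∀ t x ξ η, a t x ξ η = a t x η ξ
  a_pos : ∀ t, ∀ x ∈ U, ∀ ξ ≠ 0, 0 < a t x ξ ξ
  a_smooth : ContDiffOn ℝ 2 (fun p : ℝ × E => a p.1 p.2) (univ ×ˢ U)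
  b_smooth : ContDiffOn ℝ 2 (fun p : ℝ × E => b p.1 p.2) (univ ×ˢ U)
  V_smooth : ContDiffOn ℝ 2 (fun p : ℝ × E => V p.1 p.2) (univ ×ˢ U)

namespace LocalSystem

variable {E : Type*} [NormedAddCommGroup E] [NormedSpace ℝ E] (S : LocalSystem E)

/-- The Lagrangian. -/
def lagrangian (t : ℝ) (x ξ : E) : ℝ := S.a t x ξ ξ / 2 + S.b t x ξ - S.V t x

/-- The fibre derivative of the Lagrangian. -/
def momentum (t : ℝ) (x ξ : E) : E →L[ℝ] ℝ := S.a t x ξ + S.b t x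

/-- The derivative of the Lagrangian with respect to the position. -/
def force (t : ℝ) (x ξ : E) : E →L[ℝ] ℝ := fderiv ℝ (fun x' => S.lagrangian t x' ξ) x

/-- The velocity with given momentum. -/
def velocityOf (t : ℝ) (x : E) (p : E →L[ℝ] ℝ) : E := (S.a t x).inverse (p - S.b t x)

/-- The Euler-Lagrange equation at time `t`. -/
def EulerLagrangeAt (x : ℝ → E) (t : ℝ) : Prop :=
  HasDerivAt (fun s => S.momentum s (x s) (deriv x s)) (S.force t (x t) (deriv x t)) t

theorem fderiv_lagrangian (t : ℝ) (x ξ : E) :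
    fderiv ℝ (S.lagrangian t x) ξ = S.momentum t x ξ := by
  have h1 : HasFDerivAt (fun ξ => S.a t x ξ ξ) _ ξ :=
    (S.a t x).hasFDerivAt.clm_apply (hasFDerivAt_id ξ)
  have h2 := ((h1.const_mul 2⁻¹).add (S.b t x).hasFDerivAt).sub_const (S.V t x)
  have h3 : S.lagrangian t x = fun ξ => 2⁻¹ * S.a t x ξ ξ + S.b t x ξ - S.V t x := by
    funext ξ
    simp only [lagrangian]
    ring
  rw [h3]
  refine h2.fderiv.trans ?_
  ext η
  simp [momentum, S.a_symm t x η ξ]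
  ring

theorem isOpen_U_prod : IsOpen ((univ : Set ℝ) ×ˢ S.U) := isOpen_univ.prod S.isOpen_U

theorem isOpen_phase {F : Type*} [TopologicalSpace F] :
    IsOpen ((univ : Set ℝ) ×ˢ S.U ×ˢ (univ : Set F)) :=
  isOpen_univ.prod (S.isOpen_U.prod isOpen_univ)

theorem contDiffOn_a_phase {F : Type*} [NormedAddCommGroup F] [NormedSpace ℝ F] :
    ContDiffOn ℝ 2 (fun p : ℝ × E × F => S.a p.1 p.2.1) (univ ×ˢ S.U ×ˢ univ) :=
  S.a_smooth.comp (f := fun p : ℝ × E × F => (p.1, p.2.1)) (by fun_prop)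
    fun _ hp => ⟨mem_univ _, hp.2.1⟩

theorem contDiffOn_b_phase {F : Type*} [NormedAddCommGroup F] [NormedSpace ℝ F] :
    ContDiffOn ℝ 2 (fun p : ℝ × E × F => S.b p.1 p.2.1) (univ ×ˢ S.U ×ˢ univ) :=
  S.b_smooth.comp (f := fun p : ℝ × E × F => (p.1, p.2.1)) (by fun_prop)
    fun _ hp => ⟨mem_univ _, hp.2.1⟩

theorem contDiffOn_V_phase {F : Type*} [NormedAddCommGroup F] [NormedSpace ℝ F] :
    ContDiffOn ℝ 2 (fun p : ℝ × E × F => S.V p.1 p.2.1) (univ ×ˢ S.U ×ˢ univ) :=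
  S.V_smooth.comp (f := fun p : ℝ × E × F => (p.1, p.2.1)) (by fun_prop)
    fun _ hp => ⟨mem_univ _, hp.2.1⟩

theorem contDiffOn_lagrangian :
    ContDiffOn ℝ 2 (fun p : ℝ × E × E => S.lagrangian p.1 p.2.1 p.2.2)
      (univ ×ˢ S.U ×ˢ univ) := by
  have hv : ContDiffOn ℝ 2 (fun p : ℝ × E × E => p.2.2) (univ ×ˢ S.U ×ˢ univ) := by fun_prop
  exact ((((S.contDiffOn_a_phase.clm_apply hv).clm_apply hv).div_const 2).add
    (S.contDiffOn_b_phase.clm_apply hv)).sub S.contDiffOn_V_phase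

/-- Writing the partial derivative as a restriction of the joint one lets joint regularity of the
Lagrangian pass to `force`. -/
theorem hasFDerivAt_lagrangian_position {t : ℝ} {x : E} (hx : x ∈ S.U) (ξ : E) :
    HasFDerivAt (fun x' => S.lagrangian t x' ξ)
      ((fderiv ℝ (fun p : ℝ × E × E => S.lagrangian p.1 p.2.1 p.2.2) (t, x, ξ)).comp
        ((ContinuousLinearMap.inr ℝ ℝ (E × E)).comp (ContinuousLinearMap.inl ℝ E E))) x := by
  have hmem : (t, x, ξ) ∈ (univ : Set ℝ) ×ˢ S.U ×ˢ (univ : Set E) := ⟨mem_univ _, hx, mem_univ _⟩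
  have h1 := ((S.contDiffOn_lagrangian.contDiffAt
    (S.isOpen_phase.mem_nhds hmem)).differentiableAt two_ne_zero).hasFDerivAt
  have h2 : HasFDerivAt (fun x' : E => ((t, x', ξ) : ℝ × E × E))
      ((ContinuousLinearMap.inr ℝ ℝ (E × E)).comp (ContinuousLinearMap.inl ℝ E E)) x := by
    have := (hasFDerivAt_const (𝕜 := ℝ) t x).prodMk
      ((hasFDerivAt_id (𝕜 := ℝ) x).prodMk (hasFDerivAt_const (𝕜 := ℝ) ξ x))
    refine this.congr_fderiv ?_
    ext v <;> simp
  exact h1.comp x h2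

theorem force_eq {t : ℝ} {x : E} (hx : x ∈ S.U) (ξ : E) :
    S.force t x ξ = (fderiv ℝ (fun p : ℝ × E × E => S.lagrangian p.1 p.2.1 p.2.2) (t, x, ξ)).comp
        ((ContinuousLinearMap.inr ℝ ℝ (E × E)).comp (ContinuousLinearMap.inl ℝ E E)) :=
  (S.hasFDerivAt_lagrangian_position hx ξ).fderiv

theorem hasFDerivAt_force {t : ℝ} {x : E} (hx : x ∈ S.U) (ξ : E) :
    HasFDerivAt (fun x' => S.lagrangian t x' ξ) (S.force t x ξ) x :=
  (S.hasFDerivAt_lagrangian_position hx ξ).differentiableAt.hasFDerivAt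

/-- One of the two derivatives of the Lagrangian is spent; the remaining one makes the Hamiltonian
field locally Lipschitz. -/
theorem contDiffOn_force :
    ContDiffOn ℝ 1 (fun p : ℝ × E × E => S.force p.1 p.2.1 p.2.2)
      (univ ×ˢ S.U ×ˢ univ) := by
  have h1 : ContDiffOn ℝ 1 (fderiv ℝ (fun p : ℝ × E × E => S.lagrangian p.1 p.2.1 p.2.2))
      (univ ×ˢ S.U ×ˢ univ) :=
    S.contDiffOn_lagrangian.fderiv_of_isOpen S.isOpen_phase (by norm_num [one_add_one_eq_two])
  refine (h1.clm_comp (contDiffOn_const (c := ((ContinuousLinearMap.inr ℝ ℝ (E × E)).comp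
    (ContinuousLinearMap.inl ℝ E E))))).congr fun p hp => ?_
  exact S.force_eq hp.2.1 _

variable [FiniteDimensional ℝ E]

theorem isInvertible_a {x : E} (hx : x ∈ S.U) (t : ℝ) : (S.a t x).IsInvertible := by
  refine isInvertible_of_injective _ ?_
  rw [injective_iff_map_eq_zero]
  intro v hv
  by_contra hne
  have := S.a_pos t x hx v hne
  rw [hv] at this
  simp at this

/-- The Legendre transform is invertible because the metric is. This turns the Euler-Lagrange
equation into a first order system for position and momentum. -/
theorem velocityOf_momentum {x : E} (hx : x ∈ S.U) (t : ℝ) (ξ : E) :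
    S.velocityOf t x (S.momentum t x ξ) = ξ := by
  obtain ⟨e, he⟩ := S.isInvertible_a hx t
  simp [velocityOf, momentum, ← he]

theorem momentum_velocityOf {x : E} (hx : x ∈ S.U) (t : ℝ) (p : E →L[ℝ] ℝ) :
    S.momentum t x (S.velocityOf t x p) = p := by
  obtain ⟨e, he⟩ := S.isInvertible_a hx t
  simp [velocityOf, momentum, ← he]

theorem contDiffOn_velocityOf :
    ContDiffOn ℝ 2 (fun p : ℝ × E × (E →L[ℝ] ℝ) => S.velocityOf p.1 p.2.1 p.2.2)
      (univ ×ˢ S.U ×ˢ univ) := by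
  have hv : ContDiffOn ℝ 2 (fun p : ℝ × E × (E →L[ℝ] ℝ) => p.2.2) (univ ×ˢ S.U ×ˢ univ) := by
    fun_prop
  have hinv : ContDiffOn ℝ 2 (fun p : ℝ × E × (E →L[ℝ] ℝ) => (S.a p.1 p.2.1).inverse)
      (univ ×ˢ S.U ×ˢ univ) := fun p hp =>
    ContDiffAt.comp_contDiffWithinAt (g := ContinuousLinearMap.inverse)
      (f := fun p : ℝ × E × (E →L[ℝ] ℝ) => S.a p.1 p.2.1) p
      (S.isInvertible_a hp.2.1 p.1).contDiffAt_map_inverse (S.contDiffOn_a_phase p hp)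
  exact hinv.clm_apply (hv.sub S.contDiffOn_b_phase)

/-- The Hamiltonian vector field. -/
def hamiltonianField (t : ℝ) (z : E × (E →L[ℝ] ℝ)) : E × (E →L[ℝ] ℝ) :=
  (S.velocityOf t z.1 z.2, S.force t z.1 (S.velocityOf t z.1 z.2))

theorem contDiffOn_hamiltonianField :
    ContDiffOn ℝ 1 (fun p : ℝ × E × (E →L[ℝ] ℝ) => S.hamiltonianField p.1 p.2)
      (univ ×ˢ S.U ×ˢ univ) := by
  have h1 := S.contDiffOn_velocityOf.of_le (m := 1) one_le_two
  refine h1.prodMk (S.contDiffOn_force.comp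
    (f := fun p : ℝ × E × (E →L[ℝ] ℝ) => (p.1, p.2.1, S.velocityOf p.1 p.2.1 p.2.2))
    (contDiffOn_fst.prodMk (ContDiffOn.prodMk (by fun_prop) h1)) ?_)
  exact fun p hp => ⟨mem_univ _, hp.2.1, mem_univ _⟩

variable {S}

/-- Only differentiability of the position and of the momentum enters, so no second derivative of x
has to be known in advance. -/
theorem EulerLagrangeAt.hasDerivAt_hamiltonianField {x : ℝ → E} {t : ℝ} (hU : x t ∈ S.U)
    (hd : DifferentiableAt ℝ x t) (h : S.EulerLagrangeAt x t) :
    HasDerivAt (fun s => (x s, S.momentum s (x s) (deriv x s)))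
      (S.hamiltonianField t (x t, S.momentum t (x t) (deriv x t))) t := by
  have := hd.hasDerivAt.prodMk h
  simpa only [hamiltonianField, S.velocityOf_momentum hU] using this

/-- Solutions of the Euler-Lagrange equations are locally determined by position and velocity. -/
theorem eventuallyEq_of_eulerLagrangeAt {x y : ℝ → E} {t₀ : ℝ}
    (hx : ∀ᶠ t in 𝓝 t₀, x t ∈ S.U ∧ DifferentiableAt ℝ x t ∧ S.EulerLagrangeAt x t)
    (hy : ∀ᶠ t in 𝓝 t₀, y t ∈ S.U ∧ DifferentiableAt ℝ y t ∧ S.EulerLagrangeAt y t)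
    (h0 : x t₀ = y t₀) (h1 : deriv x t₀ = deriv y t₀) : x =ᶠ[𝓝 t₀] y := by
  -- Uniqueness is applied to the phase space curves, whose equation has a C¹ right-hand side.
  set P : (ℝ → E) → ℝ → E × (E →L[ℝ] ℝ) := fun x s => (x s, S.momentum s (x s) (deriv x s))
  have hmem : (t₀, P x t₀) ∈ (univ : Set ℝ) ×ˢ S.U ×ˢ (univ : Set (E →L[ℝ] ℝ)) :=
    ⟨mem_univ _, hx.self_of_nhds.1, mem_univ _⟩
  obtain ⟨K, s, hs, hK⟩ := (S.contDiffOn_hamiltonianField.contDiffAt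
    (S.isOpen_phase.mem_nhds hmem)).exists_lipschitzOnWith
  obtain ⟨I, hI, W, hW, hIW⟩ := mem_nhds_prod_iff.1 hs
  have hcont : ∀ {x : ℝ → E}, x t₀ ∈ S.U ∧ DifferentiableAt ℝ x t₀ ∧ S.EulerLagrangeAt x t₀ →
      ContinuousAt (P x) t₀ := fun h => (h.2.2.hasDerivAt_hamiltonianField h.1 h.2.1).continuousAt
  have hP : P x t₀ = P y t₀ := by simp only [P, h0, h1]
  have key : P x =ᶠ[𝓝 t₀] P y := by
    refine ODE_solution_unique_of_eventually (v := S.hamiltonianField) (s := fun _ => W) (K := K)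
      ?_ ?_ ?_ hP
    · filter_upwards [hI] with t ht z hz z' hz'
      have := hK (hIW (mk_mem_prod ht hz)) (hIW (mk_mem_prod ht hz'))
      simpa [Prod.edist_eq] using this
    · filter_upwards [hx, (hcont hx.self_of_nhds) hW] with t ht ht'
      exact ⟨ht.2.2.hasDerivAt_hamiltonianField ht.1 ht.2.1, ht'⟩
    · filter_upwards [hy, (hcont hy.self_of_nhds) (by rwa [← hP])] with t ht ht'
      exact ⟨ht.2.2.hasDerivAt_hamiltonianField ht.1 ht.2.1, ht'⟩
  filter_upwards [key] with t ht using congrArg Prod.fst ht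

/-- Differentiable solutions of the Euler-Lagrange equations are `C²`. -/
theorem contDiffOn_of_eulerLagrangeAt {x : ℝ → E} {O : Set ℝ} (hO : IsOpen O)
    (hx : ∀ t ∈ O, x t ∈ S.U ∧ DifferentiableAt ℝ x t ∧ S.EulerLagrangeAt x t) :
    ContDiffOn ℝ 2 x O := by
  set p : ℝ → E →L[ℝ] ℝ := fun s => S.momentum s (x s) (deriv x s)
  have hP : ∀ t ∈ O, HasDerivAt (fun s => (x s, p s)) (S.hamiltonianField t (x t, p t)) t :=
    fun t ht => (hx t ht).2.2.hasDerivAt_hamiltonianField (hx t ht).1 (hx t ht).2.1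
  have hmaps : MapsTo (fun s => (s, x s, p s)) O ((univ : Set ℝ) ×ˢ S.U ×ˢ univ) :=
    fun t ht => ⟨mem_univ _, (hx t ht).1, mem_univ _⟩
  have hd : DifferentiableOn ℝ (fun s => (x s, p s)) O :=
    fun t ht => (hP t ht).differentiableAt.differentiableWithinAt
  -- Bootstrap: position and momentum solve an equation with continuous right-hand side, hence are
  -- C¹; the velocity is a C¹ function of time, position and momentum, hence is itself C¹.
  have h1 : ContDiffOn ℝ 1 (fun s => (x s, p s)) O := by
    rw [show (1 : ℕ∞ω) = 0 + 1 by simp, contDiffOn_succ_iff_deriv_of_isOpen hO]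
    refine ⟨hd, by simp, ?_⟩
    rw [contDiffOn_zero]
    refine (S.contDiffOn_hamiltonianField.continuousOn.comp
      (continuousOn_id.prodMk hd.continuousOn) hmaps).congr fun t ht => (hP t ht).deriv
  have hdx : ∀ t ∈ O, deriv x t = S.velocityOf t (x t) (p t) := fun t ht =>
    (S.velocityOf_momentum (hx t ht).1 t _).symm
  rw [show (2 : ℕ∞ω) = 1 + 1 by norm_num [one_add_one_eq_two],
    contDiffOn_succ_iff_deriv_of_isOpen hO]
  refine ⟨fun t ht => (hx t ht).2.1.differentiableWithinAt, by simp, ?_⟩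
  exact ((S.contDiffOn_velocityOf.of_le one_le_two).comp
      (contDiffOn_id.prodMk h1) hmaps).congr hdx

end LocalSystem
end Brinkmann

/-! ### Curves calibrated by C¹ subsolutions -/

namespace Brinkmann
namespace LocalSystem

variable {E : Type*} [NormedAddCommGroup E] [NormedSpace ℝ E] {S : LocalSystem E}

/-- The mean value inequality along the segment from x to x + h e. -/
theorem lagrangian_add_smul_sub_le {t : ℝ} {x ξ e : E} {h C : ℝ} (hh : 0 ≤ h)
    (hU : ∀ σ ∈ Icc 0 h, x + σ • e ∈ S.U)
    (hC : ∀ σ ∈ Icc 0 h, S.force t (x + σ • e) ξ e ≤ C) :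
    S.lagrangian t (x + h • e) ξ - S.lagrangian t x ξ ≤ C * h := by
  have hd : ∀ σ ∈ Icc 0 h, HasDerivAt (fun σ : ℝ => S.lagrangian t (x + σ • e) ξ)
      (S.force t (x + σ • e) ξ e) σ := by
    intro σ hσ
    have h1 : HasDerivAt (fun σ : ℝ => x + σ • e) e σ := by
      simpa using ((hasDerivAt_id σ).smul_const e).const_add x
    exact (S.hasFDerivAt_force (hU σ hσ) ξ).comp_hasDerivAt σ h1
  have := (convex_Icc 0 h).image_sub_le_mul_sub_of_deriv_le
    (fun σ hσ => (hd σ hσ).continuousAt.continuousWithinAt)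
    (fun σ hσ => (hd σ (interior_subset hσ)).differentiableAt.differentiableWithinAt)
    (fun σ hσ => (hd σ (interior_subset hσ)).deriv.trans_le (hC σ (interior_subset hσ)))
    0 (left_mem_Icc.2 hh) h (right_mem_Icc.2 hh) hh
  simpa using this

/-- Along a curve which is calibrated by a `C¹` subsolution `w` of the Hamilton-Jacobi equation,
the space derivative of `w` evolves according to the Euler-Lagrange equation. -/
theorem hasDerivAt_spaceDeriv_of_calibrated {w : ℝ × E → ℝ} {T : Set ℝ} (hT : IsOpen T)
    (hw : ContDiffOn ℝ 1 w (T ×ˢ S.U))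
    (hsub : ∀ t ∈ T, ∀ x ∈ S.U, ∀ ξ, fderiv ℝ w (t, x) (1, ξ) ≤ S.lagrangian t x ξ)
    {x : ℝ → E} {t₀ : ℝ} (ht₀ : t₀ ∈ T)
    (hx : ∀ᶠ t in 𝓝 t₀, x t ∈ S.U ∧ DifferentiableAt ℝ x t ∧
      fderiv ℝ w (t, x t) (1, deriv x t) = S.lagrangian t (x t) (deriv x t))
    (hc : ContinuousAt (deriv x) t₀) :
    HasDerivAt (fun t => (fderiv ℝ w (t, x t)).comp (ContinuousLinearMap.inr ℝ ℝ E))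
      (S.force t₀ (x t₀) (deriv x t₀)) t₀ := by
  -- Since w is only C¹, P cannot be differentiated by the chain rule. Instead P e is the limit, as
  -- h decreases to 0, of the quotients of w(t, x + h e) − w(t, x) by h, whose time derivatives
  -- involve first derivatives of w only.
  set Φ := S.force t₀ (x t₀) (deriv x t₀)
  set P : ℝ → E →L[ℝ] ℝ := fun t => (fderiv ℝ w (t, x t)).comp (ContinuousLinearMap.inr ℝ ℝ E)
  have hwd : ∀ t ∈ T, ∀ y ∈ S.U, HasFDerivAt w (fderiv ℝ w (t, y)) (t, y) := fun t ht y hy =>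
    ((hw.contDiffAt ((hT.prod S.isOpen_U).mem_nhds ⟨ht, hy⟩)).differentiableAt
      one_ne_zero).hasFDerivAt
  have hx0 := hx.self_of_nhds
  have hxc : ContinuousAt x t₀ := hx0.2.1.continuousAt
  rw [hasDerivAt_iff_isLittleO, Asymptotics.isLittleO_iff]
  intro ε hε
  -- uniform control of the force
  have hF : ContinuousAt (fun p : ℝ × E × E => S.force p.1 p.2.1 p.2.2)
      (t₀, x t₀, deriv x t₀) := S.contDiffOn_force.continuousOn.continuousAt
    (S.isOpen_phase.mem_nhds ⟨mem_univ _, hx0.1, mem_univ _⟩)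
  obtain ⟨ρ, hρ, hρF⟩ := Metric.eventually_nhds_iff.1
    ((hF.eventually (Metric.closedBall_mem_nhds Φ hε)).and
      ((S.isOpen_phase (F := E)).eventually_mem ⟨mem_univ t₀, hx0.1, mem_univ (deriv x t₀)⟩))
  have hnear : ∀ᶠ t in 𝓝 t₀, t ∈ T ∧ (x t ∈ S.U ∧ DifferentiableAt ℝ x t ∧
      fderiv ℝ w (t, x t) (1, deriv x t) = S.lagrangian t (x t) (deriv x t)) ∧
      dist t t₀ < ρ ∧ dist (x t) (x t₀) < ρ / 2 ∧ dist (deriv x t) (deriv x t₀) < ρ :=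
    (hT.eventually_mem ht₀).and (hx.and ((Metric.eventually_nhds_iff.2 ⟨ρ, hρ, fun _ h => h⟩).and
      ((hxc.eventually (Metric.ball_mem_nhds _ (half_pos hρ))).and
        (hc.eventually (Metric.ball_mem_nhds _ hρ)))))
  obtain ⟨δ, hδ, hδn⟩ := Metric.eventually_nhds_iff_ball.1 hnear
  have hδconv : ∀ {s₀ s₁ : ℝ}, s₀ ∈ Metric.ball t₀ δ → s₁ ∈ Metric.ball t₀ δ →
      Icc s₀ s₁ ⊆ Metric.ball t₀ δ := fun h0 h1 => by
    rw [Real.ball_eq_Ioo] at *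
    exact Icc_subset_Ioo h0.1 h1.2
  -- the one sided estimate
  have key : ∀ s₀ s₁ : ℝ, s₀ ∈ Metric.ball t₀ δ → s₁ ∈ Metric.ball t₀ δ → s₀ ≤ s₁ → ∀ e : E,
      P s₁ e - P s₀ e ≤ (Φ e + ε * ‖e‖) * (s₁ - s₀) := by
    intro s₀ s₁ h0 h1 h01 e
    have hslope : ∀ s ∈ Metric.ball t₀ δ, Tendsto (fun h : ℝ => h⁻¹ • (w (s, x s + h • e)
        - w (s, x s))) (𝓝[>] 0) (𝓝 (P s e)) := by
      intro s hs
      obtain ⟨hsT, ⟨hsU, -, -⟩, -⟩ := hδn s hs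
      have h1 : HasDerivAt (fun h : ℝ => (s, x s + h • e)) ((0 : ℝ), e) 0 := by
        simpa using (hasDerivAt_const (0 : ℝ) s).prodMk
          (((hasDerivAt_id (0 : ℝ)).smul_const e).const_add (x s))
      have h2 : HasDerivAt (fun h : ℝ => w (s, x s + h • e)) (P s e) 0 := by
        have h3 : HasFDerivAt w (fderiv ℝ w (s, x s)) (s, x s + (0 : ℝ) • e) := by
          simpa using hwd s hsT _ hsU
        exact h3.comp_hasDerivAt 0 h1
      simpa using h2.tendsto_slope_zero_right
    have hsmall : ∀ᶠ h : ℝ in 𝓝[>] 0, 0 < h ∧ h * ‖e‖ < ρ / 2 := by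
      have : ContinuousAt (fun h : ℝ => h * ‖e‖) 0 := by fun_prop
      have h1 : ∀ᶠ h : ℝ in 𝓝 0, h * ‖e‖ < ρ / 2 :=
        this.eventually_lt_const (by simpa using half_pos hρ)
      filter_upwards [self_mem_nhdsWithin, nhdsWithin_le_nhds h1] with h h2 h3 using ⟨h2, h3⟩
    refine le_of_tendsto ((hslope s₁ h1).sub (hslope s₀ h0)) ?_
    filter_upwards [hsmall] with h hh
    have hball : ∀ t ∈ Metric.ball t₀ δ, ∀ σ ∈ Icc 0 h,
        dist (t, x t + σ • e, deriv x t) (t₀, x t₀, deriv x t₀) < ρ := by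
      intro t ht σ hσ
      obtain ⟨-, -, h3, h4, h5⟩ := hδn t ht
      have h6 : dist (x t + σ • e) (x t₀) < ρ := by
        have h7 : dist (x t + σ • e) (x t) ≤ h * ‖e‖ := by
          rw [dist_eq_norm, add_sub_cancel_left, norm_smul, Real.norm_eq_abs, abs_of_nonneg hσ.1]
          gcongr
          exact hσ.2
        linarith [dist_triangle (x t + σ • e) (x t) (x t₀)]
      simp only [Prod.dist_eq]
      exact max_lt h3 (max_lt h6 h5)
    have hUσ : ∀ t ∈ Metric.ball t₀ δ, ∀ σ ∈ Icc 0 h, x t + σ • e ∈ S.U := fun t ht σ hσ =>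
      (hρF (hball t ht σ hσ)).2.2.1
    -- The shifted curve has the same velocity, so both terms are differentiated in the direction
    -- (1, ẋ).
    have hdK : ∀ t ∈ Metric.ball t₀ δ, HasDerivAt (fun t => w (t, x t + h • e) - w (t, x t))
        (fderiv ℝ w (t, x t + h • e) (1, deriv x t) - fderiv ℝ w (t, x t) (1, deriv x t)) t := by
      intro t ht
      obtain ⟨htT, ⟨htU, hxd, -⟩, -⟩ := hδn t ht
      have h1 : HasDerivAt (fun t => (t, x t)) ((1 : ℝ), deriv x t) t :=
        (hasDerivAt_id t).prodMk hxd.hasDerivAt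
      have h2 : HasDerivAt (fun t => (t, x t + h • e)) ((1 : ℝ), deriv x t) t :=
        (hasDerivAt_id t).prodMk (hxd.hasDerivAt.add_const _)
      exact ((hwd t htT _ (hUσ t ht h (right_mem_Icc.2 hh.1.le))).comp_hasDerivAt t h2).sub
        ((hwd t htT _ htU).comp_hasDerivAt t h1)
    have hbound : ∀ t ∈ Metric.ball t₀ δ,
        fderiv ℝ w (t, x t + h • e) (1, deriv x t) - fderiv ℝ w (t, x t) (1, deriv x t)
          ≤ (Φ e + ε * ‖e‖) * h := by
      intro t ht
      obtain ⟨htT, ⟨htU, hxd, heq⟩, -⟩ := hδn t ht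
      rw [heq]
      -- The subsolution inequality at the shifted point meets the calibration equality on the
      -- curve: the rate is at most a difference of values of the Lagrangian.
      refine (sub_le_sub_right (hsub t htT _ (hUσ t ht h (right_mem_Icc.2 hh.1.le)) _) _).trans
        (lagrangian_add_smul_sub_le hh.1.le (hUσ t ht) fun σ hσ => ?_)
      have h3 : dist (S.force t (x t + σ • e) (deriv x t)) Φ ≤ ε := (hρF (hball t ht σ hσ)).1
      rw [dist_eq_norm] at h3
      have h4 := (le_abs_self _).trans
        (((S.force t (x t + σ • e) (deriv x t) - Φ).le_opNorm e).trans
          (mul_le_mul_of_nonneg_right h3 (norm_nonneg e)))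
      simp only [sub_apply] at h4
      linarith
    have hsubset := hδconv h0 h1
    have := (convex_Icc s₀ s₁).image_sub_le_mul_sub_of_deriv_le
      (fun t ht => (hdK t (hsubset ht)).continuousAt.continuousWithinAt)
      (fun t ht => (hdK t (hsubset (interior_subset ht))).differentiableAt.differentiableWithinAt)
      (fun t ht => (hdK t (hsubset (interior_subset ht))).deriv.trans_le
        (hbound t (hsubset (interior_subset ht))))
      s₀ (left_mem_Icc.2 h01) s₁ (right_mem_Icc.2 h01) h01
    have h6 := mul_le_mul_of_nonneg_left this (inv_nonneg.2 hh.1.le)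
    have h7 : h⁻¹ * ((Φ e + ε * ‖e‖) * h * (s₁ - s₀)) = (Φ e + ε * ‖e‖) * (s₁ - s₀) := by
      field_simp [hh.1.ne']
    simp only [smul_eq_mul]
    linarith
  have key2 : ∀ s₀ s₁ : ℝ, s₀ ∈ Metric.ball t₀ δ → s₁ ∈ Metric.ball t₀ δ → s₀ ≤ s₁ →
      ‖P s₁ - P s₀ - (s₁ - s₀) • Φ‖ ≤ ε * (s₁ - s₀) := by
    intro s₀ s₁ h0 h1 h01
    refine ContinuousLinearMap.opNorm_le_bound _ (mul_nonneg hε.le (sub_nonneg.2 h01)) fun e => ?_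
    have h2 := key s₀ s₁ h0 h1 h01 e
    -- The upper bound in the direction −e is the lower bound in the direction e.
    have h3 := key s₀ s₁ h0 h1 h01 (-e)
    simp only [map_neg, norm_neg] at h3
    simp only [sub_apply, smul_apply, smul_eq_mul]
    rw [Real.norm_eq_abs, abs_le]
    constructor <;> nlinarith
  filter_upwards [Metric.ball_mem_nhds t₀ hδ] with t ht
  rcases le_total t₀ t with h | h
  · rw [Real.norm_eq_abs, abs_of_nonneg (sub_nonneg.2 h)]
    exact key2 t₀ t (Metric.mem_ball_self hδ) ht h
  · rw [Real.norm_eq_abs, abs_of_nonpos (sub_nonpos.2 h), neg_sub, ← norm_neg]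
    refine le_trans (le_of_eq ?_) (key2 t t₀ ht (Metric.mem_ball_self hδ) h)
    congr 1
    module

end LocalSystem
end Brinkmann

/-! ### The Brinkmann metric in coordinates and its geodesic equation -/

namespace Brinkmann
namespace LocalSystem

variable {E : Type*} [NormedAddCommGroup E] [NormedSpace ℝ E] (S : LocalSystem E)

/-- The Brinkmann metric of a local system. -/
def metric (x w w' : ℝ × E × ℝ) : ℝ :=
  S.a x.1 x.2.1 w.2.1 w'.2.1 - w.1 * (w'.2.2 - S.b x.1 x.2.1 w'.2.1)
    - (w.2.2 - S.b x.1 x.2.1 w.2.1) * w'.1 - 2 * S.V x.1 x.2.1 * w.1 * w'.1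

/-- The left hand side of the geodesic equation of the Brinkmann metric, contracted with `w`. -/
def geodesicOp (x : ℝ → ℝ × E × ℝ) (s : ℝ) (w : ℝ × E × ℝ) : ℝ :=
  S.metric (x s) (deriv (deriv x) s) w + fderiv ℝ (fun x' => S.metric x' (deriv x s) w) (x s)
    (deriv x s) - fderiv ℝ (fun x' => S.metric x' (deriv x s) (deriv x s)) (x s) w / 2

/-- The derivative of the metric coefficients. -/
def da (t : ℝ) (x : E) : ℝ × E →L[ℝ] E →L[ℝ] E →L[ℝ] ℝ :=
  fderiv ℝ (fun p : ℝ × E => S.a p.1 p.2) (t, x)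

/-- The derivative of the coefficients of the 1-form. -/
def db (t : ℝ) (x : E) : ℝ × E →L[ℝ] E →L[ℝ] ℝ :=
  fderiv ℝ (fun p : ℝ × E => S.b p.1 p.2) (t, x)

/-- The derivative of the potential. -/
def dV (t : ℝ) (x : E) : ℝ × E →L[ℝ] ℝ := fderiv ℝ (fun p : ℝ × E => S.V p.1 p.2) (t, x)

variable {S}

theorem hasFDerivAt_a {x : E} (hx : x ∈ S.U) (t : ℝ) :
    HasFDerivAt (fun p : ℝ × E => S.a p.1 p.2) (S.da t x) (t, x) :=
  ((S.a_smooth.contDiffAt (S.isOpen_U_prod.mem_nhds ⟨mem_univ _, hx⟩)).differentiableAt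
    two_ne_zero).hasFDerivAt

theorem hasFDerivAt_b {x : E} (hx : x ∈ S.U) (t : ℝ) :
    HasFDerivAt (fun p : ℝ × E => S.b p.1 p.2) (S.db t x) (t, x) :=
  ((S.b_smooth.contDiffAt (S.isOpen_U_prod.mem_nhds ⟨mem_univ _, hx⟩)).differentiableAt
    two_ne_zero).hasFDerivAt

theorem hasFDerivAt_V {x : E} (hx : x ∈ S.U) (t : ℝ) :
    HasFDerivAt (fun p : ℝ × E => S.V p.1 p.2) (S.dV t x) (t, x) :=
  ((S.V_smooth.contDiffAt (S.isOpen_U_prod.mem_nhds ⟨mem_univ _, hx⟩)).differentiableAt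
    two_ne_zero).hasFDerivAt

/-- The coefficients do not depend on y, so only the (t, x) part of v acts. -/
theorem fderiv_metric {x : ℝ × E × ℝ} (hx : x.2.1 ∈ S.U) (u w v : ℝ × E × ℝ) :
    fderiv ℝ (fun x' => S.metric x' u w) x v =
      S.da x.1 x.2.1 (v.1, v.2.1) u.2.1 w.2.1 + u.1 * S.db x.1 x.2.1 (v.1, v.2.1) w.2.1
        + S.db x.1 x.2.1 (v.1, v.2.1) u.2.1 * w.1 - 2 * S.dV x.1 x.2.1 (v.1, v.2.1) * u.1 * w.1 := by
  have hp : HasFDerivAt (fun x' : ℝ × E × ℝ => (x'.1, x'.2.1)) ((ContinuousLinearMap.fst ℝ ℝ _).prod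
      ((ContinuousLinearMap.fst ℝ E ℝ).comp (ContinuousLinearMap.snd ℝ ℝ _))) x :=
    ((ContinuousLinearMap.fst ℝ ℝ _).prod
      ((ContinuousLinearMap.fst ℝ E ℝ).comp (ContinuousLinearMap.snd ℝ ℝ (E × ℝ)))).hasFDerivAt
  have ha := HasFDerivAt.comp (G := E →L[ℝ] E →L[ℝ] ℝ) x (hasFDerivAt_a hx x.1) hp
  have hb := HasFDerivAt.comp (G := E →L[ℝ] ℝ) x (hasFDerivAt_b hx x.1) hp
  have hV := HasFDerivAt.comp x (hasFDerivAt_V hx x.1) hp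
  have ha' := (ha.clm_apply (hasFDerivAt_const u.2.1 x)).clm_apply (hasFDerivAt_const w.2.1 x)
  have hbw := ((hb.clm_apply (hasFDerivAt_const w.2.1 x)).const_sub w.2.2).const_mul u.1
  have hbu := ((hb.clm_apply (hasFDerivAt_const u.2.1 x)).const_sub u.2.2).mul_const w.1
  have hV' := ((hV.const_mul 2).mul_const u.1).mul_const w.1
  have := (((ha'.sub hbw).sub hbu).sub hV').fderiv
  refine (congrArg (fun f => f v) this).trans ?_
  simp
  ring

theorem force_apply {t : ℝ} {x : E} (hx : x ∈ S.U) (ξ η : E) :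
    S.force t x ξ η = S.da t x (0, η) ξ ξ / 2 + S.db t x (0, η) ξ - S.dV t x (0, η) := by
  have hp : HasFDerivAt (fun x' : E => (t, x')) (ContinuousLinearMap.inr ℝ ℝ E) x := by
    have := (hasFDerivAt_const (𝕜 := ℝ) t x).prodMk (hasFDerivAt_id (𝕜 := ℝ) x)
    exact this.congr_fderiv (by ext v <;> simp)
  have ha := HasFDerivAt.comp (G := E →L[ℝ] E →L[ℝ] ℝ) x (hasFDerivAt_a hx t) hp
  have hb := HasFDerivAt.comp (G := E →L[ℝ] ℝ) x (hasFDerivAt_b hx t) hp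
  have hV := HasFDerivAt.comp x (hasFDerivAt_V hx t) hp
  have ha' := (((ha.clm_apply (hasFDerivAt_const ξ x)).clm_apply
    (hasFDerivAt_const ξ x)).mul_const (2⁻¹ : ℝ))
  have hb' := hb.clm_apply (hasFDerivAt_const ξ x)
  have := ((ha'.add hb').sub hV).fderiv
  refine (congrArg (fun f => f η) this).trans ?_
  simp
  ring

theorem hasDerivAt_momentum {x v : ℝ → E} {t : ℝ} {x' v' : E} (hU : x t ∈ S.U)
    (hx : HasDerivAt x x' t) (hv : HasDerivAt v v' t) :
    HasDerivAt (fun s => S.momentum s (x s) (v s))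
      (S.a t (x t) v' + S.da t (x t) (1, x') (v t) + S.db t (x t) (1, x')) t := by
  have hp : HasDerivAt (fun s => (s, x s)) ((1 : ℝ), x') t := (hasDerivAt_id t).prodMk hx
  have ha := HasFDerivAt.comp_hasDerivAt (E := E →L[ℝ] E →L[ℝ] ℝ) t (hasFDerivAt_a hU t) hp
  have hb := HasFDerivAt.comp_hasDerivAt (E := E →L[ℝ] ℝ) t (hasFDerivAt_b hU t) hp
  refine ((ha.clm_apply hv).add hb).congr_deriv ?_
  simp only [Function.comp_def]
  abel

theorem hasDerivAt_lagrangian_curve {x v : ℝ → E} {t : ℝ} {x' v' : E} (hU : x t ∈ S.U)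
    (hx : HasDerivAt x x' t) (hv : HasDerivAt v v' t) :
    HasDerivAt (fun s => S.lagrangian s (x s) (v s))
      (S.a t (x t) v' (v t) + S.da t (x t) (1, x') (v t) (v t) / 2 + S.b t (x t) v'
        + S.db t (x t) (1, x') (v t) - S.dV t (x t) (1, x')) t := by
  have hp : HasDerivAt (fun s => (s, x s)) ((1 : ℝ), x') t := (hasDerivAt_id t).prodMk hx
  have ha := HasFDerivAt.comp_hasDerivAt (E := E →L[ℝ] E →L[ℝ] ℝ) t (hasFDerivAt_a hU t) hp
  have hb := HasFDerivAt.comp_hasDerivAt (E := E →L[ℝ] ℝ) t (hasFDerivAt_b hU t) hp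
  have hV := (hasFDerivAt_V hU t).comp_hasDerivAt t hp
  refine (((((ha.clm_apply hv).clm_apply hv).div_const 2).add (hb.clm_apply hv)).sub
    hV).congr_deriv ?_
  simp only [Function.comp_def, add_apply, S.a_symm t (x t) (v t) v']
  ring

/-- The vector ∂_y pairs with ∂_t only, with constant coefficient −1, so both derivative terms drop
out. Along geodesics t is therefore an affine function of the parameter. -/
theorem geodesicOp_dy (x : ℝ → ℝ × E × ℝ) {s : ℝ} (hU : (x s).2.1 ∈ S.U) :
    S.geodesicOp x s (0, 0, 1) = -(deriv (deriv x) s).1 := by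
  simp only [geodesicOp, fderiv_metric hU]
  have : ((0 : ℝ), (0 : E)) = 0 := rfl
  simp [metric, this]

/-- The spatial part of a geodesic parametrized by `t` satisfies the Euler-Lagrange equation. -/
theorem eulerLagrangeAt_of_geodesicOp {x : ℝ → ℝ × E × ℝ} {s : ℝ} (hU : (x s).2.1 ∈ S.U)
    (hd : ∀ᶠ s' in 𝓝 s, DifferentiableAt ℝ x s') (hd2 : DifferentiableAt ℝ (deriv x) s)
    (ht : ∀ᶠ s' in 𝓝 s, (x s').1 = s') (hgeo : ∀ η, S.geodesicOp x s (0, η, 0) = 0) :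
    S.EulerLagrangeAt (fun s' => (x s').2.1) s := by
  have hder : ∀ {y : ℝ → ℝ × E × ℝ} {s' : ℝ}, DifferentiableAt ℝ y s' →
      HasDerivAt (fun s => (y s).2.1) (deriv y s').2.1 s' := fun h =>
    (h.hasDerivAt.snd).fst
  have h1 : deriv (fun s' => (x s').2.1) =ᶠ[𝓝 s] fun s' => (deriv x s').2.1 := by
    filter_upwards [hd] with s' hs' using (hder hs').deriv
  have ht1 : ∀ᶠ s' in 𝓝 s, (deriv x s').1 = 1 := by
    filter_upwards [ht.eventually_nhds, hd] with s' h2 h3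
    have h4 : HasDerivAt (fun s => (x s).1) (deriv x s').1 s' := h3.hasDerivAt.fst
    exact (h4.congr_of_eventuallyEq (f₁ := fun s => s)
      (h2.mono fun _ h => h.symm)).unique (hasDerivAt_id s')
  have ht2 : (deriv (deriv x) s).1 = 0 := by
    have h4 : HasDerivAt (fun s => (deriv x s).1) (deriv (deriv x) s).1 s := hd2.hasDerivAt.fst
    exact (h4.congr_of_eventuallyEq (f₁ := fun _ => 1)
      (ht1.mono fun _ h => h.symm)).unique (hasDerivAt_const s 1)
  have hs := ht.self_of_nhds
  have h2 := hasDerivAt_momentum hU (hder hd.self_of_nhds) (hder hd2)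
  unfold EulerLagrangeAt
  rw [h1.self_of_nhds]
  refine (h2.congr_of_eventuallyEq ?_).congr_deriv ?_
  · filter_upwards [h1] with s' h3
    simp only [h3]
  · ext η
    -- With ṫ = 1 and ẗ = 0 the y-velocity drops out, and the contraction with η is the difference
    -- between the derivative of the momentum and the force.
    have h3 := hgeo η
    rw [geodesicOp, fderiv_metric hU, fderiv_metric hU] at h3
    simp only [metric, ht1.self_of_nhds, ht2, hs] at h3
    rw [force_apply hU]
    simp only [add_apply]
    linarith

/-- The lift of a solution of the Euler-Lagrange equation is a geodesic. -/
theorem geodesicOp_eq_zero {ξ : ℝ → E} {Y : ℝ → ℝ} {s : ℝ} (hU : ξ s ∈ S.U)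
    (hd : ∀ᶠ s' in 𝓝 s, DifferentiableAt ℝ ξ s') (hd2 : DifferentiableAt ℝ (deriv ξ) s)
    (hY : ∀ᶠ s' in 𝓝 s, HasDerivAt Y (S.lagrangian s' (ξ s') (deriv ξ s')) s')
    (hEL : S.EulerLagrangeAt ξ s) (w : ℝ × E × ℝ) :
    S.geodesicOp (fun s' => (s', ξ s', Y s')) s w = 0 := by
  have h1 : deriv (fun s' => (s', ξ s', Y s')) =ᶠ[𝓝 s]
      fun s' => ((1 : ℝ), deriv ξ s', S.lagrangian s' (ξ s') (deriv ξ s')) := by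
    filter_upwards [hd, hY] with s' h2 h3
    exact ((hasDerivAt_id s').prodMk (h2.hasDerivAt.prodMk h3)).deriv
  have hξ := hd.self_of_nhds.hasDerivAt
  have hξ2 := hd2.hasDerivAt
  have h2 : deriv (deriv (fun s' => (s', ξ s', Y s'))) s = ((0 : ℝ), deriv (deriv ξ) s, _) :=
    h1.deriv_eq.trans ((hasDerivAt_const s (1 : ℝ)).prodMk
      (hξ2.prodMk (hasDerivAt_lagrangian_curve hU hξ hξ2))).deriv
  -- Comparing the explicit derivative of the momentum with the one prescribed by the Euler-Lagrange
  -- equation gives the equation in expanded form.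
  have hforce : ∀ η, _ := fun η => congrArg (fun f : E →L[ℝ] ℝ => f η)
    (HasDerivAt.unique (hasDerivAt_momentum hU hξ hξ2) hEL)
  simp only [force_apply hU, add_apply] at hforce
  -- The contraction with the spatial part of w gives the spatial components; the one with the
  -- velocity is the energy identity, needed for the ∂_t component. The ∂_y component vanishes
  -- because ẗ = 0.
  have e1 := hforce w.2.1
  have e2 := hforce (deriv ξ s)
  have hsplit : ∀ η : E, (1, η) = ((1 : ℝ), (0 : E)) + ((0 : ℝ), η) := fun η => by simp
  have hw : (w.1, w.2.1) = w.1 • ((1 : ℝ), (0 : E)) + ((0 : ℝ), w.2.1) := by simp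
  simp only [geodesicOp, h1.self_of_nhds, h2]
  rw [fderiv_metric (x := (s, ξ s, Y s)) hU, fderiv_metric (x := (s, ξ s, Y s)) hU]
  simp only [metric, hw]
  rw [hsplit (deriv ξ s)] at e1 e2 ⊢
  simp only [map_add, map_smul, add_apply, smul_apply, smul_eq_mul] at e1 e2 ⊢
  linear_combination e1 - w.1 * e2

end LocalSystem
end Brinkmann

/-! ### The mechanical data in the charts of Q -/

namespace Brinkmann

variable {d : ℕ} {Q : Type*} [TopologicalSpace Q] [ChartedSpace (EuclideanSpace ℝ (Fin d)) Q]

/-- The derivative of the inverse of the preferred chart around `z`. -/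
def chartDeriv (z : Q) (x : EuclideanSpace ℝ (Fin d)) :
    EuclideanSpace ℝ (Fin d) →L[ℝ] EuclideanSpace ℝ (Fin d) :=
  mfderiv (𝓡 d) (𝓡 d) (extChartAt (𝓡 d) z).symm x

/-- The regularity of the tensors is given on ℝ × TQ; composition with this coordinate
parametrization carries it to an open set of a vector space. Differentiating the chart costs one
derivative, whence the class n + 1 of the manifold. -/
theorem contMDiffOn_chart_tangent (n : ℕ∞ω) [IsManifold (𝓡 d) 1 Q] [IsManifold (𝓡 d) (n + 1) Q]
    (z : Q) :
    ContMDiffOn 𝓘(ℝ, ℝ × EuclideanSpace ℝ (Fin d) × EuclideanSpace ℝ (Fin d))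
      (𝓘(ℝ, ℝ).prod (𝓡 d).tangent) n
      (fun p => ((p.1, ⟨(extChartAt (𝓡 d) z).symm p.2.1, chartDeriv z p.2.1 p.2.2⟩) :
        ℝ × TangentBundle (𝓡 d) Q)) (univ ×ˢ (extChartAt (𝓡 d) z).target ×ˢ univ) := by
  have hopen := isOpen_extChartAt_target (I := 𝓡 d) z
  have h1 := (contMDiffOn_extChartAt_symm (n := n + 1) (I := 𝓡 d) z).contMDiffOn_tangentMapWithin
    (m := n) le_rfl hopen.uniqueMDiffOn
  have h2 : ContMDiff 𝓘(ℝ, ℝ × EuclideanSpace ℝ (Fin d) × EuclideanSpace ℝ (Fin d))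
      (𝓡 d).tangent n (fun p : ℝ × EuclideanSpace ℝ (Fin d) × EuclideanSpace ℝ (Fin d) =>
        (tangentBundleModelSpaceHomeomorph (𝓡 d)).symm (p.2.1, p.2.2)) := by
    have hx : ContMDiff 𝓘(ℝ, ℝ × EuclideanSpace ℝ (Fin d) × EuclideanSpace ℝ (Fin d)) (𝓡 d) n
        (fun p : ℝ × EuclideanSpace ℝ (Fin d) × EuclideanSpace ℝ (Fin d) => p.2.1) :=
      contMDiff_iff_contDiff.2 (by fun_prop)
    have hξ : ContMDiff 𝓘(ℝ, ℝ × EuclideanSpace ℝ (Fin d) × EuclideanSpace ℝ (Fin d)) (𝓡 d) n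
        (fun p : ℝ × EuclideanSpace ℝ (Fin d) × EuclideanSpace ℝ (Fin d) => p.2.2) :=
      contMDiff_iff_contDiff.2 (by fun_prop)
    refine contMDiff_tangentBundleModelSpaceHomeomorph_symm.comp ?_
    convert! hx.prodMk hξ
    rw [chartedSpaceSelf_prod]
    rfl
  have h3 : ContMDiff 𝓘(ℝ, ℝ × EuclideanSpace ℝ (Fin d) × EuclideanSpace ℝ (Fin d))
      𝓘(ℝ, ℝ) n (fun p : ℝ × EuclideanSpace ℝ (Fin d) × EuclideanSpace ℝ (Fin d) => p.1) :=
    contMDiff_iff_contDiff.2 (by fun_prop)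
  refine h3.contMDiffOn.prodMk ?_
  refine (h1.comp h2.contMDiffOn (fun p hp => hp.2.1)).congr ?_
  intro p hp
  change _ = tangentMapWithin _ _ _ _ (⟨p.2.1, p.2.2⟩ : TangentBundle (𝓡 d) _)
  rw [tangentMapWithin, mfderivWithin_of_isOpen hopen hp.2.1]
  rfl

namespace MechanicalData

variable [IsManifold (𝓡 d) 1 Q] {r : ℕ∞ω} (D : MechanicalData d Q r)

/-- The metric in the preferred chart around `z`. -/
def chartA (z : Q) (t : ℝ) (x : EuclideanSpace ℝ (Fin d)) :
    EuclideanSpace ℝ (Fin d) →L[ℝ] EuclideanSpace ℝ (Fin d) →L[ℝ] ℝ :=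
  ContinuousLinearMap.bilinearComp
    (show EuclideanSpace ℝ (Fin d) →L[ℝ] EuclideanSpace ℝ (Fin d) →L[ℝ] ℝ from
      D.a t ((extChartAt (𝓡 d) z).symm x)) (chartDeriv z x) (chartDeriv z x)

/-- The 1-form in the preferred chart around `z`. -/
def chartB (z : Q) (t : ℝ) (x : EuclideanSpace ℝ (Fin d)) : EuclideanSpace ℝ (Fin d) →L[ℝ] ℝ :=
  (show EuclideanSpace ℝ (Fin d) →L[ℝ] ℝ from
      D.b t ((extChartAt (𝓡 d) z).symm x)).comp (chartDeriv z x)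

theorem chartA_apply (z : Q) (t : ℝ) (x ξ η : EuclideanSpace ℝ (Fin d)) :
    D.chartA z t x ξ η = D.a t ((extChartAt (𝓡 d) z).symm x)
      (mfderiv (𝓡 d) (𝓡 d) (extChartAt (𝓡 d) z).symm x ξ)
      (mfderiv (𝓡 d) (𝓡 d) (extChartAt (𝓡 d) z).symm x η) := rfl

theorem chartA_symm (z : Q) (t : ℝ) (x ξ η : EuclideanSpace ℝ (Fin d)) :
    D.chartA z t x ξ η = D.chartA z t x η ξ := by
  rw [chartA_apply, chartA_apply]
  exact D.a_symm _ _ _ _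

theorem chartDeriv_isInvertible (z : Q) {x : EuclideanSpace ℝ (Fin d)}
    (hx : x ∈ (extChartAt (𝓡 d) z).target) : (chartDeriv z x).IsInvertible := by
  have := isInvertible_mfderivWithin_extChartAt_symm (I := 𝓡 d) hx
  rwa [modelWithCornersSelf_coe, range_id, mfderivWithin_univ] at this

theorem contDiffOn_quadratic (z : Q) [IsManifold (𝓡 d) (r + 1) Q] :
    ContDiffOn ℝ r (fun p : ℝ × EuclideanSpace ℝ (Fin d) × EuclideanSpace ℝ (Fin d) =>
      D.chartA z p.1 p.2.1 p.2.2 p.2.2) (univ ×ˢ (extChartAt (𝓡 d) z).target ×ˢ univ) := by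
  rw [← contMDiffOn_iff_contDiffOn]
  have h := D.a_smooth.comp_contMDiffOn (contMDiffOn_chart_tangent r z)
  exact h

theorem contDiffOn_chartA (z : Q) [IsManifold (𝓡 d) (r + 1) Q] :
    ContDiffOn ℝ r (fun p : ℝ × EuclideanSpace ℝ (Fin d) => D.chartA z p.1 p.2)
      (univ ×ˢ (extChartAt (𝓡 d) z).target) := by
  rw [contDiffOn_clm_apply]
  intro ξ
  rw [contDiffOn_clm_apply]
  intro η
  have hq : ∀ ζ, ContDiffOn ℝ r (fun p : ℝ × EuclideanSpace ℝ (Fin d) => D.chartA z p.1 p.2 ζ ζ)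
      (univ ×ˢ (extChartAt (𝓡 d) z).target) := fun ζ =>
    (D.contDiffOn_quadratic z).comp
      (f := fun p : ℝ × EuclideanSpace ℝ (Fin d) => (p.1, p.2, ζ)) (by fun_prop)
      fun p hp => ⟨mem_univ _, hp.2, mem_univ _⟩
  -- Polarization: only the quadratic form is known to be smooth, and it determines the symmetric
  -- bilinear form.
  refine (((hq (ξ + η)).sub (hq (ξ - η))).div_const 4).congr fun p _ => ?_
  simp only [map_add, map_sub, add_apply, sub_apply, D.chartA_symm z p.1 p.2 η ξ]
  ring

theorem contDiffOn_chartB (z : Q) [IsManifold (𝓡 d) (r + 1) Q] :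
    ContDiffOn ℝ r (fun p : ℝ × EuclideanSpace ℝ (Fin d) => D.chartB z p.1 p.2)
      (univ ×ˢ (extChartAt (𝓡 d) z).target) := by
  rw [contDiffOn_clm_apply]
  intro ξ
  have h : ContDiffOn ℝ r (fun p : ℝ × EuclideanSpace ℝ (Fin d) × EuclideanSpace ℝ (Fin d) =>
      D.chartB z p.1 p.2.1 p.2.2) (univ ×ˢ (extChartAt (𝓡 d) z).target ×ˢ univ) := by
    rw [← contMDiffOn_iff_contDiffOn]
    have h := D.b_smooth.comp_contMDiffOn (contMDiffOn_chart_tangent r z)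
    exact h
  exact h.comp (f := fun p : ℝ × EuclideanSpace ℝ (Fin d) => (p.1, p.2, ξ)) (by fun_prop)
      fun p hp => ⟨mem_univ _, hp.2, mem_univ _⟩

theorem contDiffOn_chartV (z : Q) [IsManifold (𝓡 d) (r + 1) Q] :
    ContDiffOn ℝ r (fun p : ℝ × EuclideanSpace ℝ (Fin d) =>
      D.V p.1 ((extChartAt (𝓡 d) z).symm p.2)) (univ ×ˢ (extChartAt (𝓡 d) z).target) := by
  rw [← contMDiffOn_iff_contDiffOn]
  have : IsManifold (𝓡 d) r Q := IsManifold.of_le (n := r + 1) le_self_add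
  have h3 : ContMDiff 𝓘(ℝ, ℝ × EuclideanSpace ℝ (Fin d)) 𝓘(ℝ, ℝ) r
      (fun p : ℝ × EuclideanSpace ℝ (Fin d) => p.1) :=
    contMDiff_iff_contDiff.2 (by fun_prop)
  have h4 : ContMDiff 𝓘(ℝ, ℝ × EuclideanSpace ℝ (Fin d)) (𝓡 d) r
      (fun p : ℝ × EuclideanSpace ℝ (Fin d) => p.2) :=
    contMDiff_iff_contDiff.2 (by fun_prop)
  exact D.V_smooth.comp_contMDiffOn (h3.contMDiffOn.prodMk
    ((contMDiffOn_extChartAt_symm (I := 𝓡 d) z).comp h4.contMDiffOn fun p hp => hp.2))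

/-- The data in the preferred chart around `z`. -/
def localSystem (hr : 2 ≤ r) [IsManifold (𝓡 d) (r + 1) Q] (z : Q) :
    LocalSystem (EuclideanSpace ℝ (Fin d)) where
  U := (extChartAt (𝓡 d) z).target
  isOpen_U := isOpen_extChartAt_target z
  a := D.chartA z
  b := D.chartB z
  V t x := D.V t ((extChartAt (𝓡 d) z).symm x)
  a_symm := D.chartA_symm z
  a_pos t x hx ξ hξ := by
    rw [chartA_apply]
    refine D.a_pos _ _ _ fun h => hξ ?_
    obtain ⟨e, he⟩ := chartDeriv_isInvertible z hx
    have h1 : chartDeriv z x ξ = 0 := h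
    rw [← he] at h1
    simpa using h1
  a_smooth := (D.contDiffOn_chartA z).of_le hr
  b_smooth := (D.contDiffOn_chartB z).of_le hr
  V_smooth := (D.contDiffOn_chartV z).of_le hr

theorem chartLagrangian_eq (hr : 2 ≤ r) [IsManifold (𝓡 d) (r + 1) Q] (z : Q) :
    D.chartLagrangian z = (D.localSystem hr z).lagrangian := rfl

end MechanicalData
end Brinkmann

/-! ### Differential calculus along curves and for functions on ℝ × Q -/

namespace Brinkmann

variable {d : ℕ} {Q : Type*} [TopologicalSpace Q] [ChartedSpace (EuclideanSpace ℝ (Fin d)) Q]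

/-! ### Velocities -/

/-- `v` is the velocity at time `t` of the curve `c` within the set of times `s`. -/
def HasVelocityWithinAt (c : ℝ → Q) (v : EuclideanSpace ℝ (Fin d)) (s : Set ℝ) (t : ℝ) : Prop :=
  HasMFDerivWithinAt 𝓘(ℝ, ℝ) (𝓡 d) c s t
    (ContinuousLinearMap.toSpanSingleton ℝ v : ℝ →L[ℝ] EuclideanSpace ℝ (Fin d))

/-- `v` is the velocity at time `t` of the curve `c`. -/
def HasVelocityAt (c : ℝ → Q) (v : EuclideanSpace ℝ (Fin d)) (t : ℝ) : Prop :=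
  HasMFDerivAt 𝓘(ℝ, ℝ) (𝓡 d) c t
    (ContinuousLinearMap.toSpanSingleton ℝ v : ℝ →L[ℝ] EuclideanSpace ℝ (Fin d))

theorem toSpanSingleton_one {F : Type*} [NormedAddCommGroup F] [NormedSpace ℝ F] (f : ℝ →L[ℝ] F) :
    ContinuousLinearMap.toSpanSingleton ℝ (f 1) = f := by
  ext
  simp

theorem HasVelocityAt.hasVelocityWithinAt {c : ℝ → Q} {v : EuclideanSpace ℝ (Fin d)} {t : ℝ}
    (h : HasVelocityAt c v t) (s : Set ℝ) : HasVelocityWithinAt c v s t := h.hasMFDerivWithinAt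

theorem HasVelocityWithinAt.hasVelocityAt {c : ℝ → Q} {v : EuclideanSpace ℝ (Fin d)} {t : ℝ}
    {s : Set ℝ} (h : HasVelocityWithinAt c v s t) (hs : s ∈ 𝓝 t) : HasVelocityAt c v t :=
  h.hasMFDerivAt hs

theorem HasVelocityWithinAt.union {c : ℝ → Q} {v : EuclideanSpace ℝ (Fin d)} {t : ℝ}
    {s s' : Set ℝ} (h : HasVelocityWithinAt c v s t) (h' : HasVelocityWithinAt c v s' t) :
    HasVelocityWithinAt c v (s ∪ s') t :=
  HasMFDerivWithinAt.union h h'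

theorem HasVelocityAt.velocity_eq {c : ℝ → Q} {v : EuclideanSpace ℝ (Fin d)} {t : ℝ}
    (h : HasVelocityAt c v t) : velocity (d := d) c t = v := by
  rw [velocity, HasMFDerivAt.mfderiv h]
  exact one_smul ℝ v

theorem hasVelocityAt_velocity {c : ℝ → Q} {t : ℝ}
    (h : MDifferentiableAt 𝓘(ℝ, ℝ) (𝓡 d) c t) : HasVelocityAt c (velocity (d := d) c t) t := by
  have h1 := h.hasMFDerivAt
  exact h1.congr_mfderiv (toSpanSingleton_one (F := EuclideanSpace ℝ (Fin d))
    (mfderiv 𝓘(ℝ, ℝ) (𝓡 d) c t)).symm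

theorem HasVelocityAt.mdifferentiableAt {c : ℝ → Q} {v : EuclideanSpace ℝ (Fin d)} {t : ℝ}
    (h : HasVelocityAt c v t) : MDifferentiableAt 𝓘(ℝ, ℝ) (𝓡 d) c t :=
  HasMFDerivAt.mdifferentiableAt h

theorem HasVelocityWithinAt.velocityOn_eq {c : ℝ → Q} {v : EuclideanSpace ℝ (Fin d)} {t₀ t₁ t : ℝ}
    (h : HasVelocityWithinAt c v (Icc t₀ t₁) t) (h01 : t₀ < t₁) (ht : t ∈ Icc t₀ t₁) :
    velocityOn (d := d) t₀ t₁ c t = v := by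
  rw [velocityOn, HasMFDerivWithinAt.mfderivWithin h
    (uniqueDiffOn_Icc h01 t ht).uniqueMDiffWithinAt]
  exact one_smul ℝ v

theorem hasMFDerivWithinAt_of_eq {c : ℝ → Q} {s : Set ℝ} {t : ℝ}
    {f f' : ℝ →L[ℝ] EuclideanSpace ℝ (Fin d)} (h : HasMFDerivWithinAt 𝓘(ℝ, ℝ) (𝓡 d) c s t f)
    (hf : f = f') : HasMFDerivWithinAt 𝓘(ℝ, ℝ) (𝓡 d) c s t f' := hf ▸ h

theorem hasVelocityWithinAt_velocityOn {c : ℝ → Q} {t₀ t₁ t : ℝ}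
    (h : MDifferentiableWithinAt 𝓘(ℝ, ℝ) (𝓡 d) c (Icc t₀ t₁) t) :
    HasVelocityWithinAt c (velocityOn (d := d) t₀ t₁ c t) (Icc t₀ t₁) t := by
  have h1 := h.hasMFDerivWithinAt
  exact hasMFDerivWithinAt_of_eq h1 (toSpanSingleton_one (F := EuclideanSpace ℝ (Fin d))
    (mfderivWithin 𝓘(ℝ, ℝ) (𝓡 d) c (Icc t₀ t₁) t)).symm

theorem HasVelocityWithinAt.congr {c c' : ℝ → Q} {v : EuclideanSpace ℝ (Fin d)} {t : ℝ}
    {s : Set ℝ} (h : HasVelocityWithinAt c v s t) (hc : ∀ x ∈ s, c' x = c x) (ht : c' t = c t) :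
    HasVelocityWithinAt c' v s t := by
  have h1 := HasMFDerivWithinAt.congr_of_eventuallyEq (f₁ := c') h
    (eventually_mem_nhdsWithin.mono hc) ht
  exact h1

theorem HasVelocityAt.congr {c c' : ℝ → Q} {v : EuclideanSpace ℝ (Fin d)} {t : ℝ}
    (h : HasVelocityAt c v t) (hc : c' =ᶠ[𝓝 t] c) : HasVelocityAt c' v t := by
  have h1 := HasMFDerivAt.congr_of_eventuallyEq (f₁ := c') h hc
  exact h1

/-! ### Charts -/

theorem eventually_mem_source (z : Q) {c : ℝ → Q} {t : ℝ} (hc : ContinuousAt c t)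
    (hz : c t ∈ (extChartAt (𝓡 d) z).source) :
    ∀ᶠ s in 𝓝 t, c s ∈ (extChartAt (𝓡 d) z).source :=
  hc.eventually ((isOpen_extChartAt_source z).mem_nhds hz)

theorem contMDiffAt_curve_iff (n : ℕ∞ω) [IsManifold (𝓡 d) n Q] (z : Q) {c : ℝ → Q} {t : ℝ}
    (hc : ContinuousAt c t) (hz : c t ∈ (extChartAt (𝓡 d) z).source) :
    ContMDiffAt 𝓘(ℝ, ℝ) (𝓡 d) n c t ↔ ContDiffAt ℝ n (fun s => extChartAt (𝓡 d) z (c s)) t := by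
  rw [← contMDiffAt_iff_contDiffAt]
  constructor
  · intro h
    exact (contMDiffAt_extChartAt' (by rwa [extChartAt_source] at hz)).comp t h
  · intro h
    have h1 := (((contMDiffOn_extChartAt_symm (n := n) (I := 𝓡 d) z).contMDiffAt
      ((isOpen_extChartAt_target z).mem_nhds ((extChartAt (𝓡 d) z).map_source hz)))).comp t h
    refine h1.congr_of_eventuallyEq ?_
    filter_upwards [eventually_mem_source z hc hz] with s hs
    exact ((extChartAt (𝓡 d) z).left_inv hs).symm

section Charts

variable [IsManifold (𝓡 d) 1 Q]

theorem hasMFDerivAt_extChartAt_symm (z : Q) {x : EuclideanSpace ℝ (Fin d)}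
    (hx : x ∈ (extChartAt (𝓡 d) z).target) :
    HasMFDerivAt (𝓡 d) (𝓡 d) (extChartAt (𝓡 d) z).symm x (chartDeriv z x) := by
  have := (contMDiffOn_extChartAt_symm (n := 1) (I := 𝓡 d) z).contMDiffAt
    ((isOpen_extChartAt_target z).mem_nhds hx)
  exact (this.mdifferentiableAt one_ne_zero).hasMFDerivAt

theorem hasVelocityAt_chart_symm (z : Q) {x : ℝ → EuclideanSpace ℝ (Fin d)}
    {ξ : EuclideanSpace ℝ (Fin d)} {t : ℝ} (hx : x t ∈ (extChartAt (𝓡 d) z).target)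
    (h : HasDerivAt x ξ t) :
    HasVelocityAt (fun s => (extChartAt (𝓡 d) z).symm (x s)) (chartDeriv z (x t) ξ) t := by
  have h1 := (hasMFDerivAt_extChartAt_symm z hx).comp t h.hasFDerivAt.hasMFDerivAt
  exact h1.congr_mfderiv (ContinuousLinearMap.comp_toSpanSingleton (chartDeriv z (x t)) ξ)

theorem differentiableAt_chart_curve (z : Q) {c : ℝ → Q} {t : ℝ}
    (hc : MDifferentiableAt 𝓘(ℝ, ℝ) (𝓡 d) c t) (hz : c t ∈ (extChartAt (𝓡 d) z).source) :
    DifferentiableAt ℝ (fun s => extChartAt (𝓡 d) z (c s)) t := by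
  rw [extChartAt_source] at hz
  have h1 := (mdifferentiableAt_extChartAt (I := 𝓡 d) hz).comp t hc
  exact h1.differentiableAt

theorem velocity_eq_chartDeriv (z : Q) {c : ℝ → Q} {t : ℝ}
    (hc : MDifferentiableAt 𝓘(ℝ, ℝ) (𝓡 d) c t) (hz : c t ∈ (extChartAt (𝓡 d) z).source) :
    velocity (d := d) c t = chartDeriv z (extChartAt (𝓡 d) z (c t))
      (deriv (fun s => extChartAt (𝓡 d) z (c s)) t) := by
  have h1 := hasVelocityAt_chart_symm z (x := fun s => extChartAt (𝓡 d) z (c s))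
    ((extChartAt (𝓡 d) z).map_source hz) (differentiableAt_chart_curve z hc hz).hasDerivAt
  refine HasVelocityAt.velocity_eq (h1.congr ?_)
  filter_upwards [eventually_mem_source z hc.continuousAt hz] with s hs
  exact ((extChartAt (𝓡 d) z).left_inv hs).symm

end Charts

/-! ### Functions -/

section Functions

variable {J : Set ℝ} {u : ℝ × Q → ℝ}

theorem IsC1On.mdifferentiableAt (hu : IsC1On d J u) (hJ : IsOpen J) {t : ℝ} (ht : t ∈ J) (q : Q) :
    MDifferentiableAt (𝓘(ℝ, ℝ).prod (𝓡 d)) 𝓘(ℝ, ℝ) u (t, q) :=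
  ((hu (t, q) ⟨ht, mem_univ _⟩).contMDiffAt
    ((hJ.prod isOpen_univ).mem_nhds ⟨ht, mem_univ _⟩)).mdifferentiableAt one_ne_zero

/-- The space derivative as a covector in the model space. -/
def spaceCovector (d : ℕ) {Q : Type*} [TopologicalSpace Q]
    [ChartedSpace (EuclideanSpace ℝ (Fin d)) Q] (u : ℝ × Q → ℝ) (t : ℝ) (q : Q) :
    EuclideanSpace ℝ (Fin d) →L[ℝ] ℝ := spaceDeriv u t q

/-- The derivative of `u` in terms of its partial derivatives. -/
def jointDeriv (d : ℕ) {Q : Type*} [TopologicalSpace Q] [ChartedSpace (EuclideanSpace ℝ (Fin d)) Q]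
    (u : ℝ × Q → ℝ) (t : ℝ) (q : Q) : ℝ × EuclideanSpace ℝ (Fin d) →L[ℝ] ℝ :=
  (ContinuousLinearMap.toSpanSingleton ℝ (timeDeriv u t q)).coprod (spaceCovector d u t q)

theorem jointDeriv_apply (u : ℝ × Q → ℝ) (t : ℝ) (q : Q) (τ : ℝ) (v : EuclideanSpace ℝ (Fin d)) :
    jointDeriv d u t q (τ, v) = timeDeriv u t q * τ + spaceCovector d u t q v := by
  simp only [jointDeriv, ContinuousLinearMap.coprod_apply,
    ContinuousLinearMap.toSpanSingleton_apply, smul_eq_mul, mul_comm τ]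

/-- Joint differentiability lets the two partial derivatives be assembled into the full
differential, the source of all the chain rules below. -/
theorem IsC1On.hasMFDerivAt (hu : IsC1On d J u) (hJ : IsOpen J) {t : ℝ} (ht : t ∈ J) (q : Q) :
    HasMFDerivAt (𝓘(ℝ, ℝ).prod (𝓡 d)) 𝓘(ℝ, ℝ) u (t, q) (jointDeriv d u t q) := by
  have h := hu.mdifferentiableAt hJ ht q
  refine h.hasMFDerivAt.congr_mfderiv (ContinuousLinearMap.ext fun v => ?_)
  refine (mfderiv_prod_eq_add_apply h).trans ?_
  refine Eq.trans ?_ (jointDeriv_apply u t q _ _).symm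
  congr 1
  rw [mfderiv_eq_fderiv, mul_comm]
  have h1 : ∀ τ : ℝ, fderiv ℝ (fun s => u (s, q)) t τ = τ * deriv (fun s => u (s, q)) t :=
    fun τ => fderiv_eq_smul_deriv τ
  exact h1 v.1

theorem IsC1On.hasDerivWithinAt_comp (hu : IsC1On d J u) (hJ : IsOpen J) {c : ℝ → Q} {t : ℝ}
    {s : Set ℝ} {v : EuclideanSpace ℝ (Fin d)} (ht : t ∈ J) (hc : HasVelocityWithinAt c v s t) :
    HasDerivWithinAt (fun t => u (t, c t)) (timeDeriv u t (c t) + spaceCovector d u t (c t) v)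
      s t := by
  have h1 : HasMFDerivWithinAt 𝓘(ℝ, ℝ) 𝓘(ℝ, ℝ) (fun t : ℝ => t) s t
    (ContinuousLinearMap.id ℝ (TangentSpace 𝓘(ℝ, ℝ) t)) := hasMFDerivWithinAt_id _ _
  have h2 := (hu.hasMFDerivAt hJ ht (c t)).comp_hasMFDerivWithinAt t (h1.prodMk hc)
  have h3 := hasMFDerivWithinAt_iff_hasFDerivWithinAt.1 h2
  rw [hasDerivWithinAt_iff_hasFDerivWithinAt]
  refine h3.congr_fderiv (ContinuousLinearMap.ext_ring ?_)
  have h4 := jointDeriv_apply u t (c t) 1 v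
  rw [mul_one] at h4
  have h5 : ContinuousLinearMap.toSpanSingleton ℝ v (1 : ℝ) = v := by simp
  refine Eq.trans (b := jointDeriv d u t (c t)
    ((1 : ℝ), ContinuousLinearMap.toSpanSingleton ℝ v (1 : ℝ))) rfl ?_
  rw [h5, h4]
  exact (one_smul ℝ _).symm

/-- The function `u` in the preferred chart around `z`. -/
def chartFun (z : Q) (u : ℝ × Q → ℝ) (p : ℝ × EuclideanSpace ℝ (Fin d)) : ℝ :=
  u (p.1, (extChartAt (𝓡 d) z).symm p.2)

variable [IsManifold (𝓡 d) 1 Q]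

theorem IsC1On.contDiffOn_chartFun (hu : IsC1On d J u) (z : Q) :
    ContDiffOn ℝ 1 (chartFun z u) (J ×ˢ (extChartAt (𝓡 d) z).target) := by
  rw [← contMDiffOn_iff_contDiffOn]
  have h3 : ContMDiff 𝓘(ℝ, ℝ × EuclideanSpace ℝ (Fin d)) 𝓘(ℝ, ℝ) 1
      (fun p : ℝ × EuclideanSpace ℝ (Fin d) => p.1) :=
    contMDiff_iff_contDiff.2 (by fun_prop)
  have h4 : ContMDiff 𝓘(ℝ, ℝ × EuclideanSpace ℝ (Fin d)) (𝓡 d) 1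
      (fun p : ℝ × EuclideanSpace ℝ (Fin d) => p.2) :=
    contMDiff_iff_contDiff.2 (by fun_prop)
  exact ContMDiffOn.comp hu (h3.contMDiffOn.prodMk
    ((contMDiffOn_extChartAt_symm (I := 𝓡 d) z).comp h4.contMDiffOn fun p hp => hp.2))
    fun p hp => ⟨hp.1, mem_univ _⟩

theorem IsC1On.fderiv_chartFun (hu : IsC1On d J u) (hJ : IsOpen J) (z : Q) {t : ℝ} (ht : t ∈ J)
    {x : EuclideanSpace ℝ (Fin d)} (hx : x ∈ (extChartAt (𝓡 d) z).target)
    (τ : ℝ) (ξ : EuclideanSpace ℝ (Fin d)) :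
    fderiv ℝ (chartFun z u) (t, x) (τ, ξ) = timeDeriv u t ((extChartAt (𝓡 d) z).symm x) * τ
      + spaceCovector d u t ((extChartAt (𝓡 d) z).symm x) (chartDeriv z x ξ) := by
  have hw : HasFDerivAt (chartFun z u) (fderiv ℝ (chartFun z u) (t, x)) (t, x) :=
    (((hu.contDiffOn_chartFun z).contDiffAt ((hJ.prod (isOpen_extChartAt_target z)).mem_nhds
      ⟨ht, hx⟩)).differentiableAt one_ne_zero).hasFDerivAt
  -- A direction (1, ξ) is the velocity of the curve (s, x + (s − t)ξ), parametrized by time, so the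
  -- chain rule along curves in Q applies. Other time components follow by linearity.
  have key : ∀ ξ : EuclideanSpace ℝ (Fin d), fderiv ℝ (chartFun z u) (t, x) (1, ξ) =
      timeDeriv u t ((extChartAt (𝓡 d) z).symm x)
        + spaceCovector d u t ((extChartAt (𝓡 d) z).symm x) (chartDeriv z x ξ) := by
    intro ξ
    have hx' : x + (t - t) • ξ = x := by simp
    have h1 : HasDerivAt (fun s : ℝ => x + (s - t) • ξ) ξ t := by
      simpa using (((hasDerivAt_id t).sub_const t).smul_const ξ).const_add x
    have h2 := hasVelocityAt_chart_symm z (x := fun s : ℝ => x + (s - t) • ξ) (by rwa [hx']) h1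
    have h3 := hu.hasDerivWithinAt_comp hJ ht (h2.hasVelocityWithinAt univ)
    rw [hasDerivWithinAt_univ, hx'] at h3
    have h4 : HasDerivAt (fun s : ℝ => (s, x + (s - t) • ξ)) ((1 : ℝ), ξ) t :=
      (hasDerivAt_id t).prodMk h1
    have hw' : HasFDerivAt (chartFun z u) (fderiv ℝ (chartFun z u) (t, x))
        (t, x + (t - t) • ξ) := by rwa [hx']
    have h5 : HasDerivAt (chartFun z u ∘ fun s : ℝ => (s, x + (s - t) • ξ))
        (fderiv ℝ (chartFun z u) (t, x) (1, ξ)) t := HasFDerivAt.comp_hasDerivAt t hw' h4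
    exact h5.unique h3
  have hsplit : ((τ, ξ) : ℝ × EuclideanSpace ℝ (Fin d)) = (1, ξ) + (τ - 1) • (1, 0) := by
    simp
  rw [hsplit, map_add, map_smul, key, key, map_zero, map_zero, smul_eq_mul]
  ring

end Functions
end Brinkmann

/-! ### The Fenchel inequality and its integrated form -/

namespace Brinkmann

variable {d : ℕ} {Q : Type*} [TopologicalSpace Q] [ChartedSpace (EuclideanSpace ℝ (Fin d)) Q]

section

variable {J : Set ℝ} {u : ℝ × Q → ℝ}

theorem IsC1CurveOn.hasVelocityWithinAt {c : ℝ → Q} {t₀ t₁ t : ℝ} (hc : IsC1CurveOn d t₀ t₁ c)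
    (ht : t ∈ Icc t₀ t₁) :
    HasVelocityWithinAt c (velocityOn (d := d) t₀ t₁ c t) (Icc t₀ t₁) t :=
  hasVelocityWithinAt_velocityOn ((hc t ht).mdifferentiableWithinAt one_ne_zero)

theorem IsC1CurveOn.contDiffOn_comp (hu : IsC1On d J u) {c : ℝ → Q} {t₀ t₁ : ℝ}
    (hc : IsC1CurveOn d t₀ t₁ c) (hJ : Icc t₀ t₁ ⊆ J) :
    ContDiffOn ℝ 1 (fun t => u (t, c t)) (Icc t₀ t₁) := by
  rw [← contMDiffOn_iff_contDiffOn]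
  have h1 : ContMDiffOn 𝓘(ℝ, ℝ) 𝓘(ℝ, ℝ) 1 (fun t : ℝ => t) (Icc t₀ t₁) := contMDiffOn_id
  exact ContMDiffOn.comp hu (h1.prodMk hc) fun t ht => ⟨hJ ht, mem_univ _⟩

theorem IsC1CurveOn.hasDerivWithinAt_comp (hu : IsC1On d J u) (hJo : IsOpen J) {c : ℝ → Q}
    {t₀ t₁ t : ℝ} (hc : IsC1CurveOn d t₀ t₁ c) (hJ : Icc t₀ t₁ ⊆ J) (ht : t ∈ Icc t₀ t₁) :
    HasDerivWithinAt (fun t => u (t, c t)) (timeDeriv u t (c t)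
      + spaceCovector d u t (c t) (velocityOn (d := d) t₀ t₁ c t)) (Icc t₀ t₁) t :=
  hu.hasDerivWithinAt_comp hJo (hJ ht) (hc.hasVelocityWithinAt ht)

theorem IsC1CurveOn.continuousOn_deriv_comp (hu : IsC1On d J u) (hJo : IsOpen J) {c : ℝ → Q}
    {t₀ t₁ : ℝ} (hc : IsC1CurveOn d t₀ t₁ c) (h01 : t₀ < t₁) (hJ : Icc t₀ t₁ ⊆ J) :
    ContinuousOn (fun t => timeDeriv u t (c t)
      + spaceCovector d u t (c t) (velocityOn (d := d) t₀ t₁ c t)) (Icc t₀ t₁) := by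
  refine ((hc.contDiffOn_comp hu hJ).continuousOn_derivWithin (uniqueDiffOn_Icc h01)
    le_rfl).congr fun t ht => ?_
  exact ((hc.hasDerivWithinAt_comp hu hJo hJ ht).derivWithin (uniqueDiffOn_Icc h01 t ht)).symm

theorem IsC1CurveOn.integral_deriv_comp (hu : IsC1On d J u) (hJo : IsOpen J) {c : ℝ → Q}
    {t₀ t₁ : ℝ} (hc : IsC1CurveOn d t₀ t₁ c) (h01 : t₀ < t₁) (hJ : Icc t₀ t₁ ⊆ J) :
    ∫ t in t₀..t₁, (timeDeriv u t (c t)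
      + spaceCovector d u t (c t) (velocityOn (d := d) t₀ t₁ c t)) =
      u (t₁, c t₁) - u (t₀, c t₀) := by
  refine intervalIntegral.integral_eq_sub_of_hasDeriv_right_of_le (f := fun t => u (t, c t)) h01.le
    (hc.contDiffOn_comp hu hJ).continuousOn
    (fun t ht => ?_)
    ((hc.continuousOn_deriv_comp hu hJo h01 hJ).intervalIntegrable_of_Icc h01.le)
  exact ((hc.hasDerivWithinAt_comp hu hJo hJ (Ioo_subset_Icc_self ht)).hasDerivAt
    (Icc_mem_nhds ht.1 ht.2)).hasDerivWithinAt

end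

variable [IsManifold (𝓡 d) 1 Q] {r : ℕ∞ω}

namespace MechanicalData

variable (D : MechanicalData d Q r) {J : Set ℝ} {u : ℝ × Q → ℝ}

/-- The vector field whose integral curves are the characteristics of `u`. -/
def charField (u : ℝ × Q → ℝ) (t : ℝ) (q : Q) : EuclideanSpace ℝ (Fin d) :=
  D.sharp t q (spaceDeriv u t q - D.b t q)

theorem a_add_sub (t : ℝ) (q : Q) (v w : TangentSpace (𝓡 d) q) :
    D.a t q (v - w) (v - w) = D.a t q v v - 2 * D.a t q w v + D.a t q w w := by
  simp only [map_sub, sub_apply, D.a_symm t q v w]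
  ring

theorem a_eq_zero_iff (t : ℝ) (q : Q) (v : TangentSpace (𝓡 d) q) : D.a t q v v = 0 ↔ v = 0 := by
  constructor
  · intro h
    by_contra hv
    exact (D.a_pos t q v hv).ne' h
  · rintro rfl
    simp

theorem a_nonneg (t : ℝ) (q : Q) (v : TangentSpace (𝓡 d) q) : 0 ≤ D.a t q v v := by
  by_cases hv : v = 0
  · exact ((D.a_eq_zero_iff t q v).2 hv).ge
  · exact (D.a_pos t q v hv).le

/-- The Fenchel identity. -/
theorem lagrangian_add_hamiltonian (t : ℝ) (q : Q) (v : TangentSpace (𝓡 d) q)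
    (p : TangentSpace (𝓡 d) q →L[ℝ] ℝ) :
    D.lagrangian t q v + D.hamiltonian t q p - p v =
      D.a t q (v - D.sharp t q (p - D.b t q)) (v - D.sharp t q (p - D.b t q)) / 2 := by
  rw [a_add_sub, a_sharp, lagrangian, hamiltonian, sub_apply, sub_apply]
  ring

theorem momentum_eq_iff (t : ℝ) (q : Q) (v : TangentSpace (𝓡 d) q)
    (p : TangentSpace (𝓡 d) q →L[ℝ] ℝ) :
    D.momentum t q v = p ↔ v = D.sharp t q (p - D.b t q) := by
  have h1 : D.momentum t q v = p ↔ D.a t q v = p - D.b t q := by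
    rw [momentum, eq_sub_iff_add_eq]
  rw [h1]
  constructor
  · intro h
    obtain ⟨e, he⟩ := D.isInvertible_a t q
    simp [sharp, ← he, ← h]
  · rintro rfl
    exact D.a_sharp t q _

theorem momentum_eq_spaceDeriv_iff (u : ℝ × Q → ℝ) (t : ℝ) (q : Q) (v : TangentSpace (𝓡 d) q) :
    D.momentum t q v = spaceDeriv u t q ↔ v = D.charField u t q :=
  D.momentum_eq_iff t q v _

variable {D}

/-- Substituting the Hamilton-Jacobi equation into the Fenchel identity leaves an exact square. Its
sign gives the inequality with the Lagrangian, and its definiteness singles out the characteristic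
velocity. -/
theorem IsHJSolution.timeDeriv_add (h : D.IsHJSolution J u) {t : ℝ} (ht : t ∈ J) (q : Q)
    (v : EuclideanSpace ℝ (Fin d)) :
    timeDeriv u t q + spaceCovector d u t q v = D.lagrangian t q v
      - D.a t q (v - D.charField u t q : EuclideanSpace ℝ (Fin d))
        (v - D.charField u t q : EuclideanSpace ℝ (Fin d)) / 2 := by
  have h1 := D.lagrangian_add_hamiltonian t q v (spaceDeriv u t q)
  have h2 := h t ht q
  have h3 : spaceCovector d u t q v = spaceDeriv u t q v := rfl
  have h4 : D.a t q (v - D.charField u t q : EuclideanSpace ℝ (Fin d))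
        (v - D.charField u t q : EuclideanSpace ℝ (Fin d)) / 2 =
        D.lagrangian t q v + D.hamiltonian t q (spaceDeriv u t q) - spaceDeriv u t q v := h1.symm
  rw [h3, h4]
  linarith

theorem IsHJSolution.timeDeriv_add_le (h : D.IsHJSolution J u) {t : ℝ} (ht : t ∈ J) (q : Q)
    (v : EuclideanSpace ℝ (Fin d)) :
    timeDeriv u t q + spaceCovector d u t q v ≤ D.lagrangian t q v := by
  rw [h.timeDeriv_add ht]
  have := D.a_nonneg t q (v - D.charField u t q : EuclideanSpace ℝ (Fin d))
  linarith

theorem IsHJSolution.timeDeriv_add_eq_iff (h : D.IsHJSolution J u) {t : ℝ} (ht : t ∈ J) (q : Q)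
    (v : EuclideanSpace ℝ (Fin d)) :
    timeDeriv u t q + spaceCovector d u t q v = D.lagrangian t q v ↔ v = D.charField u t q := by
  rw [h.timeDeriv_add ht]
  have h1 := D.a_eq_zero_iff t q (v - D.charField u t q : EuclideanSpace ℝ (Fin d))
  have h2 : (v - D.charField u t q : EuclideanSpace ℝ (Fin d)) = 0 ↔ v = D.charField u t q :=
    sub_eq_zero
  constructor
  · intro h3
    exact h2.1 (h1.1 (by linarith))
  · intro h3
    have h4 := h1.2 (h2.2 h3)
    linarith

end MechanicalData

/-! ### The action -/

/-- Velocities at different times lie in different fibres, so continuity is expressed in the tangent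
bundle. It makes the integrand of the action continuous. -/
theorem IsC1CurveOn.continuousOn_velocityOn {c : ℝ → Q} {t₀ t₁ : ℝ} (hc : IsC1CurveOn d t₀ t₁ c)
    (h01 : t₀ < t₁) :
    ContinuousOn (fun t => (⟨c t, velocityOn t₀ t₁ c t⟩ : TangentBundle (𝓡 d) Q)) (Icc t₀ t₁) := by
  have h1 := ContMDiffOn.continuousOn_tangentMapWithin hc le_rfl
    (uniqueDiffOn_Icc h01).uniqueMDiffOn
  have h2 : Continuous (fun t : ℝ => (tangentBundleModelSpaceHomeomorph 𝓘(ℝ, ℝ)).symm (t, (1 : ℝ))) :=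
    (tangentBundleModelSpaceHomeomorph 𝓘(ℝ, ℝ)).symm.continuous.comp
      (continuous_id.prodMk continuous_const)
  exact h1.comp h2.continuousOn fun t ht => ht

variable {J : Set ℝ} {u : ℝ × Q → ℝ} {D : MechanicalData d Q r}

theorem IsC1CurveOn.continuousOn_lagrangian (D : MechanicalData d Q r) {c : ℝ → Q} {t₀ t₁ : ℝ}
    (hc : IsC1CurveOn d t₀ t₁ c) (h01 : t₀ < t₁) :
    ContinuousOn (fun t => D.lagrangian t (c t) (velocityOn t₀ t₁ c t)) (Icc t₀ t₁) := by
  have h1 := continuousOn_id.prodMk (hc.continuousOn_velocityOn h01)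
  have h2 := continuousOn_id.prodMk (ContMDiffOn.continuousOn hc)
  exact (((D.a_smooth.continuous.comp_continuousOn h1).div_const 2).add
    (D.b_smooth.continuous.comp_continuousOn h1)).sub (D.V_smooth.continuous.comp_continuousOn h2)

/-- The increment of a solution of the Hamilton-Jacobi equation is bounded by the action. -/
theorem MechanicalData.IsHJSolution.sub_le_action (h : D.IsHJSolution J u) (hu : IsC1On d J u)
    (hJo : IsOpen J) {c : ℝ → Q} {t₀ t₁ : ℝ} (hc : IsC1CurveOn d t₀ t₁ c) (h01 : t₀ < t₁)
    (hJ : Icc t₀ t₁ ⊆ J) : u (t₁, c t₁) ≤ u (t₀, c t₀) + D.action t₀ t₁ c := by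
  have h1 := hc.integral_deriv_comp hu hJo h01 hJ
  have h2 := intervalIntegral.integral_mono_on (μ := MeasureTheory.volume) h01.le
    ((hc.continuousOn_deriv_comp hu hJo h01 hJ).intervalIntegrable_of_Icc h01.le)
    ((hc.continuousOn_lagrangian D h01).intervalIntegrable_of_Icc h01.le)
    fun t ht => h.timeDeriv_add_le (hJ ht) (c t) (velocityOn (d := d) t₀ t₁ c t)
  rw [h1] at h2
  rw [MechanicalData.action]
  linarith

/-- Equality holds exactly for the integral curves of the characteristic field. -/
theorem MechanicalData.IsHJSolution.eq_action_iff (h : D.IsHJSolution J u) (hu : IsC1On d J u)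
    (hJo : IsOpen J) {c : ℝ → Q} {t₀ t₁ : ℝ} (hc : IsC1CurveOn d t₀ t₁ c) (h01 : t₀ < t₁)
    (hJ : Icc t₀ t₁ ⊆ J) : u (t₁, c t₁) = u (t₀, c t₀) + D.action t₀ t₁ c ↔
      ∀ t ∈ Icc t₀ t₁, velocityOn (d := d) t₀ t₁ c t = D.charField u t (c t) := by
  have h1 := hc.integral_deriv_comp hu hJo h01 hJ
  have hc1 := hc.continuousOn_deriv_comp hu hJo h01 hJ
  have hc2 := hc.continuousOn_lagrangian D h01
  have h2 := intervalIntegral.integral_sub (hc2.intervalIntegrable_of_Icc h01.le)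
    (hc1.intervalIntegrable_of_Icc h01.le) (μ := MeasureTheory.volume)
  rw [h1] at h2
  have h3 : u (t₁, c t₁) = u (t₀, c t₀) + D.action t₀ t₁ c ↔
      ∫ t in t₀..t₁, (D.lagrangian t (c t) (velocityOn t₀ t₁ c t) - (timeDeriv u t (c t)
        + spaceCovector d u t (c t) (velocityOn (d := d) t₀ t₁ c t))) = 0 := by
    rw [h2, MechanicalData.action]
    constructor <;> intro h <;> linarith
  rw [h3]
  constructor
  · intro h0 t ht
    refine (h.timeDeriv_add_eq_iff (hJ ht) (c t) _).1 ?_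
    by_contra hne
    have hle := h.timeDeriv_add_le (hJ ht) (c t) (velocityOn (d := d) t₀ t₁ c t)
    -- The defect is continuous and nonnegative: if it were positive at one time, endpoints
    -- included, its integral would be positive.
    refine (intervalIntegral.integral_pos h01 (hc2.sub hc1) (fun s hs => ?_)
      ⟨t, ht, ?_⟩).ne' h0
    · exact sub_nonneg.2 (h.timeDeriv_add_le (hJ (Ioc_subset_Icc_self hs)) _ _)
    · exact sub_pos.2 (lt_of_le_of_ne hle hne)
  · intro h0
    rw [← intervalIntegral.integral_zero (a := t₀) (b := t₁)]
    refine intervalIntegral.integral_congr fun t ht => ?_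
    rw [uIcc_of_le h01.le] at ht
    exact sub_eq_zero.2 ((h.timeDeriv_add_eq_iff (hJ ht) _ _).2 (h0 t ht)).symm

end Brinkmann

/-! ### Characteristics and the Euler-Lagrange equations -/

namespace Brinkmann

variable {d : ℕ} {Q : Type*} [TopologicalSpace Q] [ChartedSpace (EuclideanSpace ℝ (Fin d)) Q]
  [IsManifold (𝓡 d) 1 Q] {r : ℕ∞ω} [IsManifold (𝓡 d) (r + 1) Q]

namespace MechanicalData

variable {D : MechanicalData d Q r} {J : Set ℝ} {u : ℝ × Q → ℝ}

/-- The differential of `u` along `Q` in the preferred chart around `z`. -/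
def chartCovector (z : Q) (u : ℝ × Q → ℝ) (t : ℝ) (x : EuclideanSpace ℝ (Fin d)) :
    EuclideanSpace ℝ (Fin d) →L[ℝ] ℝ :=
  (fderiv ℝ (chartFun z u) (t, x)).comp (ContinuousLinearMap.inr ℝ ℝ (EuclideanSpace ℝ (Fin d)))

/-- The bridge between the intrinsic characteristic field and coordinates. Both sides are covector
equations related by the chart derivative, which is invertible, so testing on its image loses
nothing. -/
theorem localSystem_momentum_eq_iff (D : MechanicalData d Q r) (hr : 2 ≤ r) (hu : IsC1On d J u)
    (hJ : IsOpen J) (z : Q) {t : ℝ} (ht : t ∈ J) {x : EuclideanSpace ℝ (Fin d)}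
    (hx : x ∈ (extChartAt (𝓡 d) z).target) (ξ : EuclideanSpace ℝ (Fin d)) :
    (D.localSystem hr z).momentum t x ξ = chartCovector z u t x ↔
      chartDeriv z x ξ = D.charField u t ((extChartAt (𝓡 d) z).symm x) := by
  set q := (extChartAt (𝓡 d) z).symm x with hq
  have h1 := D.momentum_eq_spaceDeriv_iff u t q (chartDeriv z x ξ)
  refine Iff.trans ?_ h1
  have h2 : ∀ η, (D.localSystem hr z).momentum t x ξ η =
      (D.momentum t q (chartDeriv z x ξ) : EuclideanSpace ℝ (Fin d) →L[ℝ] ℝ) (chartDeriv z x η) :=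
    fun η => rfl
  have h3 : ∀ η, chartCovector z u t x η = spaceCovector d u t q (chartDeriv z x η) := by
    intro η
    have := hu.fderiv_chartFun hJ z ht hx 0 η
    rw [mul_zero, zero_add] at this
    exact this
  constructor
  · intro h
    refine ContinuousLinearMap.ext fun v => ?_
    obtain ⟨e, he⟩ := chartDeriv_isInvertible z hx
    have hv : chartDeriv z x (e.symm v) = v := by
      rw [← he]
      exact e.apply_symm_apply v
    have h4 := congrArg (fun f : EuclideanSpace ℝ (Fin d) →L[ℝ] ℝ => f (e.symm v)) h
    simp only [h2, h3, hv] at h4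
    exact h4
  · intro h
    ext η
    rw [h2, h3]
    exact congrArg (fun f : EuclideanSpace ℝ (Fin d) →L[ℝ] ℝ => f (chartDeriv z x η)) h

/-- With its equality case `fderiv_chartFun_eq`, this supplies the hypotheses of
`LocalSystem.hasDerivAt_spaceDeriv_of_calibrated` in a chart. -/
theorem IsHJSolution.fderiv_chartFun_le (h : D.IsHJSolution J u) (hr : 2 ≤ r) (hu : IsC1On d J u)
    (hJ : IsOpen J) (z : Q) {t : ℝ} (ht : t ∈ J) {x : EuclideanSpace ℝ (Fin d)}
    (hx : x ∈ (extChartAt (𝓡 d) z).target) (ξ : EuclideanSpace ℝ (Fin d)) :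
    fderiv ℝ (chartFun z u) (t, x) (1, ξ) ≤ (D.localSystem hr z).lagrangian t x ξ := by
  rw [hu.fderiv_chartFun hJ z ht hx, mul_one]
  exact h.timeDeriv_add_le ht _ _

theorem IsHJSolution.fderiv_chartFun_eq (h : D.IsHJSolution J u) (hr : 2 ≤ r) (hu : IsC1On d J u)
    (hJ : IsOpen J) (z : Q) {t : ℝ} (ht : t ∈ J) {x : EuclideanSpace ℝ (Fin d)}
    (hx : x ∈ (extChartAt (𝓡 d) z).target) {ξ : EuclideanSpace ℝ (Fin d)}
    (hξ : (D.localSystem hr z).momentum t x ξ = chartCovector z u t x) :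
    fderiv ℝ (chartFun z u) (t, x) (1, ξ) = (D.localSystem hr z).lagrangian t x ξ := by
  rw [hu.fderiv_chartFun hJ z ht hx, mul_one]
  exact (h.timeDeriv_add_eq_iff ht _ _).2
    ((D.localSystem_momentum_eq_iff hr hu hJ z ht hx ξ).1 hξ)

theorem continuousOn_chartCovector (hu : IsC1On d J u) (hJ : IsOpen J) (z : Q) :
    ContinuousOn (fun p : ℝ × EuclideanSpace ℝ (Fin d) => chartCovector z u p.1 p.2)
      (J ×ˢ (extChartAt (𝓡 d) z).target) :=
  ((hu.contDiffOn_chartFun z).continuousOn_fderiv_of_isOpen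
    (hJ.prod (isOpen_extChartAt_target z)) le_rfl).clm_comp continuousOn_const

theorem _root_.Brinkmann.LocalSystem.continuousOn_velocityOf_comp {E : Type*}
    [NormedAddCommGroup E] [NormedSpace ℝ E] [FiniteDimensional ℝ E] (S : LocalSystem E)
    {p : ℝ × E → E →L[ℝ] ℝ} (hp : ContinuousOn p (J ×ˢ S.U)) :
    ContinuousOn (fun e : ℝ × E => S.velocityOf e.1 e.2 (p e)) (J ×ˢ S.U) := by
  have h1 : ContinuousOn (fun e : ℝ × E => (e.1, e.2, p e)) (J ×ˢ S.U) :=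
    continuousOn_fst.prodMk (continuousOn_snd.prodMk hp)
  exact S.contDiffOn_velocityOf.continuousOn.comp h1 fun e he => ⟨mem_univ _, he.2, mem_univ _⟩

theorem continuousOn_velocityOf_chartCovector (D : MechanicalData d Q r) (hr : 2 ≤ r)
    (hu : IsC1On d J u) (hJ : IsOpen J) (z : Q) :
    ContinuousOn (fun p : ℝ × EuclideanSpace ℝ (Fin d) =>
      (D.localSystem hr z).velocityOf p.1 p.2 (chartCovector z u p.1 p.2))
      (J ×ˢ (extChartAt (𝓡 d) z).target) :=
  (D.localSystem hr z).continuousOn_velocityOf_comp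
    (p := fun e => chartCovector z u e.1 e.2) (continuousOn_chartCovector hu hJ z)

/-- Through any point there is locally an integral curve of the characteristic field. -/
theorem exists_hasVelocityAt_charField (D : MechanicalData d Q r) (hr : 2 ≤ r)
    (hu : IsC1On d J u) (hJ : IsOpen J) {t₁ : ℝ} (ht₁ : t₁ ∈ J) (q₁ : Q) :
    ∃ c : ℝ → Q, c t₁ = q₁ ∧ ∀ᶠ t in 𝓝 t₁, HasVelocityAt c (D.charField u t (c t)) t := by
  set φ := extChartAt (𝓡 d) q₁ with hφ
  have hmem : (t₁, φ q₁) ∈ J ×ˢ φ.target := ⟨ht₁, φ.map_source (mem_extChartAt_source q₁)⟩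
  -- The field involves the first derivatives of a C¹ function and is only continuous, so Peano's
  -- theorem is used.
  obtain ⟨x, hx0, hx⟩ := exists_hasDerivAt_of_continuousOn
    (hJ.prod (isOpen_extChartAt_target q₁))
    (D.continuousOn_velocityOf_chartCovector hr hu hJ q₁) hmem
  refine ⟨fun t => φ.symm (x t), ?_, ?_⟩
  · change φ.symm (x t₁) = q₁
    rw [hx0]
    exact φ.left_inv (mem_extChartAt_source q₁)
  · filter_upwards [hx] with t ht
    have h1 := hasVelocityAt_chart_symm q₁ ht.1.2 ht.2
    have h2 := (D.localSystem hr q₁).momentum_velocityOf ht.1.2 t (chartCovector q₁ u t (x t))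
    rw [D.localSystem_momentum_eq_iff hr hu hJ q₁ ht.1.1 ht.1.2] at h2
    rw [h2] at h1
    exact h1

variable {A : Set ℝ} {c : ℝ → Q}

theorem isOpen_chart_times (z : Q) (hA : IsOpen A) (hc : ContinuousOn c A) :
    IsOpen (A ∩ c ⁻¹' (extChartAt (𝓡 d) z).source) :=
  hc.isOpen_inter_preimage hA (isOpen_extChartAt_source z)

/-- Integral curves of the characteristic field in a chart. -/
theorem momentum_chart_of_hasVelocityAt (D : MechanicalData d Q r) (hr : 2 ≤ r)
    (hu : IsC1On d J u) (hJ : IsOpen J) (z : Q) {t : ℝ} (ht : t ∈ J)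
    (hc : HasVelocityAt c (D.charField u t (c t)) t) (hz : c t ∈ (extChartAt (𝓡 d) z).source) :
    (D.localSystem hr z).momentum t (extChartAt (𝓡 d) z (c t))
      (deriv (fun s => extChartAt (𝓡 d) z (c s)) t) =
      chartCovector z u t (extChartAt (𝓡 d) z (c t)) := by
  rw [D.localSystem_momentum_eq_iff hr hu hJ z ht ((extChartAt (𝓡 d) z).map_source hz),
    (extChartAt (𝓡 d) z).left_inv hz, ← velocity_eq_chartDeriv z hc.mdifferentiableAt hz]
  exact hc.velocity_eq

/-- The coordinate velocity is the Legendre transform of the continuous covector ∂_x u evaluated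
along the curve; differentiable integral curves are therefore C¹. -/
theorem continuousOn_deriv_chart (D : MechanicalData d Q r) (hr : 2 ≤ r)
    (hu : IsC1On d J u) (hJ : IsOpen J) (z : Q) (hAJ : A ⊆ J)
    (hc : ∀ t ∈ A, HasVelocityAt c (D.charField u t (c t)) t) :
    ContinuousOn (deriv (fun s => extChartAt (𝓡 d) z (c s)))
      (A ∩ c ⁻¹' (extChartAt (𝓡 d) z).source) := by
  have hd : ∀ t ∈ A ∩ c ⁻¹' (extChartAt (𝓡 d) z).source,
      DifferentiableAt ℝ (fun s => extChartAt (𝓡 d) z (c s)) t := fun t ht =>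
    differentiableAt_chart_curve z (hc t ht.1).mdifferentiableAt ht.2
  have h1 : ContinuousOn (fun t => (t, extChartAt (𝓡 d) z (c t)))
      (A ∩ c ⁻¹' (extChartAt (𝓡 d) z).source) :=
    continuousOn_id.prodMk fun t ht => (hd t ht).continuousAt.continuousWithinAt
  refine ((D.continuousOn_velocityOf_chartCovector hr hu hJ z).comp h1
    fun t ht => ⟨hAJ ht.1, (extChartAt (𝓡 d) z).map_source ht.2⟩).congr fun t ht => ?_
  have h2 := D.momentum_chart_of_hasVelocityAt hr hu hJ z (hAJ ht.1) (hc t ht.1) ht.2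
  change _ = (D.localSystem hr z).velocityOf t (extChartAt (𝓡 d) z (c t))
    (chartCovector z u t (extChartAt (𝓡 d) z (c t)))
  rw [← h2]
  exact ((D.localSystem hr z).velocityOf_momentum ((extChartAt (𝓡 d) z).map_source ht.2) t _).symm

/-- Integral curves of the characteristic field are `C¹`. -/
theorem contMDiffOn_of_hasVelocityAt (D : MechanicalData d Q r) (hr : 2 ≤ r)
    (hu : IsC1On d J u) (hJ : IsOpen J) (hA : IsOpen A) (hAJ : A ⊆ J)
    (hc : ∀ t ∈ A, HasVelocityAt c (D.charField u t (c t)) t) :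
    ContMDiffOn 𝓘(ℝ, ℝ) (𝓡 d) 1 c A := by
  have hcc : ContinuousOn c A := fun t ht =>
    (HasVelocityAt.mdifferentiableAt (hc t ht)).continuousAt.continuousWithinAt
  intro t ht
  refine ContMDiffAt.contMDiffWithinAt ?_
  have hz := mem_extChartAt_source (I := 𝓡 d) (c t)
  rw [contMDiffAt_curve_iff 1 (c t) (hcc.continuousAt (hA.mem_nhds ht)) hz]
  have hO := isOpen_chart_times (d := d) (c t) hA hcc
  refine ContDiffOn.contDiffAt (s := A ∩ c ⁻¹' (extChartAt (𝓡 d) (c t)).source) ?_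
    (hO.mem_nhds ⟨ht, hz⟩)
  rw [show (1 : ℕ∞ω) = 0 + 1 by simp, contDiffOn_succ_iff_deriv_of_isOpen hO]
  refine ⟨fun s hs => (differentiableAt_chart_curve (c t) (hc s hs.1).mdifferentiableAt
    hs.2).differentiableWithinAt, by simp, ?_⟩
  rw [contDiffOn_zero]
  exact D.continuousOn_deriv_chart hr hu hJ (c t) hAJ hc

/-- The momentum condition is inverted by the metric, and the C¹ requirement is automatic for
integral curves of a continuous field. -/
theorem isCharacteristic_iff (D : MechanicalData d Q r) (hr : 2 ≤ r)
    (hu : IsC1On d J u) (hJ : IsOpen J) : D.IsCharacteristic J u A c ↔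
      IsOpenSubinterval J A ∧ ∀ t ∈ A, HasVelocityAt c (D.charField u t (c t)) t := by
  constructor
  · rintro ⟨hA, hc, hm⟩
    refine ⟨hA, fun t ht => ?_⟩
    have h1 := hasVelocityAt_velocity
      ((hc.contMDiffAt (hA.1.mem_nhds ht)).mdifferentiableAt one_ne_zero)
    rwa [show velocity (d := d) c t = D.charField u t (c t) from
      (D.momentum_eq_spaceDeriv_iff u t (c t) _).1 (hm t ht)] at h1
  · rintro ⟨hA, hc⟩
    refine ⟨hA, D.contMDiffOn_of_hasVelocityAt hr hu hJ hA.1 hA.2.2.2 hc, fun t ht => ?_⟩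
    exact (D.momentum_eq_spaceDeriv_iff u t (c t) _).2 (hc t ht).velocity_eq

/-! ### The Euler-Lagrange equations -/

theorem isELSolution_iff (D : MechanicalData d Q r) (hr : 2 ≤ r) : D.IsELSolution J A c ↔
    IsOpenSubinterval J A ∧ ContMDiffOn 𝓘(ℝ, ℝ) (𝓡 d) 2 c A ∧
    ∀ z : Q, ∀ t ∈ A, c t ∈ (extChartAt (𝓡 d) z).source →
      (D.localSystem hr z).EulerLagrangeAt (fun s => extChartAt (𝓡 d) z (c s)) t := by
  simp only [IsELSolution, D.chartLagrangian_eq hr, LocalSystem.EulerLagrangeAt,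
    LocalSystem.fderiv_lagrangian, LocalSystem.force]

/-- Along an integral curve the momentum is ∂_x u, and calibration makes that covector
differentiable. Here the first order equation with merely continuous field gains the uniqueness of a
second order one. -/
theorem IsHJSolution.eulerLagrangeAt (h : D.IsHJSolution J u) (hr : 2 ≤ r)
    (hu : IsC1On d J u) (hJ : IsOpen J) (hA : IsOpen A) (hAJ : A ⊆ J)
    (hc : ∀ t ∈ A, HasVelocityAt c (D.charField u t (c t)) t) (z : Q) {t : ℝ} (ht : t ∈ A)
    (hz : c t ∈ (extChartAt (𝓡 d) z).source) :
    (D.localSystem hr z).EulerLagrangeAt (fun s => extChartAt (𝓡 d) z (c s)) t := by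
  have hcc : ContinuousOn c A := fun t ht =>
    (HasVelocityAt.mdifferentiableAt (hc t ht)).continuousAt.continuousWithinAt
  have hO := (isOpen_chart_times z hA hcc).mem_nhds ⟨ht, hz⟩
  have hmom : ∀ s ∈ A ∩ c ⁻¹' (extChartAt (𝓡 d) z).source, _ := fun s hs =>
    D.momentum_chart_of_hasVelocityAt hr hu hJ z (hAJ hs.1) (hc s hs.1) hs.2
  have h1 := (D.localSystem hr z).hasDerivAt_spaceDeriv_of_calibrated hJ
    (hu.contDiffOn_chartFun z) (fun t ht x hx ξ => h.fderiv_chartFun_le hr hu hJ z ht hx ξ)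
    (x := fun s => extChartAt (𝓡 d) z (c s)) (hAJ ht) ?_
    ((D.continuousOn_deriv_chart hr hu hJ z hAJ hc).continuousAt hO)
  · refine h1.congr_of_eventuallyEq ?_
    filter_upwards [hO] with s hs using hmom s hs
  · filter_upwards [hO] with s hs
    exact ⟨(extChartAt (𝓡 d) z).map_source hs.2,
      differentiableAt_chart_curve z (hc s hs.1).mdifferentiableAt hs.2,
      h.fderiv_chartFun_eq hr hu hJ z (hAJ hs.1) ((extChartAt (𝓡 d) z).map_source hs.2)
        (hmom s hs)⟩

/-- Characteristics solve the Euler-Lagrange equations. -/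
theorem IsHJSolution.isELSolution (h : D.IsHJSolution J u) (hr : 2 ≤ r)
    (hu : IsC1On d J u) (hJ : IsOpen J) (hA : IsOpenSubinterval J A)
    (hc : ∀ t ∈ A, HasVelocityAt c (D.charField u t (c t)) t) : D.IsELSolution J A c := by
  rw [D.isELSolution_iff hr]
  have hEL := fun z t (ht : t ∈ A) hz => h.eulerLagrangeAt hr hu hJ hA.1 hA.2.2.2 hc z ht hz
  refine ⟨hA, fun t ht => ?_, hEL⟩
  have hcc : ContinuousOn c A := fun t ht =>
    (HasVelocityAt.mdifferentiableAt (hc t ht)).continuousAt.continuousWithinAt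
  have h2 : IsManifold (𝓡 d) 2 Q := IsManifold.of_le (n := r + 1) (hr.trans le_self_add)
  refine ContMDiffAt.contMDiffWithinAt ?_
  have hz := mem_extChartAt_source (I := 𝓡 d) (c t)
  rw [contMDiffAt_curve_iff 2 (c t) (hcc.continuousAt (hA.1.mem_nhds ht)) hz]
  have hO := isOpen_chart_times (d := d) (c t) hA.1 hcc
  refine ((D.localSystem hr (c t)).contDiffOn_of_eulerLagrangeAt hO fun s hs => ?_).contDiffAt
    (hO.mem_nhds ⟨ht, hz⟩)
  exact ⟨(extChartAt (𝓡 d) (c t)).map_source hs.2,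
      differentiableAt_chart_curve (c t) (hc s hs.1).mdifferentiableAt hs.2,
      hEL (c t) s hs.1 hs.2⟩

/-- Solutions of the Euler-Lagrange equations are locally determined by position and velocity. -/
theorem IsELSolution.eventuallyEq (hr : 2 ≤ r) {A' : Set ℝ} {c' : ℝ → Q}
    (h : D.IsELSolution J A c) (h' : D.IsELSolution J A' c') {t : ℝ} (ht : t ∈ A) (ht' : t ∈ A')
    (h0 : c t = c' t) (h1 : velocity (d := d) c t = velocity (d := d) c' t) : c =ᶠ[𝓝 t] c' := by
  rw [D.isELSolution_iff hr] at h h'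
  set φ := extChartAt (𝓡 d) (c t) with hφ
  have hz := mem_extChartAt_source (I := 𝓡 d) (c t)
  have key : ∀ {A : Set ℝ} {c' : ℝ → Q}, (IsOpenSubinterval J A ∧ ContMDiffOn 𝓘(ℝ, ℝ) (𝓡 d) 2 c' A ∧
      ∀ z : Q, ∀ t ∈ A, c' t ∈ (extChartAt (𝓡 d) z).source →
      (D.localSystem hr z).EulerLagrangeAt (fun s => extChartAt (𝓡 d) z (c' s)) t) → t ∈ A →
      c' t ∈ φ.source → ∀ᶠ s in 𝓝 t, c' s ∈ φ.source ∧ φ (c' s) ∈ φ.target ∧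
        DifferentiableAt ℝ (fun s => φ (c' s)) s ∧
        (D.localSystem hr (c t)).EulerLagrangeAt (fun s => φ (c' s)) s := by
    intro A c' h ht hz'
    filter_upwards [(isOpen_chart_times (c t) h.1.1 h.2.1.continuousOn).mem_nhds ⟨ht, hz'⟩]
      with s hs
    exact ⟨hs.2, φ.map_source hs.2, differentiableAt_chart_curve (c t)
      ((h.2.1.contMDiffAt (h.1.1.mem_nhds hs.1)).mdifferentiableAt two_ne_zero) hs.2,
      h.2.2 (c t) s hs.1 hs.2⟩
  have hz' : c' t ∈ φ.source := by rw [← h0]; exact hz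
  have k1 := key h ht hz
  have k2 := key h' ht' hz'
  -- Both curves are read in the same chart at the common point, where the chart derivative is
  -- injective.
  have hv : deriv (fun s => φ (c s)) t = deriv (fun s => φ (c' s)) t := by
    have e1 := velocity_eq_chartDeriv (c t)
      ((h.2.1.contMDiffAt (h.1.1.mem_nhds ht)).mdifferentiableAt two_ne_zero) hz
    have e2 := velocity_eq_chartDeriv (c t)
      ((h'.2.1.contMDiffAt (h'.1.1.mem_nhds ht')).mdifferentiableAt two_ne_zero) hz'
    obtain ⟨e, he⟩ := chartDeriv_isInvertible (c t) (φ.map_source hz)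
    rw [← h0] at e2
    have e3 := e1.symm.trans (h1.trans e2)
    rw [← he] at e3
    exact e.injective e3
  have := LocalSystem.eventuallyEq_of_eulerLagrangeAt (S := D.localSystem hr (c t))
    (x := fun s => φ (c s)) (y := fun s => φ (c' s)) (t₀ := t)
    (k1.mono fun s hs => hs.2) (k2.mono fun s hs => hs.2) (by simp only [h0]) hv
  filter_upwards [this, k1, k2] with s hs h1 h2
  exact φ.injOn h1.1 h2.1 hs

end MechanicalData
end Brinkmann

/-! ### Uniqueness, maximality and minimality of characteristics -/

namespace Brinkmann

/-- The set of times near which the curves agree is open by definition; it is closed in B by the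
Hausdorff property together with local uniqueness. -/
theorem eqOn_of_eventuallyEq {X : Type*} [TopologicalSpace X] [T2Space X] {B : Set ℝ}
    {c c' : ℝ → X} (hB : IsOpen B) (hB' : IsPreconnected B) (hc : ContinuousOn c B)
    (hc' : ContinuousOn c' B) {t₁ : ℝ} (ht₁ : t₁ ∈ B) (h1 : c t₁ = c' t₁)
    (h : ∀ t ∈ B, c t = c' t → c =ᶠ[𝓝 t] c') : EqOn c c' B := by
  have key : B ⊆ {t | c =ᶠ[𝓝 t] c'} := by
    refine hB'.subset_of_closure_inter_subset isOpen_setOfPred_eventually_nhds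
      ⟨t₁, ht₁, h t₁ ht₁ h1⟩ fun t ht => h t ht.2 ?_
    refine tendsto_nhds_unique_of_frequently_eq (hc.continuousAt (hB.mem_nhds ht.2))
      (hc'.continuousAt (hB.mem_nhds ht.2)) ?_
    exact (mem_closure_iff_frequently.1 ht.1).mono fun s hs => Eventually.self_of_nhds (p := fun s => c s = c' s) hs
  exact fun t ht => Eventually.self_of_nhds (p := fun s => c s = c' s) (key ht)

variable {d : ℕ} {Q : Type*} [TopologicalSpace Q] [ChartedSpace (EuclideanSpace ℝ (Fin d)) Q]
  [IsManifold (𝓡 d) 1 Q] {r : ℕ∞ω} [IsManifold (𝓡 d) (r + 1) Q]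

namespace MechanicalData

variable {D : MechanicalData d Q r} {J : Set ℝ} {u : ℝ × Q → ℝ} {A : Set ℝ} {c : ℝ → Q}

theorem IsCharacteristic.continuousOn (h : D.IsCharacteristic J u A c) : ContinuousOn c A :=
  h.2.1.continuousOn

theorem exists_isCharacteristic (D : MechanicalData d Q r) (hr : 2 ≤ r)
    (hu : IsC1On d J u) (hJ : IsOpen J) {t₁ : ℝ} (ht₁ : t₁ ∈ J) (q₁ : Q) :
    ∃ ε > 0, ∃ c : ℝ → Q, c t₁ = q₁ ∧ D.IsCharacteristic J u (Ioo (t₁ - ε) (t₁ + ε)) c := by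
  obtain ⟨c, hc1, hc⟩ := D.exists_hasVelocityAt_charField hr hu hJ ht₁ q₁
  obtain ⟨ε, hε, hb⟩ := Metric.eventually_nhds_iff_ball.1 (hc.and (hJ.eventually_mem ht₁))
  rw [Real.ball_eq_Ioo] at hb
  refine ⟨ε, hε, c, hc1, (D.isCharacteristic_iff hr hu hJ).2
    ⟨⟨isOpen_Ioo, ordConnected_Ioo, ⟨t₁, by constructor <;> linarith⟩, fun t ht => (hb t ht).2⟩,
      fun t ht => (hb t ht).1⟩⟩

theorem IsHJSolution.isELSolution_of_isCharacteristic (h : D.IsHJSolution J u) (hr : 2 ≤ r)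
    (hu : IsC1On d J u) (hJ : IsOpen J) (hc : D.IsCharacteristic J u A c) :
    D.IsELSolution J A c :=
  h.isELSolution hr hu hJ hc.1 ((D.isCharacteristic_iff hr hu hJ).1 hc).2

/-- At a common point both velocities equal the characteristic field there, so uniqueness for the
Euler-Lagrange equation applies. -/
theorem IsHJSolution.characteristic_eventuallyEq (h : D.IsHJSolution J u) (hr : 2 ≤ r)
    (hu : IsC1On d J u) (hJ : IsOpen J) (hc : D.IsCharacteristic J u A c)
    {A' : Set ℝ} {c' : ℝ → Q} (hc' : D.IsCharacteristic J u A' c') {t : ℝ} (ht : t ∈ A)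
    (ht' : t ∈ A') (h0 : c t = c' t) : c =ᶠ[𝓝 t] c' := by
  refine (h.isELSolution_of_isCharacteristic hr hu hJ hc).eventuallyEq hr
    (h.isELSolution_of_isCharacteristic hr hu hJ hc') ht ht' h0 ?_
  have h1 := (((D.isCharacteristic_iff hr hu hJ).1 hc).2 t ht).velocity_eq
  have h2 := (((D.isCharacteristic_iff hr hu hJ).1 hc').2 t ht').velocity_eq
  rw [← h0] at h2
  exact h1.trans h2.symm

theorem IsHJSolution.characteristic_eqOn [T2Space Q] (h : D.IsHJSolution J u) (hr : 2 ≤ r)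
    (hu : IsC1On d J u) (hJ : IsOpen J) (hc : D.IsCharacteristic J u A c)
    {A' : Set ℝ} {c' : ℝ → Q} (hc' : D.IsCharacteristic J u A' c') {t : ℝ} (ht : t ∈ A)
    (ht' : t ∈ A') (h0 : c t = c' t) : EqOn c c' (A ∩ A') :=
  eqOn_of_eventuallyEq (hc.1.1.inter hc'.1.1) (hc.1.2.1.inter hc'.1.2.1).isPreconnected
    (hc.continuousOn.mono inter_subset_left) (hc'.continuousOn.mono inter_subset_right)
    ⟨ht, ht'⟩ h0 fun _ hs => h.characteristic_eventuallyEq hr hu hJ hc hc' hs.1 hs.2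

/-- The maximal characteristic through a given point. -/
theorem IsHJSolution.exists_maximal_characteristic [T2Space Q] (h : D.IsHJSolution J u)
    (hr : 2 ≤ r) (hu : IsC1On d J u) (hJ : IsOpen J) {t₁ : ℝ} (ht₁ : t₁ ∈ J) (q₁ : Q) :
    ∃ (A : Set ℝ) (c : ℝ → Q), t₁ ∈ A ∧ c t₁ = q₁ ∧ D.IsCharacteristic J u A c ∧
      ∀ A' c', D.IsCharacteristic J u A' c' → t₁ ∈ A' → c' t₁ = q₁ → A' ⊆ A ∧ EqOn c' c A' := by
  classical
  let P : Set ℝ → (ℝ → Q) → Prop := fun A c => D.IsCharacteristic J u A c ∧ t₁ ∈ A ∧ c t₁ = q₁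
  let A : Set ℝ := ⋃₀ {B | ∃ c, P B c}
  -- All characteristics through the given point agree on common times, so they glue on the union of
  -- their intervals; the value q₁ at other times is irrelevant.
  have hex : ∀ t : ℝ, ∃ q : Q, ∀ B c, P B c → t ∈ B → c t = q := by
    intro t
    by_cases ht : ∃ B c, P B c ∧ t ∈ B
    · obtain ⟨B, c, hP, htB⟩ := ht
      exact ⟨c t, fun B' c' hP' htB' => h.characteristic_eqOn hr hu hJ hP'.1 hP.1 hP'.2.1 hP.2.1
        (hP'.2.2.trans hP.2.2.symm) ⟨htB', htB⟩⟩
    · exact ⟨q₁, fun B c hP htB => (ht ⟨B, c, hP, htB⟩).elim⟩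
  choose c hc using hex
  have hsub : ∀ B c', P B c' → B ⊆ A := fun B c' hP => subset_sUnion_of_mem ⟨c', hP⟩
  obtain ⟨ε, hε, c₀, hc₀, hchar₀⟩ := D.exists_isCharacteristic hr hu hJ ht₁ q₁
  have hP₀ : P (Ioo (t₁ - ε) (t₁ + ε)) c₀ := ⟨hchar₀, by constructor <;> linarith, hc₀⟩
  have ht₁A : t₁ ∈ A := hsub _ _ hP₀ hP₀.2.1
  refine ⟨A, c, ht₁A, ?_, ?_, fun A' c' h1 h2 h3 =>
    ⟨hsub A' c' ⟨h1, h2, h3⟩, fun t ht => hc t A' c' ⟨h1, h2, h3⟩ ht⟩⟩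
  · rw [← hc t₁ _ _ hP₀ hP₀.2.1, hc₀]
  · refine (D.isCharacteristic_iff hr hu hJ).2 ⟨⟨isOpen_sUnion fun B ⟨_, hB⟩ => hB.1.1.1, ?_,
      ⟨t₁, ht₁A⟩, sUnion_subset fun B ⟨_, hB⟩ => hB.1.1.2.2.2⟩, ?_⟩
    · have h1 : IsPreconnected A := isPreconnected_sUnion t₁ {B | ∃ c, P B c}
        (fun B ⟨_, hB⟩ => hB.2.1) fun B ⟨_, hB⟩ => hB.1.1.2.1.isPreconnected
      exact h1.ordConnected
    · rintro t ⟨B, ⟨c', hP⟩, htB⟩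
      have h1 := ((D.isCharacteristic_iff hr hu hJ).1 hP.1).2 t htB
      have h2 : c =ᶠ[𝓝 t] c' := by
        filter_upwards [hP.1.1.1.mem_nhds htB] with s hs using (hc s B c' hP hs).symm
      rw [← h2.self_of_nhds] at h1
      exact h1.congr h2

/-- An extension of a characteristic as a solution of the Euler-Lagrange equations is a
characteristic. -/
theorem IsHJSolution.isCharacteristic_of_isELSolution (h : D.IsHJSolution J u) (hr : 2 ≤ r)
    (hu : IsC1On d J u) (hJ : IsOpen J) (hc : D.IsCharacteristic J u A c) {A' : Set ℝ} {c' : ℝ → Q}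
    (hc' : D.IsELSolution J A' c') (hA : A ⊆ A') (heq : EqOn c c' A) :
    D.IsCharacteristic J u A' c' := by
  have hEL := ((D.isELSolution_iff hr).1 hc').2.2
  have hvel : ∀ t ∈ A', HasVelocityAt c' (velocity (d := d) c' t) t := fun t ht =>
    hasVelocityAt_velocity ((hc'.2.1.contMDiffAt (hc'.1.1.mem_nhds ht)).mdifferentiableAt
      two_ne_zero)
  have hcont := hc'.2.1.continuousOn
  -- Connectedness argument for the open set of times near which c' is an integral curve; it
  -- contains A, and its closedness in A' has to be shown.
  have key : A' ⊆ {t | ∀ᶠ s in 𝓝 t, HasVelocityAt c' (D.charField u s (c' s)) s} := by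
    obtain ⟨t₀, ht₀⟩ := hc.1.2.2.1
    refine hc'.1.2.1.isPreconnected.subset_of_closure_inter_subset isOpen_setOfPred_eventually_nhds
      ⟨t₀, hA ht₀, ?_⟩ ?_
    · filter_upwards [hc.1.1.mem_nhds ht₀] with s hs
      have h1 := ((D.isCharacteristic_iff hr hu hJ).1 hc).2 s hs
      rw [heq hs] at h1
      refine h1.congr ?_
      filter_upwards [hc.1.1.mem_nhds hs] with s' hs' using (heq hs').symm
    · rintro t ⟨htc, ht⟩
      have htJ : t ∈ J := hc'.1.2.2.2 ht
      set z := c' t with hz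
      have hzs := mem_extChartAt_source (I := 𝓡 d) z
      have hO := isOpen_chart_times (d := d) z hc'.1.1 hcont
      -- At a limit time the momentum condition persists, because both sides are continuous: the
      -- momentum by the Euler-Lagrange equation, ∂_x u because u is C¹.
      have hm : (D.localSystem hr z).momentum t (extChartAt (𝓡 d) z (c' t))
          (deriv (fun s => extChartAt (𝓡 d) z (c' s)) t) =
          chartCovector z u t (extChartAt (𝓡 d) z (c' t)) := by
        refine tendsto_nhds_unique_of_frequently_eq (f := fun s =>
          (D.localSystem hr z).momentum s (extChartAt (𝓡 d) z (c' s))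
            (deriv (fun s => extChartAt (𝓡 d) z (c' s)) s))
          (g := fun s => chartCovector z u s (extChartAt (𝓡 d) z (c' s)))
          (HasDerivAt.continuousAt (hEL z t ht hzs)) ?_ ?_
        · have h1 : ContinuousAt (fun s => (s, extChartAt (𝓡 d) z (c' s))) t :=
            continuousAt_id.prodMk
              (differentiableAt_chart_curve z (hvel t ht).mdifferentiableAt hzs).continuousAt
          exact ContinuousAt.comp (g := fun p : ℝ × EuclideanSpace ℝ (Fin d) =>
            chartCovector z u p.1 p.2) ((continuousOn_chartCovector hu hJ z).continuousAt
              ((hJ.prod (isOpen_extChartAt_target z)).mem_nhds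
                ⟨htJ, (extChartAt (𝓡 d) z).map_source hzs⟩)) h1
        · refine ((mem_closure_iff_frequently.1 htc).and_eventually
            (hO.eventually_mem ⟨ht, hzs⟩)).mono ?_
          rintro s ⟨hs, hsA, hsz⟩
          exact D.momentum_chart_of_hasVelocityAt hr hu hJ z (hc'.1.2.2.2 hsA)
            (Eventually.self_of_nhds
              (p := fun s => HasVelocityAt c' (D.charField u s (c' s)) s) hs) hsz
      have hv : velocity (d := d) c' t = D.charField u t (c' t) := by
        rw [D.localSystem_momentum_eq_iff hr hu hJ z htJ ((extChartAt (𝓡 d) z).map_source hzs),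
          (extChartAt (𝓡 d) z).left_inv hzs] at hm
        exact (velocity_eq_chartDeriv z (hvel t ht).mdifferentiableAt hzs).trans hm
      -- A fresh characteristic started at c'(t) has the same velocity as c' there. Both solve the
      -- Euler-Lagrange equation, so they coincide near t.
      obtain ⟨ε, hε, e, he, hchar⟩ := D.exists_isCharacteristic hr hu hJ htJ (c' t)
      have hte : t ∈ Ioo (t - ε) (t + ε) := by constructor <;> linarith
      have h2 := ((D.isCharacteristic_iff hr hu hJ).1 hchar).2
      have h3 : c' =ᶠ[𝓝 t] e := by
        refine hc'.eventuallyEq hr (h.isELSolution_of_isCharacteristic hr hu hJ hchar) ht hte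
          he.symm ?_
        have h4 := (h2 t hte).velocity_eq
        rw [he] at h4
        exact hv.trans h4.symm
      filter_upwards [eventually_eventually_nhds.2 h3, isOpen_Ioo.eventually_mem hte] with s hs hsI
      have h4 := h2 s hsI
      rw [← hs.self_of_nhds] at h4
      exact h4.congr hs
  exact (D.isCharacteristic_iff hr hu hJ).2 ⟨hc'.1, fun t ht => Eventually.self_of_nhds
    (p := fun s => HasVelocityAt c' (D.charField u s (c' s)) s) (key ht)⟩

/-- A `C¹` integral curve of the characteristic field on a closed interval extends to a
characteristic on an open interval. -/
theorem exists_isCharacteristic_extension (D : MechanicalData d Q r) (hr : 2 ≤ r)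
    (hu : IsC1On d J u) (hJ : IsOpen J) {t₀ t₁ : ℝ} (h01 : t₀ < t₁) (hI : Icc t₀ t₁ ⊆ J)
    (hc : ∀ t ∈ Icc t₀ t₁, HasVelocityWithinAt c (D.charField u t (c t)) (Icc t₀ t₁) t) :
    ∃ A' c', D.IsCharacteristic J u A' c' ∧ Icc t₀ t₁ ⊆ A' ∧ EqOn c' c (Icc t₀ t₁) := by
  classical
  obtain ⟨ε₀, hε₀, e₀, he₀, hchar₀⟩ :=
    D.exists_isCharacteristic hr hu hJ (hI (left_mem_Icc.2 h01.le)) (c t₀)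
  obtain ⟨ε₁, hε₁, e₁, he₁, hchar₁⟩ :=
    D.exists_isCharacteristic hr hu hJ (hI (right_mem_Icc.2 h01.le)) (c t₁)
  have hv₀ := ((D.isCharacteristic_iff hr hu hJ).1 hchar₀).2
  have hv₁ := ((D.isCharacteristic_iff hr hu hJ).1 hchar₁).2
  -- Local characteristics are attached at both ends. At each junction the one-sided velocities
  -- agree, both being the value of the characteristic field at the common point.
  let e : ℝ → Q := fun t => if t < t₀ then e₀ t else if t ≤ t₁ then c t else e₁ t
  have heI : EqOn e c (Icc t₀ t₁) := fun t ht => by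
    simp only [e, not_lt.2 ht.1, if_false, ht.2, if_true]
  have heL : EqOn e e₀ (Iic t₀) := by
    intro t ht
    rcases lt_or_eq_of_le (mem_Iic.1 ht) with h1 | rfl
    · simp only [e, h1, if_true]
    · rw [heI (left_mem_Icc.2 h01.le), he₀]
  have heR : EqOn e e₁ (Ici t₁) := by
    intro t ht
    rcases lt_or_eq_of_le (mem_Ici.1 ht) with h1 | rfl
    · simp only [e, not_lt.2 (h01.trans h1).le, if_false, not_le.2 h1]
    · rw [heI (right_mem_Icc.2 h01.le), he₁]
  have hL : ∀ t ∈ Ioc (t₀ - ε₀) t₀, HasVelocityWithinAt e (D.charField u t (e t)) (Iic t₀) t := by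
    intro t ht
    rw [heL ht.2]
    exact ((hv₀ t ⟨ht.1, by linarith [ht.2]⟩).hasVelocityWithinAt _).congr heL (heL ht.2)
  have hR : ∀ t ∈ Ico t₁ (t₁ + ε₁), HasVelocityWithinAt e (D.charField u t (e t)) (Ici t₁) t := by
    intro t ht
    rw [heR ht.1]
    exact ((hv₁ t ⟨by linarith [ht.1], ht.2⟩).hasVelocityWithinAt _).congr heR (heR ht.1)
  have hM : ∀ t ∈ Icc t₀ t₁, HasVelocityWithinAt e (D.charField u t (e t)) (Icc t₀ t₁) t := by
    intro t ht
    rw [heI ht]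
    exact (hc t ht).congr heI (heI ht)
  refine ⟨Ioo (t₀ - ε₀) (t₁ + ε₁), e, (D.isCharacteristic_iff hr hu hJ).2
    ⟨⟨isOpen_Ioo, ordConnected_Ioo, ⟨t₀, by constructor <;> linarith⟩, ?_⟩, ?_⟩,
    fun t ht => ⟨by linarith [ht.1], by linarith [ht.2]⟩, heI⟩
  · intro t ht
    rcases le_or_gt t t₀ with h1 | h1
    · exact hchar₀.1.2.2.2 ⟨ht.1, by linarith⟩
    rcases le_or_gt t t₁ with h2 | h2
    · exact hI ⟨h1.le, h2⟩
    · exact hchar₁.1.2.2.2 ⟨by linarith, ht.2⟩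
  · intro t ht
    rcases lt_trichotomy t t₀ with h1 | rfl | h1
    · exact (hL t ⟨ht.1, h1.le⟩).hasVelocityAt (Iic_mem_nhds h1)
    · refine ((hL t ⟨ht.1, le_rfl⟩).union (hM t (left_mem_Icc.2 h01.le))).hasVelocityAt ?_
      rw [Iic_union_Icc_eq_Iic h01.le]
      exact Iic_mem_nhds h01
    rcases lt_trichotomy t t₁ with h2 | rfl | h2
    · exact (hM t ⟨h1.le, h2.le⟩).hasVelocityAt (Icc_mem_nhds h1 h2)
    · refine ((hM t (right_mem_Icc.2 h01.le)).union (hR t ⟨le_rfl, ht.2⟩)).hasVelocityAt ?_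
      rw [Icc_union_Ici_eq_Ici h01.le]
      exact Ici_mem_nhds h01
    · exact (hR t ⟨h2.le, ht.2⟩).hasVelocityAt (Ici_mem_nhds h2)

theorem IsCharacteristic.isC1CurveOn (hc : D.IsCharacteristic J u A c) {t₀ t₁ : ℝ}
    (ht₀ : t₀ ∈ A) (ht₁ : t₁ ∈ A) : IsC1CurveOn d t₀ t₁ c :=
  ContMDiffOn.mono hc.2.1 (hc.1.2.1.out ht₀ ht₁)

theorem IsHJSolution.eq_action_of_isCharacteristic (h : D.IsHJSolution J u) (hr : 2 ≤ r)
    (hu : IsC1On d J u) (hJ : IsOpen J) (hc : D.IsCharacteristic J u A c) {t₀ t₁ : ℝ}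
    (ht₀ : t₀ ∈ A) (ht₁ : t₁ ∈ A) (h01 : t₀ < t₁) :
    u (t₁, c t₁) = u (t₀, c t₀) + D.action t₀ t₁ c := by
  have hsub := hc.1.2.1.out ht₀ ht₁
  refine (h.eq_action_iff hu hJ (hc.isC1CurveOn ht₀ ht₁) h01 (hsub.trans hc.1.2.2.2)).2
    fun t ht => ?_
  exact ((((D.isCharacteristic_iff hr hu hJ).1 hc).2 t (hsub ht)).hasVelocityWithinAt
    _).velocityOn_eq h01 ht

theorem IsHJSolution.isActionMinimizing (h : D.IsHJSolution J u) (hr : 2 ≤ r)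
    (hu : IsC1On d J u) (hJ : IsOpen J) (hc : D.IsCharacteristic J u A c) :
    D.IsActionMinimizing A c := by
  intro t₀ ht₀ t₁ ht₁ h01 c' hc' h0 h1
  have h2 := h.eq_action_of_isCharacteristic hr hu hJ hc ht₀ ht₁ h01
  have h3 := h.sub_le_action hu hJ hc' h01 ((hc.1.2.1.out ht₀ ht₁).trans hc.1.2.2.2)
  rw [h0, h1] at h3
  linarith

/-- Curves realizing equality extend to characteristics. -/
theorem IsHJSolution.exists_isCharacteristic_of_eq (h : D.IsHJSolution J u) (hr : 2 ≤ r)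
    (hu : IsC1On d J u) (hJ : IsOpen J) {t₀ t₁ : ℝ} (h01 : t₀ < t₁) (hI : Icc t₀ t₁ ⊆ J)
    (hc : IsC1CurveOn d t₀ t₁ c) (heq : u (t₁, c t₁) = u (t₀, c t₀) + D.action t₀ t₁ c) :
    ∃ A' c', D.IsCharacteristic J u A' c' ∧ Icc t₀ t₁ ⊆ A' ∧ EqOn c' c (Icc t₀ t₁) := by
  refine D.exists_isCharacteristic_extension hr hu hJ h01 hI fun t ht => ?_
  have h1 := hc.hasVelocityWithinAt ht
  rwa [(h.eq_action_iff hu hJ hc h01 hI).1 heq t ht] at h1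

theorem laxOleinikValues_nonempty (D : MechanicalData d Q r) (u : ℝ × Q → ℝ) (t₀ t₁ : ℝ) (q₁ : Q) :
    (D.laxOleinikValues u t₀ t₁ q₁).Nonempty :=
  ⟨_, fun _ => q₁, contMDiffOn_const, rfl, rfl⟩

theorem IsHJSolution.mem_lowerBounds_laxOleinikValues (h : D.IsHJSolution J u)
    (hu : IsC1On d J u) (hJ : IsOpen J) {t₀ t₁ : ℝ} (h01 : t₀ < t₁) (hI : Icc t₀ t₁ ⊆ J) (q₁ : Q) :
    u (t₁, q₁) ∈ lowerBounds (D.laxOleinikValues u t₀ t₁ q₁) := by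
  rintro _ ⟨c, hc, rfl, rfl⟩
  exact h.sub_le_action hu hJ hc h01 hI

end MechanicalData
end Brinkmann

/-! ### The spacetime in product charts -/

namespace Brinkmann

variable {d : ℕ} {Q : Type*} [TopologicalSpace Q] [ChartedSpace (EuclideanSpace ℝ (Fin d)) Q]

/-! ### Velocities in the spacetime -/

/-- `w` is the velocity at `s` of the curve `γ` in the spacetime within the parameter set `B`. -/
def HasSpVelocityWithinAt (γ : ℝ → Spacetime Q) (w : ModelSpace d) (B : Set ℝ) (s : ℝ) : Prop :=
  HasMFDerivWithinAt 𝓘(ℝ, ℝ) (model d) γ B s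
    (ContinuousLinearMap.toSpanSingleton ℝ w : ℝ →L[ℝ] ModelSpace d)

theorem hasSpVelocityWithinAt_iff {γ : ℝ → Spacetime Q} {w : ModelSpace d} {B : Set ℝ} {s : ℝ} :
    HasSpVelocityWithinAt γ w B s ↔ HasDerivWithinAt (fun s => (γ s).1) w.1 B s ∧
      HasVelocityWithinAt (fun s => (γ s).2.1) w.2.1 B s ∧
      HasDerivWithinAt (fun s => (γ s).2.2) w.2.2 B s := by
  constructor
  · intro h
    have h1 := (hasMFDerivAt_fst (I := 𝓘(ℝ, ℝ)) (I' := (𝓡 d).prod 𝓘(ℝ, ℝ))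
      (γ s)).comp_hasMFDerivWithinAt s h
    have h2 := (hasMFDerivAt_snd (I := 𝓘(ℝ, ℝ)) (I' := (𝓡 d).prod 𝓘(ℝ, ℝ))
      (γ s)).comp_hasMFDerivWithinAt s h
    have h3 := (hasMFDerivAt_fst (I := 𝓡 d) (I' := 𝓘(ℝ, ℝ)) (γ s).2).comp_hasMFDerivWithinAt s h2
    have h4 := (hasMFDerivAt_snd (I := 𝓡 d) (I' := 𝓘(ℝ, ℝ)) (γ s).2).comp_hasMFDerivWithinAt s h2
    exact ⟨hasDerivWithinAt_iff_hasFDerivWithinAt.2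
      (hasMFDerivWithinAt_iff_hasFDerivWithinAt.1 h1), h3,
      hasDerivWithinAt_iff_hasFDerivWithinAt.2 (hasMFDerivWithinAt_iff_hasFDerivWithinAt.1 h4)⟩
  · rintro ⟨h1, h2, h3⟩
    have h1' := hasMFDerivWithinAt_iff_hasFDerivWithinAt.2
      (hasDerivWithinAt_iff_hasFDerivWithinAt.1 h1)
    have h3' := hasMFDerivWithinAt_iff_hasFDerivWithinAt.2
      (hasDerivWithinAt_iff_hasFDerivWithinAt.1 h3)
    exact HasMFDerivWithinAt.prodMk h1' (HasMFDerivWithinAt.prodMk h2 h3')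

theorem HasSpVelocityWithinAt.spVelocity_eq {γ : ℝ → Spacetime Q} {w : ModelSpace d}
    {s : ℝ} (h : HasSpVelocityWithinAt γ w univ s) : spVelocity (d := d) γ s = w := by
  rw [spVelocity, HasMFDerivAt.mfderiv (hasMFDerivWithinAt_univ.1 h)]
  exact one_smul ℝ w

theorem hasSpVelocityWithinAt_spVelocityOn {γ : ℝ → Spacetime Q} {s₀ s₁ s : ℝ}
    (h : MDifferentiableWithinAt 𝓘(ℝ, ℝ) (model d) γ (Icc s₀ s₁) s) :
    HasSpVelocityWithinAt γ (spVelocityOn (d := d) s₀ s₁ γ s) (Icc s₀ s₁) s := by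
  have h1 := h.hasMFDerivWithinAt
  have h2 : ∀ f f' : ℝ →L[ℝ] ModelSpace d,
      HasMFDerivWithinAt 𝓘(ℝ, ℝ) (model d) γ (Icc s₀ s₁) s f → f = f' →
      HasMFDerivWithinAt 𝓘(ℝ, ℝ) (model d) γ (Icc s₀ s₁) s f' := fun f f' h e => e ▸ h
  exact h2 _ _ h1 (toSpanSingleton_one (F := ModelSpace d)
    (mfderivWithin 𝓘(ℝ, ℝ) (model d) γ (Icc s₀ s₁) s)).symm

theorem hasSpVelocityWithinAt_spVelocity {γ : ℝ → Spacetime Q} {s : ℝ}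
    (h : MDifferentiableAt 𝓘(ℝ, ℝ) (model d) γ s) :
    HasSpVelocityWithinAt γ (spVelocity (d := d) γ s) univ s := by
  have h1 := hasMFDerivWithinAt_univ.2 h.hasMFDerivAt
  have h2 : ∀ f f' : ℝ →L[ℝ] ModelSpace d,
      HasMFDerivWithinAt 𝓘(ℝ, ℝ) (model d) γ univ s f → f = f' →
      HasMFDerivWithinAt 𝓘(ℝ, ℝ) (model d) γ univ s f' := fun f f' h e => e ▸ h
  exact h2 _ _ h1 (toSpanSingleton_one (F := ModelSpace d)
    (mfderiv 𝓘(ℝ, ℝ) (model d) γ s)).symm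

theorem mem_extChartAt_source_spacetime (z x : Spacetime Q) :
    x ∈ (extChartAt (model d) z).source ↔ x.2.1 ∈ (extChartAt (𝓡 d) z.2.1).source := by
  simp [chartAt_self_eq]

variable [IsManifold (𝓡 d) 1 Q]

/-- The derivative of the inverse of a preferred chart of the spacetime. -/
theorem mfderiv_extChartAt_symm_spacetime (z : Spacetime Q) {x : ModelSpace d}
    (hx : x.2.1 ∈ (extChartAt (𝓡 d) z.2.1).target) (w : ModelSpace d) :
    (mfderiv 𝓘(ℝ, ModelSpace d) (model d) (extChartAt (model d) z).symm x w : ModelSpace d) =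
      (w.1, chartDeriv z.2.1 x.2.1 w.2.1, w.2.2) := by
  have h1 : HasMFDerivAt 𝓘(ℝ, ModelSpace d) 𝓘(ℝ, ℝ) (fun x : ModelSpace d => x.1) x
      (ContinuousLinearMap.fst ℝ ℝ (EuclideanSpace ℝ (Fin d) × ℝ)) :=
    (ContinuousLinearMap.fst ℝ ℝ (EuclideanSpace ℝ (Fin d) × ℝ)).hasMFDerivAt
  have h2 : HasMFDerivAt 𝓘(ℝ, ModelSpace d) (𝓡 d) (fun x : ModelSpace d => x.2.1) x
      ((ContinuousLinearMap.fst ℝ (EuclideanSpace ℝ (Fin d)) ℝ).comp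
        (ContinuousLinearMap.snd ℝ ℝ (EuclideanSpace ℝ (Fin d) × ℝ))) :=
    ((ContinuousLinearMap.fst ℝ (EuclideanSpace ℝ (Fin d)) ℝ).comp
        (ContinuousLinearMap.snd ℝ ℝ (EuclideanSpace ℝ (Fin d) × ℝ))).hasMFDerivAt
  have h3 : HasMFDerivAt 𝓘(ℝ, ModelSpace d) 𝓘(ℝ, ℝ) (fun x : ModelSpace d => x.2.2) x
      ((ContinuousLinearMap.snd ℝ (EuclideanSpace ℝ (Fin d)) ℝ).comp
        (ContinuousLinearMap.snd ℝ ℝ (EuclideanSpace ℝ (Fin d) × ℝ))) :=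
    ((ContinuousLinearMap.snd ℝ (EuclideanSpace ℝ (Fin d)) ℝ).comp
        (ContinuousLinearMap.snd ℝ ℝ (EuclideanSpace ℝ (Fin d) × ℝ))).hasMFDerivAt
  have h4 := (hasMFDerivAt_extChartAt_symm z.2.1 hx).comp x h2
  have h5 : HasMFDerivAt 𝓘(ℝ, ModelSpace d) (model d) (extChartAt (model d) z).symm x _ :=
    h1.prodMk (h4.prodMk h3)
  have h6 := h5.mfderiv
  exact congrArg (fun f : ModelSpace d →L[ℝ] ModelSpace d => f w) h6

namespace MechanicalData

variable {r : ℕ∞ω} [IsManifold (𝓡 d) (r + 1) Q]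

/-- The preferred charts of the spacetime are the identity in t and y, so only the chart of Q
transforms the tensors. -/
theorem chartMetric_eq (D : MechanicalData d Q r) (hr : 2 ≤ r) (z : Spacetime Q) {x : ModelSpace d}
    (hx : x.2.1 ∈ (extChartAt (𝓡 d) z.2.1).target) (w w' : ModelSpace d) :
    D.chartMetric z x w w' = (D.localSystem hr z.2.1).metric x w w' := by
  have h1 := mfderiv_extChartAt_symm_spacetime z hx w
  have h2 := mfderiv_extChartAt_symm_spacetime z hx w'
  have h3 : D.chartMetric z x w w' = D.g (x.1, (extChartAt (𝓡 d) z.2.1).symm x.2.1, x.2.2)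
      ((w.1, chartDeriv z.2.1 x.2.1 w.2.1, w.2.2) : ModelSpace d)
      ((w'.1, chartDeriv z.2.1 x.2.1 w'.2.1, w'.2.2) : ModelSpace d) := by
    rw [← h1, ← h2]
    rfl
  rw [h3]
  rfl

theorem isGeodesic_iff (D : MechanicalData d Q r) (hr : 2 ≤ r) {J A : Set ℝ}
    {γ : ℝ → Spacetime Q} : D.IsGeodesic J A γ ↔
      IsOpenSubinterval univ A ∧ MapsTo γ A (slab J) ∧
      ContMDiffOn 𝓘(ℝ, ℝ) (model d) 2 γ A ∧
      ∀ z : Q, ∀ s ∈ A, (γ s).2.1 ∈ (extChartAt (𝓡 d) z).source → ∀ w : ModelSpace d,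
        (D.localSystem hr z).geodesicOp
          (fun s' => ((γ s').1, extChartAt (𝓡 d) z (γ s').2.1, (γ s').2.2)) s w = 0 := by
  have key : ∀ z : Spacetime Q, ∀ s, (γ s).2.1 ∈ (extChartAt (𝓡 d) z.2.1).source →
      ∀ w : ModelSpace d, (D.localSystem hr z.2.1).geodesicOp
          (fun s' => ((γ s').1, extChartAt (𝓡 d) z.2.1 (γ s').2.1, (γ s').2.2)) s w =
        D.chartMetric z (extChartAt (model d) z (γ s))
          (deriv (deriv fun s' => extChartAt (model d) z (γ s')) s) w
        + fderiv ℝ (fun x' => D.chartMetric z x'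
            (deriv (fun s' => extChartAt (model d) z (γ s')) s) w) (extChartAt (model d) z (γ s))
            (deriv (fun s' => extChartAt (model d) z (γ s')) s)
        - fderiv ℝ (fun x' => D.chartMetric z x'
            (deriv (fun s' => extChartAt (model d) z (γ s')) s)
            (deriv (fun s' => extChartAt (model d) z (γ s')) s))
            (extChartAt (model d) z (γ s)) w / 2 := by
    intro z s hs w
    have hx : (extChartAt (model d) z (γ s)).2.1 ∈ (extChartAt (𝓡 d) z.2.1).target :=
      (extChartAt (𝓡 d) z.2.1).map_source hs
    have hev : ∀ w w' : ModelSpace d, (fun x' => D.chartMetric z x' w w')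
        =ᶠ[𝓝 (extChartAt (model d) z (γ s))]
        fun x' => (D.localSystem hr z.2.1).metric x' w w' := by
      intro w w'
      have ho : IsOpen {x : ModelSpace d | x.2.1 ∈ (extChartAt (𝓡 d) z.2.1).target} :=
        (isOpen_extChartAt_target z.2.1).preimage (continuous_fst.comp continuous_snd)
      filter_upwards [ho.mem_nhds hx] with x' hx' using D.chartMetric_eq hr z hx' w w'
    rw [(hev _ _).fderiv_eq, (hev _ _).fderiv_eq, D.chartMetric_eq hr z hx]
    rfl
  refine and_congr_right fun _ => and_congr_right fun _ => and_congr_right fun _ => ?_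
  constructor
  · intro h z s hs hz w
    -- The chart around a point of the spacetime depends only on its component in Q; the zeros are
    -- arbitrary.
    rw [key (0, z, 0) s hz w]
    exact h (0, z, 0) s hs ((mem_extChartAt_source_spacetime _ _).2 hz) w
  · intro h z s hs hz
    rw [mem_extChartAt_source_spacetime] at hz
    intro x w
    have := h z.2.1 s hs hz w
    rw [key z s hz w] at this
    exact this

end MechanicalData
end Brinkmann

/-! ### Characteristics lift to lightlike geodesics -/

namespace Brinkmann

variable {d : ℕ} {Q : Type*} [TopologicalSpace Q] [ChartedSpace (EuclideanSpace ℝ (Fin d)) Q]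
  [IsManifold (𝓡 d) 1 Q] {r : ℕ∞ω} [IsManifold (𝓡 d) (r + 1) Q]

namespace MechanicalData

variable {D : MechanicalData d Q r} {J : Set ℝ} {u : ℝ × Q → ℝ} {A : Set ℝ} {c : ℝ → Q}

theorem contDiffOn_deriv_of_contDiffOn {F : Type*} [NormedAddCommGroup F] [NormedSpace ℝ F]
    {f : ℝ → F} {O : Set ℝ} (hO : IsOpen O) (hf : ContDiffOn ℝ 2 f O) :
    ContDiffOn ℝ 1 (deriv f) O := by
  rw [show (2 : ℕ∞ω) = 1 + 1 by norm_num, contDiffOn_succ_iff_deriv_of_isOpen hO] at hf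
  exact hf.2.2

theorem contDiffOn_chart_curve (hr : 2 ≤ r) (z : Q) (hA : IsOpen A)
    (hc : ContMDiffOn 𝓘(ℝ, ℝ) (𝓡 d) 2 c A) :
    ContDiffOn ℝ 2 (fun s => extChartAt (𝓡 d) z (c s))
      (A ∩ c ⁻¹' (extChartAt (𝓡 d) z).source) := by
  have h2 : IsManifold (𝓡 d) 2 Q := IsManifold.of_le (n := r + 1) (hr.trans le_self_add)
  intro t ht
  have h1 := hc.contMDiffAt (hA.mem_nhds ht.1)
  exact ((contMDiffAt_curve_iff 2 z h1.continuousAt ht.2).1 h1).contDiffWithinAt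

/-- The derivative of `u` along a characteristic is the Lagrangian. -/
theorem IsHJSolution.hasDerivAt_comp_characteristic (h : D.IsHJSolution J u)
    (hu : IsC1On d J u) (hJ : IsOpen J) {t : ℝ} (ht : t ∈ J)
    (hc : HasVelocityAt c (D.charField u t (c t)) t) :
    HasDerivAt (fun s => u (s, c s)) (D.lagrangian t (c t) (D.charField u t (c t))) t := by
  have h1 := hu.hasDerivWithinAt_comp hJ ht (hc.hasVelocityWithinAt univ)
  rw [hasDerivWithinAt_univ] at h1
  exact h1.congr_deriv ((h.timeDeriv_add_eq_iff ht (c t) _).2 rfl)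

theorem lagrangian_chart_eq (D : MechanicalData d Q r) (hr : 2 ≤ r) (z : Q) {t : ℝ}
    {v : EuclideanSpace ℝ (Fin d)} (hc : HasVelocityAt c v t)
    (hz : c t ∈ (extChartAt (𝓡 d) z).source) :
    (D.localSystem hr z).lagrangian t (extChartAt (𝓡 d) z (c t))
      (deriv (fun s => extChartAt (𝓡 d) z (c s)) t) = D.lagrangian t (c t) v := by
  have h1 := velocity_eq_chartDeriv z hc.mdifferentiableAt hz
  rw [hc.velocity_eq] at h1
  rw [h1]
  have h2 : ∀ x ξ, (D.localSystem hr z).lagrangian t x ξ =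
      D.lagrangian t ((extChartAt (𝓡 d) z).symm x) (chartDeriv z x ξ) := fun x ξ => rfl
  rw [h2, (extChartAt (𝓡 d) z).left_inv hz]

/-- Lifts of characteristics to the graph are geodesics. -/
theorem IsHJSolution.isGeodesic (h : D.IsHJSolution J u) (hr : 2 ≤ r)
    (hu : IsC1On d J u) (hJ : IsOpen J) (hc : D.IsCharacteristic J u A c) :
    D.IsGeodesic J A (fun t => (t, c t, u (t, c t))) := by
  have hEL := h.isELSolution_of_isCharacteristic hr hu hJ hc
  have hv := ((D.isCharacteristic_iff hr hu hJ).1 hc).2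
  have hO := fun z => isOpen_chart_times (d := d) z hc.1.1 hc.continuousOn
  have hY : ∀ z, ∀ s ∈ A ∩ c ⁻¹' (extChartAt (𝓡 d) z).source,
      HasDerivAt (fun s => u (s, c s)) ((D.localSystem hr z).lagrangian s
        (extChartAt (𝓡 d) z (c s)) (deriv (fun s => extChartAt (𝓡 d) z (c s)) s)) s := by
    intro z s hs
    rw [D.lagrangian_chart_eq hr z (hv s hs.1) hs.2]
    exact h.hasDerivAt_comp_characteristic hu hJ (hc.1.2.2.2 hs.1) (hv s hs.1)
  have hξ := fun z => contDiffOn_chart_curve hr z hc.1.1 hEL.2.1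
  have hξ' := fun z => contDiffOn_deriv_of_contDiffOn (hO z) (hξ z)
  rw [D.isGeodesic_iff hr]
  refine ⟨⟨hc.1.1, hc.1.2.1, hc.1.2.2.1, subset_univ _⟩, fun t ht => hc.1.2.2.2 ht, ?_, ?_⟩
  · have h1 : ContMDiffOn 𝓘(ℝ, ℝ) 𝓘(ℝ, ℝ) 2 (fun t : ℝ => t) A := contMDiffOn_id
    refine h1.prodMk (ContMDiffOn.prodMk hEL.2.1 ?_)
    -- Although u is only C¹, it is C² along a characteristic: its derivative there is the
    -- Lagrangian, a C¹ function of the time, position and velocity of a C² curve.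
    rw [contMDiffOn_iff_contDiffOn]
    intro t ht
    have hz := mem_extChartAt_source (I := 𝓡 d) (c t)
    refine ContDiffAt.contDiffWithinAt (ContDiffOn.contDiffAt ?_ ((hO (c t)).mem_nhds ⟨ht, hz⟩))
    rw [show (2 : ℕ∞ω) = 1 + 1 by norm_num, contDiffOn_succ_iff_deriv_of_isOpen (hO (c t))]
    refine ⟨fun s hs => (hY (c t) s hs).differentiableAt.differentiableWithinAt, by simp, ?_⟩
    have h2 : ContDiffOn ℝ 1 (fun s => (s, extChartAt (𝓡 d) (c t) (c s),
        deriv (fun s => extChartAt (𝓡 d) (c t) (c s)) s))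
        (A ∩ c ⁻¹' (extChartAt (𝓡 d) (c t)).source) :=
      contDiffOn_id.prodMk (((hξ (c t)).of_le one_le_two).prodMk (hξ' (c t)))
    refine (((D.localSystem hr (c t)).contDiffOn_lagrangian.of_le one_le_two).comp h2
      fun s hs => ⟨mem_univ _, (extChartAt (𝓡 d) (c t)).map_source hs.2, mem_univ _⟩).congr
      fun s hs => (hY (c t) s hs).deriv
  · intro z s hs hz w
    have hmem := (hO z).mem_nhds ⟨hs, hz⟩
    refine LocalSystem.geodesicOp_eq_zero (S := D.localSystem hr z)
      (ξ := fun s => extChartAt (𝓡 d) z (c s)) (Y := fun s => u (s, c s))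
      ((extChartAt (𝓡 d) z).map_source hz) ?_ ?_ ?_ (((D.isELSolution_iff hr).1 hEL).2.2 z s hs hz) w
    · filter_upwards [hmem] with s' hs'
      exact ((hξ z).contDiffAt ((hO z).mem_nhds hs')).differentiableAt two_ne_zero
    · exact ((hξ' z).contDiffAt hmem).differentiableAt one_ne_zero
    · filter_upwards [hmem] with s' hs' using hY z s' hs'

/-- The y-velocity L is precisely the value that cancels a(v,v) − 2(L − b(v)) − 2V. The product with
the orienting field is then −(a(v,v) + 1)/2. -/
theorem IsHJSolution.isFutureLightlike_lift (h : D.IsHJSolution J u)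
    (hu : IsC1On d J u) (hJ : IsOpen J) {t : ℝ} (ht : t ∈ J)
    (hc : HasVelocityAt c (D.charField u t (c t)) t) :
    D.IsFutureLightlike (spVelocity (d := d) (fun t => (t, c t, u (t, c t))) t) := by
  have h1 : HasSpVelocityWithinAt (fun t => (t, c t, u (t, c t)))
      ((1, D.charField u t (c t), D.lagrangian t (c t) (D.charField u t (c t))) : ModelSpace d)
      univ t := by
    rw [hasSpVelocityWithinAt_iff]
    exact ⟨hasDerivWithinAt_id t _, hc.hasVelocityWithinAt univ,
      (h.hasDerivAt_comp_characteristic hu hJ ht hc).hasDerivWithinAt⟩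
  rw [h1.spVelocity_eq]
  set v := D.charField u t (c t) with hv
  have hpos := D.a_nonneg t (c t) v
  have h0 : D.a t (c t) 0 v = 0 := by
    rw [map_zero]; rfl
  have hL : D.lagrangian t (c t) v = D.a t (c t) v v / 2 + D.b t (c t) v - D.V t (c t) := rfl
  have h0' : D.b t (c t) (0 : EuclideanSpace ℝ (Fin d)) = 0 := map_zero (D.b t (c t))
  refine ⟨fun h => one_ne_zero (congrArg (fun w : ModelSpace d => w.1) h), ?_, ?_⟩
  · change D.a t (c t) v v - 1 * (D.lagrangian t (c t) v - D.b t (c t) v)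
      - (D.lagrangian t (c t) v - D.b t (c t) v) * 1 - 2 * D.V t (c t) * 1 * 1 = 0
    linarith
  · change D.a t (c t) 0 v - 1 * (D.lagrangian t (c t) v - D.b t (c t) v)
      - (-(D.V t (c t) - 1 / 2) - D.b t (c t) (0 : EuclideanSpace ℝ (Fin d))) * 1
      - 2 * D.V t (c t) * 1 * 1 < 0
    rw [h0, h0']
    linarith

/-- A geodesic extending a curve parametrized by `t` is parametrized by `t`. -/
theorem IsGeodesic.fst_eq (hr : 2 ≤ r) {γ : ℝ → Spacetime Q} (hγ : D.IsGeodesic J A γ)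
    {B : Set ℝ} (hB : IsOpen B) (hB' : B.Nonempty) (hBA : B ⊆ A) (hB1 : ∀ t ∈ B, (γ t).1 = t) :
    ∀ t ∈ A, (γ t).1 = t := by
  rw [D.isGeodesic_iff hr] at hγ
  obtain ⟨hA, -, hsm, hgeo⟩ := hγ
  have hT : ContDiffOn ℝ 2 (fun s => (γ s).1) A := by
    rw [← contMDiffOn_iff_contDiffOn]
    exact contMDiff_fst.comp_contMDiffOn hsm
  have hq : ContMDiffOn 𝓘(ℝ, ℝ) (𝓡 d) 2 (fun s => (γ s).2.1) A :=
    (contMDiff_fst.comp contMDiff_snd).comp_contMDiffOn hsm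
  have hy : ContDiffOn ℝ 2 (fun s => (γ s).2.2) A := by
    rw [← contMDiffOn_iff_contDiffOn]
    exact (contMDiff_snd.comp contMDiff_snd).comp_contMDiffOn hsm
  have hT' := contDiffOn_deriv_of_contDiffOn hA.1 hT
  have hfst : ∀ {f : ℝ → ModelSpace d} {s : ℝ}, DifferentiableAt ℝ f s →
      deriv (fun s => (f s).1) s = (deriv f s).1 := fun hf =>
    HasDerivAt.deriv hf.hasDerivAt.fst
  have hT2 : ∀ s ∈ A, deriv (deriv fun s => (γ s).1) s = 0 := by
    intro s hs
    have hz := mem_extChartAt_source (I := 𝓡 d) (γ s).2.1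
    have hO := isOpen_chart_times (d := d) (γ s).2.1 hA.1 hq.continuousOn
    set O := A ∩ (fun s => (γ s).2.1) ⁻¹' (extChartAt (𝓡 d) (γ s).2.1).source
    have hx : ContDiffOn ℝ 2 (fun s' => ((γ s').1, extChartAt (𝓡 d) (γ s).2.1 (γ s').2.1,
        (γ s').2.2)) O :=
      (hT.mono inter_subset_left).prodMk ((contDiffOn_chart_curve hr (γ s).2.1 hA.1 hq).prodMk
        (hy.mono inter_subset_left))
    have hx' := contDiffOn_deriv_of_contDiffOn hO hx
    have hmem := hO.mem_nhds ⟨hs, hz⟩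
    have h1 := hgeo (γ s).2.1 s hs hz (0, 0, 1)
    rw [LocalSystem.geodesicOp_dy _ ((extChartAt (𝓡 d) (γ s).2.1).map_source hz),
      neg_eq_zero] at h1
    rw [← h1]
    have h2 : deriv (fun s => (γ s).1) =ᶠ[𝓝 s] fun s' => (deriv (fun s' => ((γ s').1,
        extChartAt (𝓡 d) (γ s).2.1 (γ s').2.1, (γ s').2.2)) s').1 := by
      filter_upwards [hmem] with s' hs'
      exact hfst ((hx.contDiffAt (hO.mem_nhds hs')).differentiableAt two_ne_zero)
    rw [h2.deriv_eq]
    exact hfst ((hx'.contDiffAt hmem).differentiableAt one_ne_zero)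
  -- The function t has zero second derivative on the interval A and is the identity on an open
  -- part, which fixes both its slope and its value.
  obtain ⟨t₀, ht₀⟩ := hB'
  have hBev : (fun s => (γ s).1) =ᶠ[𝓝 t₀] id := by
    filter_upwards [hB.mem_nhds ht₀] with s hs using hB1 s hs
  have hd1 : EqOn (deriv fun s => (γ s).1) (fun _ => 1) A := by
    refine hA.1.eqOn_of_deriv_eq hA.2.1.isPreconnected (hT'.differentiableOn one_ne_zero)
      (differentiableOn_const _) (fun s hs => ?_) (hBA ht₀) ?_
    · rw [hT2 s hs, deriv_const]
    · rw [hBev.deriv_eq, deriv_id]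
  exact hA.1.eqOn_of_deriv_eq hA.2.1.isPreconnected (hT.differentiableOn two_ne_zero)
    differentiableOn_id (fun s hs => by rw [hd1 hs]; exact (deriv_id s).symm) (hBA ht₀) (hB1 t₀ ht₀)

theorem IsGeodesic.isELSolution (hr : 2 ≤ r) {γ : ℝ → Spacetime Q} (hγ : D.IsGeodesic J A γ)
    (ht : ∀ t ∈ A, (γ t).1 = t) : D.IsELSolution J A (fun s => (γ s).2.1) := by
  rw [D.isGeodesic_iff hr] at hγ
  obtain ⟨hA, hm, hsm, hgeo⟩ := hγ
  have hT : ContDiffOn ℝ 2 (fun s => (γ s).1) A := by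
    rw [← contMDiffOn_iff_contDiffOn]
    exact contMDiff_fst.comp_contMDiffOn hsm
  have hq : ContMDiffOn 𝓘(ℝ, ℝ) (𝓡 d) 2 (fun s => (γ s).2.1) A :=
    (contMDiff_fst.comp contMDiff_snd).comp_contMDiffOn hsm
  have hy : ContDiffOn ℝ 2 (fun s => (γ s).2.2) A := by
    rw [← contMDiffOn_iff_contDiffOn]
    exact (contMDiff_snd.comp contMDiff_snd).comp_contMDiffOn hsm
  rw [D.isELSolution_iff hr]
  refine ⟨⟨hA.1, hA.2.1, hA.2.2.1, fun t htA => ?_⟩, hq, fun z s hs hz => ?_⟩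
  · have h1 : (γ t).1 ∈ J := hm htA
    rwa [ht t htA] at h1
  · have hO := isOpen_chart_times (d := d) z hA.1 hq.continuousOn
    have hx : ContDiffOn ℝ 2 (fun s' => ((γ s').1, extChartAt (𝓡 d) z (γ s').2.1,
        (γ s').2.2)) (A ∩ (fun s => (γ s).2.1) ⁻¹' (extChartAt (𝓡 d) z).source) :=
      (hT.mono inter_subset_left).prodMk ((contDiffOn_chart_curve hr z hA.1 hq).prodMk
        (hy.mono inter_subset_left))
    have hx' := contDiffOn_deriv_of_contDiffOn hO hx
    have hmem := hO.mem_nhds ⟨hs, hz⟩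
    refine LocalSystem.eulerLagrangeAt_of_geodesicOp (S := D.localSystem hr z)
      (x := fun s' => ((γ s').1, extChartAt (𝓡 d) z (γ s').2.1, (γ s').2.2))
      ((extChartAt (𝓡 d) z).map_source hz) ?_
      ((hx'.contDiffAt hmem).differentiableAt one_ne_zero) ?_ fun η => hgeo z s hs hz _
    · filter_upwards [hmem] with s' hs'
      exact (hx.contDiffAt (hO.mem_nhds hs')).differentiableAt two_ne_zero
    · filter_upwards [hmem] with s' hs' using ht s' hs'.1

/-- A geodesic extension is still parametrized by t, so its projection extends c as an
Euler-Lagrange solution, and maximality of c gives equality of the intervals. The y component need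
not be compared. -/
theorem IsHJSolution.isInextendibleLightlikeGeodesic (h : D.IsHJSolution J u) (hr : 2 ≤ r)
    (hu : IsC1On d J u) (hJ : IsOpen J) (hc : D.IsCharacteristic J u A c)
    (hmax : D.IsMaximalELSolution J A c) :
    D.IsInextendibleLightlikeGeodesic J A (fun t => (t, c t, u (t, c t))) := by
  refine ⟨h.isGeodesic hr hu hJ hc, fun t ht => h.isFutureLightlike_lift hu hJ (hc.1.2.2.2 ht)
    (((D.isCharacteristic_iff hr hu hJ).1 hc).2 t ht), fun A' γ' hγ' hA heq => ?_⟩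
  have h1 := hγ'.fst_eq hr hc.1.1 hc.1.2.2.1 hA fun t ht => by rw [← heq ht]
  exact hmax.2 A' _ (hγ'.isELSolution hr h1) hA fun t ht => by rw [← heq ht]

end MechanicalData
end Brinkmann

/-! ### Tangent spaces, normals and achronality of graphs -/

namespace Brinkmann

variable {d : ℕ} {Q : Type*} [TopologicalSpace Q] [ChartedSpace (EuclideanSpace ℝ (Fin d)) Q]

section

variable {J : Set ℝ} {u : ℝ × Q → ℝ}

theorem IsC1On.hasDerivWithinAt_comp_curve (hu : IsC1On d J u) (hJ : IsOpen J) {T : ℝ → ℝ}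
    {c : ℝ → Q} {s τ : ℝ} {B : Set ℝ} {v : EuclideanSpace ℝ (Fin d)} (ht : T s ∈ J)
    (hT : HasDerivWithinAt T τ B s) (hc : HasVelocityWithinAt c v B s) :
    HasDerivWithinAt (fun s => u (T s, c s))
      (timeDeriv u (T s) (c s) * τ + spaceCovector d u (T s) (c s) v) B s := by
  have h1 := hasMFDerivWithinAt_iff_hasFDerivWithinAt.2
    (hasDerivWithinAt_iff_hasFDerivWithinAt.1 hT)
  have h2 := (hu.hasMFDerivAt hJ ht (c s)).comp_hasMFDerivWithinAt s
    (HasMFDerivWithinAt.prodMk h1 hc)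
  have h3 := hasMFDerivWithinAt_iff_hasFDerivWithinAt.1 h2
  rw [hasDerivWithinAt_iff_hasFDerivWithinAt]
  refine h3.congr_fderiv (ContinuousLinearMap.ext_ring ?_)
  have h5 : ContinuousLinearMap.toSpanSingleton ℝ v (1 : ℝ) = v := by simp
  have h6 : ContinuousLinearMap.toSpanSingleton ℝ τ (1 : ℝ) = τ := by simp
  refine Eq.trans (b := jointDeriv d u (T s) (c s)
    (ContinuousLinearMap.toSpanSingleton ℝ τ (1 : ℝ),
      ContinuousLinearMap.toSpanSingleton ℝ v (1 : ℝ))) rfl ?_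
  rw [h5, h6, jointDeriv_apply]
  exact (one_smul ℝ _).symm

/-- The tangent spaces of a graph. -/
theorem IsC1On.mem_tangentVectors_iff [IsManifold (𝓡 d) 1 Q] (hu : IsC1On d J u) (hJ : IsOpen J)
    {t : ℝ} (ht : t ∈ J) (q : Q) (w : ModelSpace d) :
    w ∈ tangentVectors (d := d) (graphOver J u) (t, q, u (t, q)) ↔
      w.2.2 = timeDeriv u t q * w.1 + spaceCovector d u t q w.2.1 := by
  constructor
  · rintro ⟨γ, h0, hγ, hd, hw⟩
    have h1 := hasSpVelocityWithinAt_iff.1 (hasSpVelocityWithinAt_spVelocity hd)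
    have h2 : (spVelocity (d := d) γ 0 : ModelSpace d) = w := hw
    rw [h2] at h1
    obtain ⟨hT, hc, hy⟩ := h1
    have e1 : (γ 0).1 = t := by rw [h0]
    have e2 : (γ 0).2.1 = q := by rw [h0]
    have h3 := hu.hasDerivWithinAt_comp_curve hJ (by rwa [e1]) hT hc
    rw [hasDerivWithinAt_univ] at h3 hy
    rw [e1, e2] at h3
    refine hy.unique (h3.congr_of_eventuallyEq ?_)
    filter_upwards [hγ] with s hs
    obtain ⟨e, -, he⟩ := hs
    rw [← he]
  · intro hw
    set φ := extChartAt (𝓡 d) q with hφ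
    have hq : φ q ∈ φ.target := φ.map_source (mem_extChartAt_source q)
    have hx0 : φ q + (0 : ℝ) • (0 : EuclideanSpace ℝ (Fin d)) = φ q := by simp
    obtain ⟨e, he⟩ := MechanicalData.chartDeriv_isInvertible q hq
    -- A tangent vector is realized by a straight line in (t, x) coordinates lifted to the graph; ξ
    -- is the coordinate expression of its component along Q.
    set ξ := e.symm w.2.1 with hξ
    have hξv : chartDeriv q (φ q) ξ = w.2.1 := by
      rw [← he]
      exact e.apply_symm_apply _
    have e1 : t + 0 * w.1 = t := by ring
    have e2 : φ.symm (φ q + (0 : ℝ) • ξ) = q := by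
      rw [zero_smul, add_zero]
      exact φ.left_inv (mem_extChartAt_source q)
    have hT : HasDerivAt (fun s : ℝ => t + s * w.1) w.1 0 := by
      simpa using ((hasDerivAt_id (0 : ℝ)).mul_const w.1).const_add t
    have hx : HasDerivAt (fun s : ℝ => φ q + s • ξ) ξ 0 := by
      simpa using ((hasDerivAt_id (0 : ℝ)).smul_const ξ).const_add (φ q)
    have hc : HasVelocityAt (fun s : ℝ => φ.symm (φ q + s • ξ)) w.2.1 0 := by
      have h1 := hasVelocityAt_chart_symm q (x := fun s : ℝ => φ q + s • ξ)
        (by change φ q + (0 : ℝ) • ξ ∈ φ.target; rwa [zero_smul, add_zero]) hx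
      simp only [zero_smul, add_zero] at h1
      rwa [hξv] at h1
    have hy := hu.hasDerivWithinAt_comp_curve hJ (T := fun s : ℝ => t + s * w.1)
      (by simpa using ht) hT.hasDerivWithinAt (hc.hasVelocityWithinAt univ)
    simp only [e1, e2, ← hw] at hy
    have hγ : HasSpVelocityWithinAt (fun s : ℝ => ((t + s * w.1, φ.symm (φ q + s • ξ),
        u (t + s * w.1, φ.symm (φ q + s • ξ))) : Spacetime Q)) w univ 0 :=
      hasSpVelocityWithinAt_iff.2 ⟨hT.hasDerivWithinAt, hc.hasVelocityWithinAt univ, hy⟩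
    refine ⟨_, ?_, ?_, HasMFDerivAt.mdifferentiableAt (hasMFDerivWithinAt_univ.1 hγ),
      hγ.spVelocity_eq⟩
    · simp only [e1, e2]
    · have h2 : ∀ᶠ s in 𝓝 (0 : ℝ), t + s * w.1 ∈ J :=
        hT.continuousAt.eventually_mem (by simpa using hJ.mem_nhds ht)
      filter_upwards [h2] with s hs
      exact ⟨(t + s * w.1, φ.symm (φ q + s • ξ)), ⟨hs, mem_univ _⟩, rfl⟩

end

namespace MechanicalData

variable [IsManifold (𝓡 d) 1 Q] {r : ℕ∞ω} {D : MechanicalData d Q r} {J : Set ℝ} {u : ℝ × Q → ℝ}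

theorem g_mk (D : MechanicalData d Q r) (t : ℝ) (q : Q) (y τ η σ μ : ℝ)
    (v ζ : EuclideanSpace ℝ (Fin d)) :
    D.g (t, q, y) ((τ, v, η) : ModelSpace d) ((σ, ζ, μ) : ModelSpace d) =
      D.a t q v ζ - τ * (μ - D.b t q ζ) - (η - D.b t q v) * σ - 2 * D.V t q * τ * σ := rfl

/-- The normals of a graph. -/
theorem orthogonal_graph_iff (D : MechanicalData d Q r) (hu : IsC1On d J u) (hJ : IsOpen J)
    {t : ℝ} (ht : t ∈ J) (q : Q) (w : ModelSpace d) :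
    (∀ z ∈ tangentVectors (d := d) (graphOver J u) (t, q, u (t, q)),
      D.g (t, q, u (t, q)) w z = 0) ↔
    w.2.1 = w.1 • D.charField u t q ∧
      w.2.2 = D.b t q w.2.1 - w.1 * (timeDeriv u t q + 2 * D.V t q) := by
  obtain ⟨τ, v, η⟩ := w
  have hX : ∀ ζ : EuclideanSpace ℝ (Fin d), D.a t q (D.charField u t q) ζ =
      spaceCovector d u t q ζ - D.b t q ζ := by
    intro ζ
    have h1 := D.a_sharp t q (spaceDeriv u t q - D.b t q)
    exact congrArg (fun f : EuclideanSpace ℝ (Fin d) →L[ℝ] ℝ => f ζ) h1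
  have hsub : ∀ ζ : EuclideanSpace ℝ (Fin d), D.a t q (v - τ • D.charField u t q) ζ =
      D.a t q v ζ - τ * D.a t q (D.charField u t q) ζ := by
    intro ζ
    have h1 := map_sub (D.a t q) v (τ • D.charField u t q)
    have h2 := map_smul (D.a t q) τ (D.charField u t q)
    rw [h2] at h1
    exact congrArg (fun f : EuclideanSpace ℝ (Fin d) →L[ℝ] ℝ => f ζ) h1
  -- The tangent space is parametrized by free σ and ζ, and the product separates into a part linear
  -- in ζ and a part linear in σ, each of which must vanish.
  have key : ∀ (σ : ℝ) (ζ : EuclideanSpace ℝ (Fin d)),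
      D.g (t, q, u (t, q)) ((τ, v, η) : ModelSpace d) ((σ, ζ, timeDeriv u t q * σ
        + spaceCovector d u t q ζ) : ModelSpace d) = D.a t q (v - τ • D.charField u t q) ζ
        - σ * (τ * (timeDeriv u t q + 2 * D.V t q) + η - D.b t q v) := by
    intro σ ζ
    rw [g_mk, hsub, hX]
    ring
  constructor
  · intro h
    have h1 : ∀ (σ : ℝ) (ζ : EuclideanSpace ℝ (Fin d)), D.a t q (v - τ • D.charField u t q) ζ
        - σ * (τ * (timeDeriv u t q + 2 * D.V t q) + η - D.b t q v) = 0 := by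
      intro σ ζ
      rw [← key]
      exact h _ ((hu.mem_tangentVectors_iff hJ ht q _).2 rfl)
    -- The choice of ζ makes the product an a-square, so definiteness forces v = τX.
    have h2 := h1 0 (v - τ • D.charField u t q)
    rw [zero_mul, sub_zero] at h2
    have h3 := sub_eq_zero.1 ((D.a_eq_zero_iff t q _).1 h2)
    have h4 := h1 1 0
    have h5 : D.a t q (v - τ • D.charField u t q) (0 : EuclideanSpace ℝ (Fin d)) = 0 :=
      map_zero (D.a t q (v - τ • D.charField u t q))
    rw [h5] at h4
    exact ⟨h3, by change η = D.b t q v - τ * _; linarith⟩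
  · rintro ⟨h1, h2⟩ ⟨σ, ζ, μ⟩ hz
    have hμ : μ = timeDeriv u t q * σ + spaceCovector d u t q ζ :=
      (hu.mem_tangentVectors_iff hJ ht q _).1 hz
    change v = τ • D.charField u t q at h1
    change η = D.b t q v - τ * _ at h2
    rw [hμ, key, hsub, h2, h1]
    have h3 := congrArg (fun f : EuclideanSpace ℝ (Fin d) →L[ℝ] ℝ => f ζ)
      (map_smul (D.a t q) τ (D.charField u t q))
    have h4 : D.a t q (τ • D.charField u t q) ζ = τ * D.a t q (D.charField u t q) ζ := h3
    rw [h4]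
    ring

theorem b_smul (t : ℝ) (q : Q) (τ : ℝ) (v : EuclideanSpace ℝ (Fin d)) :
    D.b t q (τ • v) = τ * D.b t q v := (D.b t q).map_smul τ v

theorem hamiltonian_spaceDeriv (D : MechanicalData d Q r) (u : ℝ × Q → ℝ) (t : ℝ) (q : Q) :
    D.hamiltonian t q (spaceDeriv u t q) = (spaceCovector d u t q (D.charField u t q)
      - D.b t q (D.charField u t q)) / 2 + D.V t q := rfl

/-- The square of a normal of a graph. -/
theorem g_normal (D : MechanicalData d Q r) (u : ℝ × Q → ℝ) (t : ℝ) (q : Q) (y : ℝ)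
    {w : ModelSpace d} (h1 : w.2.1 = w.1 • D.charField u t q)
    (h2 : w.2.2 = D.b t q w.2.1 - w.1 * (timeDeriv u t q + 2 * D.V t q)) :
    D.g (t, q, y) w w = 2 * w.1 ^ 2 * (timeDeriv u t q
      + D.hamiltonian t q (spaceDeriv u t q)) := by
  obtain ⟨τ, v, η⟩ := w
  change v = τ • D.charField u t q at h1
  change η = D.b t q v - τ * _ at h2
  have hX : D.a t q (D.charField u t q) (D.charField u t q) =
      spaceCovector d u t q (D.charField u t q) - D.b t q (D.charField u t q) :=
    congrArg (fun f : EuclideanSpace ℝ (Fin d) →L[ℝ] ℝ => f (D.charField u t q))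
      (D.a_sharp t q (spaceDeriv u t q - D.b t q))
  have h3 : D.a t q (τ • D.charField u t q) (τ • D.charField u t q) =
      τ * (τ * D.a t q (D.charField u t q) (D.charField u t q)) :=
    (congrArg (fun f : EuclideanSpace ℝ (Fin d) →L[ℝ] ℝ => f (τ • D.charField u t q))
      (map_smul (D.a t q) τ (D.charField u t q))).trans
      (congrArg (τ * ·) (map_smul (D.a t q (D.charField u t q)) τ (D.charField u t q)))
  rw [g_mk, hamiltonian_spaceDeriv, h2, h1, h3, hX]
  ring

/-- A tangent space is degenerate exactly when it contains a nonzero normal, which is then null. The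
normals form a line, and `g_normal` gives their square in terms of the Hamilton-Jacobi expression.
-/
theorem isLightlikeHypersurface_graph_iff (D : MechanicalData d Q r) (hu : IsC1On d J u)
    (hJ : IsOpen J) : D.IsLightlikeHypersurface (graphOver J u) ↔ D.IsHJSolution J u := by
  constructor
  · intro h t ht q
    obtain ⟨w, hw, hw0, horth⟩ := h (t, q, u (t, q)) ⟨(t, q), ⟨ht, mem_univ _⟩, rfl⟩
    have h1 := (D.orthogonal_graph_iff hu hJ ht q w).1 horth
    have h2 := D.g_normal u t q (u (t, q)) h1.1 h1.2
    have h3 := horth w hw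
    rw [h3] at h2
    obtain ⟨τ, v, η⟩ := w
    obtain ⟨h4, h5⟩ := h1
    change v = τ • D.charField u t q at h4
    change η = D.b t q v - τ * _ at h5
    -- A normal is determined by its t component, so τ = 0 would make it vanish.
    have hτ : τ ≠ 0 := by
      rintro rfl
      apply hw0
      rw [zero_smul] at h4
      have h6 : D.b t q (0 : EuclideanSpace ℝ (Fin d)) = 0 := map_zero (D.b t q)
      rw [h4, h6, zero_mul, sub_zero] at h5
      rw [h4, h5]
      rfl
    have h7 : 2 * τ ^ 2 * (timeDeriv u t q + D.hamiltonian t q (spaceDeriv u t q)) = 0 := h2.symm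
    exact (mul_eq_zero.1 h7).resolve_left (by positivity)
  · rintro h _ ⟨⟨t, q⟩, ⟨ht, -⟩, rfl⟩
    set X := D.charField u t q with hX
    set w : ModelSpace d := (1, X, D.b t q X - (timeDeriv u t q + 2 * D.V t q)) with hw
    have h1 := (D.orthogonal_graph_iff hu hJ ht q w).2 ⟨(one_smul ℝ X).symm, by
      change _ = _ - 1 * _
      rw [one_mul]⟩
    refine ⟨w, (hu.mem_tangentVectors_iff hJ ht q w).2 ?_,
      fun h => one_ne_zero (congrArg (fun w : ModelSpace d => w.1) h), h1⟩
    -- Tangency of the normal with τ = 1 is, after clearing the factor 2, the Hamilton-Jacobi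
    -- equation itself.
    have h2 := h t ht q
    rw [hamiltonian_spaceDeriv] at h2
    change D.b t q X - (timeDeriv u t q + 2 * D.V t q) = timeDeriv u t q * 1
      + spaceCovector d u t q X
    linarith

theorem hasCausalNormals_graph_iff (D : MechanicalData d Q r) (hu : IsC1On d J u)
    (hJ : IsOpen J) : D.HasCausalNormals (graphOver J u) ↔ D.IsHJSubsolution J u := by
  constructor
  · intro h t ht q
    set X := D.charField u t q with hX
    set w : ModelSpace d := (1, X, D.b t q X - (timeDeriv u t q + 2 * D.V t q)) with hw
    have h0 : w.2.1 = w.1 • D.charField u t q ∧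
        w.2.2 = D.b t q w.2.1 - w.1 * (timeDeriv u t q + 2 * D.V t q) :=
      ⟨(one_smul ℝ X).symm, by
        change _ = _ - 1 * _
        rw [one_mul]⟩
    have h1 := h (t, q, u (t, q)) ⟨(t, q), ⟨ht, mem_univ _⟩, rfl⟩ w
      (fun h => one_ne_zero (congrArg (fun w : ModelSpace d => w.1) h))
      ((D.orthogonal_graph_iff hu hJ ht q w).2 h0)
    have h2 := D.g_normal u t q (u (t, q)) h0.1 h0.2
    have h3 : 2 * (1 : ℝ) ^ 2 * (timeDeriv u t q + D.hamiltonian t q (spaceDeriv u t q)) ≤ 0 :=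
      h2.symm.trans_le h1
    linarith
  · rintro h _ ⟨⟨t, q⟩, ⟨ht, -⟩, rfl⟩ w - horth
    have h1 := (D.orthogonal_graph_iff hu hJ ht q w).1 horth
    refine (D.g_normal u t q (u (t, q)) h1.1 h1.2).trans_le ?_
    exact mul_nonpos_of_nonneg_of_nonpos (by positivity) (h t ht q)

/-! ### Achronality -/

/-- With m = η − b(v), timelikeness makes the product of τ and m + Vτ positive, and the time
orientation says m + Vτ + τ/2 > 0; hence both factors are positive. -/
theorem isFutureTimelike_mk {t : ℝ} {q : Q} {y τ η : ℝ} {v : EuclideanSpace ℝ (Fin d)}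
    (h : D.IsFutureTimelike (x := (t, q, y)) ((τ, v, η) : ModelSpace d)) :
    0 < τ ∧ D.a t q v v < 2 * τ * (η - D.b t q v + D.V t q * τ) := by
  obtain ⟨h1, h2⟩ := h
  have h0 : D.a t q (0 : EuclideanSpace ℝ (Fin d)) v = 0 :=
    congrArg (fun f : EuclideanSpace ℝ (Fin d) →L[ℝ] ℝ => f v) (map_zero (D.a t q))
  have h0' : D.b t q (0 : EuclideanSpace ℝ (Fin d)) = 0 := map_zero (D.b t q)
  have e2 : D.g (t, q, y) (D.orientation (t, q, y)) ((τ, v, η) : ModelSpace d) =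
    D.a t q (0 : EuclideanSpace ℝ (Fin d)) v - 1 * (η - D.b t q v) - (-(D.V t q - 1 / 2)
      - D.b t q (0 : EuclideanSpace ℝ (Fin d))) * τ - 2 * D.V t q * 1 * τ := rfl
  rw [g_mk] at h1
  rw [e2, h0, h0'] at h2
  have hpos := D.a_nonneg t q v
  set m := η - D.b t q v
  set V := D.V t q
  have h3 : 0 < τ * (m + V * τ) := by nlinarith
  have h4 : 0 < m + V * τ + τ / 2 := by linarith
  have hτ : 0 < τ := by
    by_contra hle
    push Not at hle
    rcases hle.lt_or_eq with h | h
    · have : m + V * τ < 0 := by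
        by_contra h5
        push Not at h5
        nlinarith
      linarith
    · rw [h] at h3
      simp at h3
  exact ⟨hτ, by linarith⟩

/-- Along a future timelike curve y − u strictly increases, whereas it vanishes at both ends if
these lie on the graph. Monotonicity of t keeps the curve over the interval J, where u is
controlled. -/
theorem IsHJSolution.isAchronal_graph (h : D.IsHJSolution J u) (hu : IsC1On d J u)
    (hJ : IsOpen J) (hJ' : J.OrdConnected) : D.IsAchronal (graphOver J u) := by
  rintro x ⟨⟨tx, qx⟩, ⟨htx, -⟩, rfl⟩ y ⟨⟨ty, qy⟩, ⟨hty, -⟩, rfl⟩ ⟨s₀, s₁, γ, h01, hγ, h0, h1, hf⟩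
  have hv : ∀ s ∈ Icc s₀ s₁, ∃ (τ : ℝ) (v : EuclideanSpace ℝ (Fin d)) (η : ℝ),
      HasDerivWithinAt (fun s => (γ s).1) τ (Icc s₀ s₁) s ∧
      HasVelocityWithinAt (fun s => (γ s).2.1) v (Icc s₀ s₁) s ∧
      HasDerivWithinAt (fun s => (γ s).2.2) η (Icc s₀ s₁) s ∧ 0 < τ ∧
      D.a (γ s).1 (γ s).2.1 v v <
        2 * τ * (η - D.b (γ s).1 (γ s).2.1 v + D.V (γ s).1 (γ s).2.1 * τ) := by
    intro s hs
    have e1 := hasSpVelocityWithinAt_iff.1 (hasSpVelocityWithinAt_spVelocityOn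
      ((hγ s hs).mdifferentiableWithinAt one_ne_zero))
    exact ⟨_, _, _, e1.1, e1.2.1, e1.2.2, isFutureTimelike_mk (hf s hs)⟩
  choose! τ v η hT hc hy hτ hlt using hv
  have hint : ∀ s ∈ interior (Icc s₀ s₁), s ∈ Icc s₀ s₁ := fun s hs => interior_subset hs
  have hmono : StrictMonoOn (fun s => (γ s).1) (Icc s₀ s₁) :=
    strictMonoOn_of_hasDerivWithinAt_pos (convex_Icc _ _)
      (fun s hs => (hT s hs).continuousWithinAt)
      (fun s hs => (hT s (hint s hs)).mono interior_subset) fun s hs => hτ s (hint s hs)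
  have hmem : ∀ s ∈ Icc s₀ s₁, (γ s).1 ∈ J := by
    intro s hs
    refine hJ'.out htx hty ⟨?_, ?_⟩
    · have := hmono.monotoneOn (left_mem_Icc.2 h01.le) hs hs.1
      simpa only [h0] using this
    · have := hmono.monotoneOn hs (right_mem_Icc.2 h01.le) hs.2
      simpa only [h1] using this
  have hder : ∀ s ∈ Icc s₀ s₁, HasDerivWithinAt (fun s => (γ s).2.2 - u ((γ s).1, (γ s).2.1))
      (η s - (timeDeriv u (γ s).1 (γ s).2.1 * τ s + spaceCovector d u (γ s).1 (γ s).2.1 (v s)))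
      (Icc s₀ s₁) s := fun s hs =>
    (hy s hs).sub (hu.hasDerivWithinAt_comp_curve hJ (hmem s hs) (hT s hs) (hc s hs))
  have hmono' : StrictMonoOn (fun s => (γ s).2.2 - u ((γ s).1, (γ s).2.1)) (Icc s₀ s₁) := by
    refine strictMonoOn_of_hasDerivWithinAt_pos (convex_Icc _ _)
      (fun s hs => (hder s hs).continuousWithinAt)
      (fun s hs => (hder s (hint s hs)).mono interior_subset) fun s hs => ?_
    have hs := hint s hs
    -- The Fenchel inequality concerns curves parametrized by t, hence the velocity v/τ;
    -- multiplication by τ > 0 returns to the parameter s.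
    have e1 := h.timeDeriv_add_le (hmem s hs) (γ s).2.1 ((τ s)⁻¹ • v s)
    have e2 : D.lagrangian (γ s).1 (γ s).2.1 ((τ s)⁻¹ • v s) =
        (τ s)⁻¹ * ((τ s)⁻¹ * D.a (γ s).1 (γ s).2.1 (v s) (v s)) / 2
        + (τ s)⁻¹ * D.b (γ s).1 (γ s).2.1 (v s) - D.V (γ s).1 (γ s).2.1 := by
      have h3 : D.a (γ s).1 (γ s).2.1 ((τ s)⁻¹ • v s) ((τ s)⁻¹ • v s) =
          (τ s)⁻¹ * ((τ s)⁻¹ * D.a (γ s).1 (γ s).2.1 (v s) (v s)) :=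
        (congrArg (fun f : EuclideanSpace ℝ (Fin d) →L[ℝ] ℝ => f ((τ s)⁻¹ • v s))
          (map_smul (D.a (γ s).1 (γ s).2.1) (τ s)⁻¹ (v s))).trans
          (congrArg ((τ s)⁻¹ * ·) (map_smul (D.a (γ s).1 (γ s).2.1 (v s)) (τ s)⁻¹ (v s)))
      change D.a (γ s).1 (γ s).2.1 ((τ s)⁻¹ • v s) ((τ s)⁻¹ • v s) / 2
        + D.b (γ s).1 (γ s).2.1 ((τ s)⁻¹ • v s) - _ = _
      rw [h3, b_smul]
    have e3 : spaceCovector d u (γ s).1 (γ s).2.1 ((τ s)⁻¹ • v s) =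
        (τ s)⁻¹ * spaceCovector d u (γ s).1 (γ s).2.1 (v s) := by
      rw [map_smul, smul_eq_mul]
    have hp := hτ s hs
    have e4 := hlt s hs
    have e5 : timeDeriv u (γ s).1 (γ s).2.1
        + (τ s)⁻¹ * spaceCovector d u (γ s).1 (γ s).2.1 (v s) ≤
        (τ s)⁻¹ * ((τ s)⁻¹ * D.a (γ s).1 (γ s).2.1 (v s) (v s)) / 2
        + (τ s)⁻¹ * D.b (γ s).1 (γ s).2.1 (v s) - D.V (γ s).1 (γ s).2.1 := by
      rw [← e2, ← e3]
      exact e1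
    have e6 := mul_le_mul_of_nonneg_left e5 hp.le
    have e7 : (τ s)⁻¹ * D.a (γ s).1 (γ s).2.1 (v s) (v s) <
        2 * (η s - D.b (γ s).1 (γ s).2.1 (v s) + D.V (γ s).1 (γ s).2.1 * τ s) := by
      rw [inv_mul_lt_iff₀ hp]
      linarith
    have e8 : τ s * ((τ s)⁻¹ * ((τ s)⁻¹ * D.a (γ s).1 (γ s).2.1 (v s) (v s)) / 2
        + (τ s)⁻¹ * D.b (γ s).1 (γ s).2.1 (v s) - D.V (γ s).1 (γ s).2.1) =
        (τ s)⁻¹ * D.a (γ s).1 (γ s).2.1 (v s) (v s) / 2 + D.b (γ s).1 (γ s).2.1 (v s)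
        - D.V (γ s).1 (γ s).2.1 * τ s := by
      field_simp
    have e9 : τ s * (timeDeriv u (γ s).1 (γ s).2.1
        + (τ s)⁻¹ * spaceCovector d u (γ s).1 (γ s).2.1 (v s)) =
        timeDeriv u (γ s).1 (γ s).2.1 * τ s + spaceCovector d u (γ s).1 (γ s).2.1 (v s) := by
      field_simp
    rw [e8, e9] at e6
    linarith
  have := hmono' (left_mem_Icc.2 h01.le) (right_mem_Icc.2 h01.le) h01
  simp only [h0, h1, sub_self, lt_self_iff_false] at this

end MechanicalData
end Brinkmann

/-! ### Straightening charts along a graph -/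

namespace Brinkmann

variable {d : ℕ} {Q : Type*} [TopologicalSpace Q] [ChartedSpace (EuclideanSpace ℝ (Fin d)) Q]
variable {J : Set ℝ} {u : ℝ × Q → ℝ}

/-! ### Graphs are hypersurfaces -/

/-- A linear identification of the model space of `ℝ × Q` with a Euclidean space. -/
def flatten (d : ℕ) : (ℝ × EuclideanSpace ℝ (Fin d)) ≃L[ℝ] EuclideanSpace ℝ (Fin (d + 1)) :=
  ContinuousLinearEquiv.ofFinrankEq (by simp [add_comm])

/-- The projection of the graph is inverse to (t, q) ↦ (t, q, u(t, q)); it transports the charts of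
J × Q to the graph. -/
theorem isOpenEmbedding_graph_proj (hu : ContinuousOn u (J ×ˢ univ)) (hJ : IsOpen J) :
    IsOpenEmbedding (fun x : graphOver J u => ((x.1.1, x.1.2.1) : ℝ × Q)) := by
  have hmem : ∀ x : graphOver J u, x.1.1 ∈ J ∧ x.1.2.2 = u (x.1.1, x.1.2.1) := by
    rintro ⟨_, ⟨⟨t, q⟩, ⟨ht, -⟩, rfl⟩⟩
    exact ⟨ht, rfl⟩
  let e : graphOver J u ≃ₜ (J ×ˢ univ : Set (ℝ × Q)) :=
    { toFun := fun x => ⟨(x.1.1, x.1.2.1), (hmem x).1, mem_univ _⟩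
      invFun := fun p => ⟨(p.1.1, p.1.2, u p.1), p.1, p.2, rfl⟩
      left_inv := fun x => Subtype.ext (Prod.ext rfl (Prod.ext rfl (hmem x).2.symm))
      right_inv := fun p => rfl
      continuous_toFun := by fun_prop
      continuous_invFun := by
        refine Continuous.subtype_mk ?_ _
        have h1 : Continuous fun p : (J ×ˢ univ : Set (ℝ × Q)) => u p.1 :=
          continuousOn_iff_continuous_domRestrict.1 hu
        exact (continuous_fst.comp continuous_subtype_val).prodMk
          ((continuous_snd.comp continuous_subtype_val).prodMk h1) }
  exact (hJ.prod isOpen_univ).isOpenEmbedding_subtypeVal.comp e.isOpenEmbedding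

/-- The chart of `ℝ × Q × ℝ` that straightens the graph of `u`. -/
def shearChart (hu : ContinuousOn u (J ×ˢ univ)) (hJ : IsOpen J) (z : Q) :
    OpenPartialHomeomorph (Spacetime Q) (ModelProd ℝ (ModelProd (EuclideanSpace ℝ (Fin d)) ℝ)) where
  toFun p := (p.1, chartAt (EuclideanSpace ℝ (Fin d)) z p.2.1, p.2.2 - u (p.1, p.2.1))
  invFun x := (x.1, (chartAt (EuclideanSpace ℝ (Fin d)) z).symm x.2.1,
    x.2.2 + u (x.1, (chartAt (EuclideanSpace ℝ (Fin d)) z).symm x.2.1))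
  source := J ×ˢ (chartAt (EuclideanSpace ℝ (Fin d)) z).source ×ˢ univ
  target := J ×ˢ (chartAt (EuclideanSpace ℝ (Fin d)) z).target ×ˢ univ
  map_source' p hp := ⟨hp.1, (chartAt (EuclideanSpace ℝ (Fin d)) z).map_source hp.2.1, mem_univ _⟩
  map_target' x hx := ⟨hx.1, (chartAt (EuclideanSpace ℝ (Fin d)) z).map_target hx.2.1, mem_univ _⟩
  left_inv' p hp := by
    have h1 := (chartAt (EuclideanSpace ℝ (Fin d)) z).left_inv hp.2.1
    simp only [h1, sub_add_cancel]
  right_inv' x hx := by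
    have h1 := (chartAt (EuclideanSpace ℝ (Fin d)) z).right_inv hx.2.1
    simp only [h1, add_sub_cancel_right]
    rfl
  open_source := hJ.prod ((chartAt (EuclideanSpace ℝ (Fin d)) z).open_source.prod isOpen_univ)
  open_target := hJ.prod ((chartAt (EuclideanSpace ℝ (Fin d)) z).open_target.prod isOpen_univ)
  continuousOn_toFun := by
    have h1 : ContinuousOn (fun p : ℝ × Q × ℝ => p.2.1)
        (J ×ˢ (chartAt (EuclideanSpace ℝ (Fin d)) z).source ×ˢ univ) := by fun_prop
    have h2 : ContinuousOn (fun p : ℝ × Q × ℝ => (p.1, p.2.1))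
        (J ×ˢ (chartAt (EuclideanSpace ℝ (Fin d)) z).source ×ˢ univ) := by fun_prop
    exact continuousOn_fst.prodMk (((chartAt (EuclideanSpace ℝ (Fin d)) z).continuousOn.comp h1
      fun p hp => hp.2.1).prodMk ((continuous_snd.comp continuous_snd).continuousOn.sub
        (hu.comp h2 fun p hp => ⟨hp.1, mem_univ _⟩)))
  continuousOn_invFun := by
    have h1 : ContinuousOn (fun p : ℝ × EuclideanSpace ℝ (Fin d) × ℝ => p.2.1)
        (J ×ˢ (chartAt (EuclideanSpace ℝ (Fin d)) z).target ×ˢ univ) := by fun_prop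
    have h2 := (chartAt (EuclideanSpace ℝ (Fin d)) z).continuousOn_symm.comp h1
      fun p hp => hp.2.1
    exact continuousOn_fst.prodMk (h2.prodMk ((continuous_snd.comp continuous_snd).continuousOn.add
        (hu.comp (continuousOn_fst.prodMk h2) fun p hp => ⟨hp.1, mem_univ _⟩)))

variable [IsManifold (𝓡 d) 1 Q]

theorem prodChartedSpace_modelProd : (prodChartedSpace ℝ ℝ (ModelProd (EuclideanSpace ℝ (Fin d)) ℝ)
    (EuclideanSpace ℝ (Fin d) × ℝ)) =
    chartedSpaceSelf (ModelProd ℝ (ModelProd (EuclideanSpace ℝ (Fin d)) ℝ)) := by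
  rw [chartedSpaceSelf_prod]
  exact chartedSpaceSelf_prod

/-- The shear y ↦ y − u and its inverse y ↦ y + u are as regular as u, so this is a chart of the
underlying C¹ structure. -/
theorem shearChart_mem_maximalAtlas (hu : IsC1On d J u) (hJ : IsOpen J) (z : Q) :
    shearChart (d := d) (ContMDiffOn.continuousOn hu) hJ z ∈
      IsManifold.maximalAtlas (model d) 1 (Spacetime Q) := by
  refine OpenPartialHomeomorph.mem_maximalAtlas_of_contMDiffOn _ ?_ ?_
  · have h1 : ContMDiff (model d) (𝓡 d) 1 (fun p : Spacetime Q => p.2.1) :=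
      contMDiff_fst.comp contMDiff_snd
    have h2 : ContMDiff (model d) 𝓘(ℝ, ℝ) 1 (fun p : Spacetime Q => p.2.2) :=
      contMDiff_snd.comp contMDiff_snd
    have h3 : ContMDiff (model d) 𝓘(ℝ, ℝ) 1 (fun p : Spacetime Q => p.1) := contMDiff_fst
    have h4 : ContMDiffOn (model d) 𝓘(ℝ, ℝ) 1 (fun p : Spacetime Q => u (p.1, p.2.1))
        (J ×ˢ (chartAt (EuclideanSpace ℝ (Fin d)) z).source ×ˢ univ) :=
      ContMDiffOn.comp hu (h3.prodMk h1).contMDiffOn fun p hp => ⟨hp.1, mem_univ _⟩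
    have h5 : ContMDiffOn (model d) (𝓡 d) 1
        (fun p : Spacetime Q => chartAt (EuclideanSpace ℝ (Fin d)) z p.2.1)
        (J ×ˢ (chartAt (EuclideanSpace ℝ (Fin d)) z).source ×ˢ univ) :=
      ContMDiffOn.comp contMDiffOn_chart h1.contMDiffOn fun p hp => hp.2.1
    have h6 := h3.contMDiffOn.prodMk (h5.prodMk (h2.contMDiffOn.sub h4))
    rw [prodChartedSpace_modelProd] at h6
    exact h6
  · have h1 : ContMDiff (model d) (𝓡 d) 1 (fun p : ℝ × EuclideanSpace ℝ (Fin d) × ℝ => p.2.1) :=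
      contMDiff_fst.comp contMDiff_snd
    have h2 : ContMDiff (model d) 𝓘(ℝ, ℝ) 1
        (fun p : ℝ × EuclideanSpace ℝ (Fin d) × ℝ => p.2.2) :=
      contMDiff_snd.comp contMDiff_snd
    have h3 : ContMDiff (model d) 𝓘(ℝ, ℝ) 1
        (fun p : ℝ × EuclideanSpace ℝ (Fin d) × ℝ => p.1) := contMDiff_fst
    have h5 : ContMDiffOn (model d) (𝓡 d) 1 (fun p : ℝ × EuclideanSpace ℝ (Fin d) × ℝ =>
          (chartAt (EuclideanSpace ℝ (Fin d)) z).symm p.2.1)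
        (J ×ˢ (chartAt (EuclideanSpace ℝ (Fin d)) z).target ×ˢ univ) :=
      ContMDiffOn.comp contMDiffOn_chart_symm h1.contMDiffOn fun p hp => hp.2.1
    have h4 : ContMDiffOn (model d) 𝓘(ℝ, ℝ) 1 (fun p : ℝ × EuclideanSpace ℝ (Fin d) × ℝ =>
          u (p.1, (chartAt (EuclideanSpace ℝ (Fin d)) z).symm p.2.1))
        (J ×ˢ (chartAt (EuclideanSpace ℝ (Fin d)) z).target ×ˢ univ) :=
      ContMDiffOn.comp hu (h3.contMDiffOn.prodMk h5) fun p hp => ⟨hp.1, mem_univ _⟩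
    have h6 := h3.contMDiffOn.prodMk (h5.prodMk (h2.contMDiffOn.add h4))
    rw [prodChartedSpace_modelProd] at h6
    exact h6

theorem isC1Hypersurface_graph [Nonempty Q] (hJ' : J.Nonempty) (hu : IsC1On d J u)
    (hJ : IsOpen J) : IsC1Hypersurface d (graphOver J u) := by
  obtain ⟨t₀, ht₀⟩ := hJ'
  obtain ⟨q₀⟩ := ‹Nonempty Q›
  have : Nonempty (graphOver J u) := ⟨⟨_, (t₀, q₀), ⟨ht₀, mem_univ _⟩, rfl⟩⟩
  have hemb := isOpenEmbedding_graph_proj (ContMDiffOn.continuousOn hu) hJ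
  let G := hemb.toOpenPartialHomeomorph
  have hG : ∀ t ∈ J, ∀ q, ((G.symm (t, q)).1 : Spacetime Q) = (t, q, u (t, q)) := by
    intro t ht q
    have h1 := hemb.toOpenPartialHomeomorph_left_inv
      (x := ⟨(t, q, u (t, q)), (t, q), ⟨ht, mem_univ _⟩, rfl⟩)
    exact congrArg Subtype.val h1
  -- The charts are product charts of J × Q read through the projection; u does not enter their
  -- coordinate changes.
  let C : Q → OpenPartialHomeomorph (graphOver J u) (EuclideanSpace ℝ (Fin (d + 1))) := fun z =>
    (G.trans ((OpenPartialHomeomorph.refl ℝ).prod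
      (chartAt (EuclideanSpace ℝ (Fin d)) z))).transHomeomorph (flatten d).toHomeomorph
  have hsymm : ∀ z y, (C z).symm y = G.symm (((flatten d).symm y).1,
      (chartAt (EuclideanSpace ℝ (Fin d)) z).symm ((flatten d).symm y).2) := fun z y => rfl
  have hC : ∀ z x, C z x = flatten d (x.1.1, chartAt (EuclideanSpace ℝ (Fin d)) z x.1.2.1) :=
    fun z x => rfl
  have htarget : ∀ z y, y ∈ (C z).target → ((flatten d).symm y).1 ∈ J ∧
      ((flatten d).symm y).2 ∈ (chartAt (EuclideanSpace ℝ (Fin d)) z).target := by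
    intro z y hy
    have hy' : (flatten d).symm y ∈ (G.trans ((OpenPartialHomeomorph.refl ℝ).prod
      (chartAt (EuclideanSpace ℝ (Fin d)) z))).target := hy
    rw [OpenPartialHomeomorph.trans_target] at hy'
    obtain ⟨h1, h2⟩ := hy'
    have h3 := G.map_target h2
    refine ⟨?_, h1.2⟩
    have h4 : G.target = range (fun x : graphOver J u => ((x.1.1, x.1.2.1) : ℝ × Q)) :=
      hemb.toOpenPartialHomeomorph_target
    have h5 : (((flatten d).symm y).1, (chartAt (EuclideanSpace ℝ (Fin d)) z).symm
      ((flatten d).symm y).2) ∈ G.target := h2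
    rw [h4] at h5
    obtain ⟨⟨_, ⟨⟨t, q⟩, ⟨ht, _⟩, rfl⟩⟩, hx⟩ := h5
    have h6 : t = ((flatten d).symm y).1 := congrArg Prod.fst hx
    rwa [← h6]
  have hsource : ∀ z (x : graphOver J u),
      x.1.2.1 ∈ (chartAt (EuclideanSpace ℝ (Fin d)) z).source → x ∈ (C z).source := by
    intro z x hx
    have h1 : x ∈ (G.trans ((OpenPartialHomeomorph.refl ℝ).prod
      (chartAt (EuclideanSpace ℝ (Fin d)) z))).source := by
      rw [OpenPartialHomeomorph.trans_source]
      refine ⟨?_, mem_univ _, hx⟩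
      rw [hemb.toOpenPartialHomeomorph_source]
      exact mem_univ _
    exact h1
  have hsource' : ∀ z (x : graphOver J u), x ∈ (C z).source →
      x.1.2.1 ∈ (chartAt (EuclideanSpace ℝ (Fin d)) z).source := by
    intro z x hx
    have h1 : x ∈ (G.trans ((OpenPartialHomeomorph.refl ℝ).prod
      (chartAt (EuclideanSpace ℝ (Fin d)) z))).source := hx
    rw [OpenPartialHomeomorph.trans_source] at h1
    exact h1.2.2
  have hval : ∀ z y, y ∈ (C z).target → (((C z).symm y).1 : Spacetime Q) =
      (((flatten d).symm y).1, (chartAt (EuclideanSpace ℝ (Fin d)) z).symm ((flatten d).symm y).2,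
        u (((flatten d).symm y).1, (chartAt (EuclideanSpace ℝ (Fin d)) z).symm
          ((flatten d).symm y).2)) := fun z y hy => by
    rw [hsymm, hG _ (htarget z y hy).1]
  let cs : ChartedSpace (EuclideanSpace ℝ (Fin (d + 1))) (graphOver J u) :=
    { atlas := range C
      chartAt := fun x => C x.1.2.1
      mem_chart_source := fun x => hsource _ x (mem_chart_source _ _)
      chart_mem_atlas := fun x => mem_range_self _ }
  have hmfd : IsManifold (𝓡 (d + 1)) 1 (graphOver J u) := by
    refine isManifold_of_contDiffOn _ _ _ ?_
    rintro _ _ ⟨z, rfl⟩ ⟨z', rfl⟩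
    have h1 : ContDiffOn ℝ 1 (fun y : EuclideanSpace ℝ (Fin (d + 1)) =>
        flatten d (((flatten d).symm y).1, extChartAt (𝓡 d) z'
          ((extChartAt (𝓡 d) z).symm ((flatten d).symm y).2)))
        {y | ((flatten d).symm y).2 ∈
          ((extChartAt (𝓡 d) z).symm ≫ extChartAt (𝓡 d) z').source} := by
      refine (flatten d).contDiff.comp_contDiffOn (ContDiffOn.prodMk ?_ ?_)
      · exact (contDiff_fst.comp (flatten d).symm.contDiff).contDiffOn
      · exact (contDiffOn_ext_coord_change (I := 𝓡 d) (n := 1) z' z).comp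
          (contDiff_snd.comp (flatten d).symm.contDiff).contDiffOn fun y hy => hy
    refine (h1.congr_mono ?_ ?_)
    · rintro y ⟨⟨hy1, hy2⟩, -⟩
      change C z' ((C z).symm y) = _
      have hy1' : y ∈ (C z).target := hy1
      rw [hC, hval z y hy1']
      rfl
    · rintro y ⟨⟨hy1, hy2⟩, -⟩
      have hy1' : y ∈ (C z).target := hy1
      have hy2' : (C z).symm y ∈ (C z').source := hy2
      have h3 := hsource' z' _ hy2'
      rw [hval z y hy1'] at h3
      have h4 : ((flatten d).symm y).2 ∈ (extChartAt (𝓡 d) z).target := by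
        simpa using (htarget z y hy1').2
      have h5 : (extChartAt (𝓡 d) z).symm ((flatten d).symm y).2 ∈ (extChartAt (𝓡 d) z').source := by
        rw [extChartAt_source]
        exact h3
      exact ⟨h4, h5⟩
  refine ⟨cs, hmfd, ⟨?_, IsEmbedding.subtypeVal⟩⟩
  refine Manifold.IsImmersionOfComplement.isImmersion (F := ℝ) fun x => ?_
  let eqv : (EuclideanSpace ℝ (Fin (d + 1)) × ℝ) ≃L[ℝ] ModelSpace d :=
    ((flatten d).symm.prodCongr (ContinuousLinearEquiv.refl ℝ ℝ)).trans
      (ContinuousLinearEquiv.prodAssoc ℝ ℝ (EuclideanSpace ℝ (Fin d)) ℝ)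
  have hx : x.1.1 ∈ J := by
    obtain ⟨_, ⟨⟨t, q⟩, ⟨ht, -⟩, rfl⟩⟩ := x
    exact ht
  -- Between such a chart and the sheared chart the inclusion reads p ↦ (p, 0), with complement the
  -- y axis.
  refine Manifold.IsImmersionAtOfComplement.mk_of_continuousAt
    continuous_subtype_val.continuousAt eqv (C x.1.2.1)
    (shearChart (d := d) (ContMDiffOn.continuousOn hu) hJ x.1.2.1)
    (hsource _ x (mem_chart_source _ _)) ⟨hx, mem_chart_source _ _, mem_univ _⟩
    (IsManifold.chart_mem_maximalAtlas x) (shearChart_mem_maximalAtlas hu hJ _) ?_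
  intro y hy
  have hy' : y ∈ (C x.1.2.1).target := by
    rw [OpenPartialHomeomorph.extend_target] at hy
    exact hy.1
  change shearChart (d := d) (ContMDiffOn.continuousOn hu) hJ x.1.2.1
    ((C x.1.2.1).symm y).1 = (((flatten d).symm y).1, ((flatten d).symm y).2, (0 : ℝ))
  rw [hval _ y hy']
  refine Prod.ext rfl (Prod.ext ?_ (sub_self _))
  exact (chartAt (EuclideanSpace ℝ (Fin d)) x.1.2.1).right_inv (htarget _ y hy').2

end Brinkmann

/-! ### From transversality to graphs by the inverse function theorem -/

namespace Brinkmann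

variable {d : ℕ} {Q : Type*} [TopologicalSpace Q] [ChartedSpace (EuclideanSpace ℝ (Fin d)) Q]
  [IsManifold (𝓡 d) 1 Q] {S : Set (Spacetime Q)}

/-! ### Hypersurfaces transverse to `n` are graphs -/

/-- The map P inverts a chart of S and Ψ is an ambient chart in which the immersion is linear; the
injectivity of L will show that P has injective derivative. -/
theorem IsC1Hypersurface.exists_parametrization (hS : IsC1Hypersurface d S) {x : Spacetime Q}
    (hx : x ∈ S) : ∃ (P : EuclideanSpace ℝ (Fin (d + 1)) → Spacetime Q)
      (y₀ : EuclideanSpace ℝ (Fin (d + 1))) (Ψ : Spacetime Q → ModelSpace d)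
      (L : EuclideanSpace ℝ (Fin (d + 1)) →L[ℝ] ModelSpace d),
      P y₀ = x ∧ (∀ y, P y ∈ S) ∧
      ContMDiffAt 𝓘(ℝ, EuclideanSpace ℝ (Fin (d + 1))) (model d) 1 P y₀ ∧
      MDifferentiableAt (model d) 𝓘(ℝ, ModelSpace d) Ψ x ∧
      Function.Injective L ∧ ∀ᶠ y in 𝓝 y₀, Ψ (P y) = L y := by
  obtain ⟨cs, hmfd, hemb⟩ := hS
  have him := hemb.isImmersion.isImmersionAt ⟨x, hx⟩
  set φ := him.domChart with hφ
  set ψ := him.codChart with hψ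
  have hxφ : (⟨x, hx⟩ : S) ∈ φ.source := him.mem_domChart_source
  have hleft : (φ.extend (𝓡 (d + 1))).symm (φ.extend (𝓡 (d + 1)) ⟨x, hx⟩) = ⟨x, hx⟩ :=
    φ.extend_left_inv hxφ
  have htarget : (φ.extend (𝓡 (d + 1))).target ∈ 𝓝 (φ.extend (𝓡 (d + 1)) ⟨x, hx⟩) :=
    (φ.isOpen_extend_target).mem_nhds ((φ.extend (𝓡 (d + 1))).map_source
      (by rwa [φ.extend_source]))
  refine ⟨fun y => ((φ.extend (𝓡 (d + 1))).symm y).1, φ.extend (𝓡 (d + 1)) ⟨x, hx⟩,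
    ψ.extend (model d), him.equiv.toContinuousLinearMap.comp (ContinuousLinearMap.inl ℝ _ _),
    congrArg Subtype.val hleft, fun y => ((φ.extend (𝓡 (d + 1))).symm y).2, ?_, ?_, ?_, ?_⟩
  · have h1 : ContMDiffAt 𝓘(ℝ, EuclideanSpace ℝ (Fin (d + 1))) (𝓡 (d + 1)) 1
        (φ.extend (𝓡 (d + 1))).symm (φ.extend (𝓡 (d + 1)) ⟨x, hx⟩) := by
      refine (contMDiffOn_extend_symm him.domChart_mem_maximalAtlas).contMDiffAt ?_
      rw [(𝓡 (d + 1)).image_eq, ← φ.extend_target]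
      exact htarget
    have h2 := him.contMDiffAt
    rw [← hleft] at h2
    exact h2.comp _ h1
  · exact (ψ.contMDiffAt_extend him.codChart_mem_maximalAtlas
      him.mem_codChart_source).mdifferentiableAt one_ne_zero
  · exact him.equiv.injective.comp (Prod.mk_left_injective 0)
  · filter_upwards [htarget] with y hy using him.writtenInCharts hy

/-- The tangent vectors of `S` are closed under scaling. -/
theorem smul_mem_tangentVectors {x : Spacetime Q} {γ : ℝ → Spacetime Q} (h0 : γ 0 = x)
    (hγ : ∀ᶠ s in 𝓝 (0 : ℝ), γ s ∈ S) {w : ModelSpace d}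
    (hw : HasSpVelocityWithinAt γ w univ 0) (k : ℝ) :
    k • w ∈ tangentVectors (d := d) S x := by
  obtain ⟨h1, h2, h3⟩ := hasSpVelocityWithinAt_iff.1 hw
  rw [hasDerivWithinAt_univ] at h1 h3
  have hk : HasDerivAt (fun s : ℝ => k * s) k 0 := by simpa using (hasDerivAt_id (0 : ℝ)).const_mul k
  have hk0 : Tendsto (fun s : ℝ => k * s) (𝓝 0) (𝓝 0) := by
    simpa using hk.continuousAt.tendsto
  have hk' := hasMFDerivAt_iff_hasFDerivAt.2 (hasDerivAt_iff_hasFDerivAt.1 hk)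
  have hw' : HasMFDerivAt 𝓘(ℝ, ℝ) (model d) γ (k * 0)
      (ContinuousLinearMap.toSpanSingleton ℝ w : ℝ →L[ℝ] ModelSpace d) := by
    rw [mul_zero]
    exact hasMFDerivWithinAt_univ.1 hw
  have h4 := HasMFDerivAt.comp 0 hw' hk'
  have h5 : HasSpVelocityWithinAt (fun s => γ (k * s)) (k • w) univ 0 := by
    refine hasMFDerivWithinAt_univ.2 (h4.congr_mfderiv ?_)
    refine ContinuousLinearMap.ext_ring ?_
    change ((1 : ℝ) • k) • w = (1 : ℝ) • (k • w)
    rw [one_smul, one_smul]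
  refine ⟨fun s => γ (k * s), by simp only [mul_zero, h0], hk0.eventually hγ,
    HasMFDerivAt.mdifferentiableAt (hasMFDerivWithinAt_univ.1 h5), h5.spVelocity_eq⟩

theorem hasSpVelocityWithinAt_of_chart {γ : ℝ → Spacetime Q} {t : ℝ} {q : Q} {y η : ℝ}
    (h0 : γ 0 = (t, q, y)) (hc : ContinuousAt γ 0) {τ : ℝ} {ξ : EuclideanSpace ℝ (Fin d)}
    (hT : HasDerivAt (fun s => (γ s).1) τ 0)
    (hX : HasDerivAt (fun s => extChartAt (𝓡 d) q (γ s).2.1) ξ 0)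
    (hY : HasDerivAt (fun s => (γ s).2.2) η 0) :
    HasSpVelocityWithinAt γ (τ, chartDeriv q (extChartAt (𝓡 d) q q) ξ, η) univ 0 := by
  have hq : (γ 0).2.1 = q := by rw [h0]
  have h1 := hasVelocityAt_chart_symm q (x := fun s => extChartAt (𝓡 d) q (γ s).2.1)
    (by rw [hq]; exact (extChartAt (𝓡 d) q).map_source (mem_extChartAt_source q)) hX
  have h2 : (fun s => (γ s).2.1) =ᶠ[𝓝 0]
      fun s => (extChartAt (𝓡 d) q).symm (extChartAt (𝓡 d) q (γ s).2.1) := by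
    have hc' : ContinuousAt (fun s => (γ s).2.1) 0 := hc.snd.fst
    filter_upwards [eventually_mem_source q hc' (by rw [hq]; exact mem_extChartAt_source (I := 𝓡 d) q)]
      with s hs using ((extChartAt (𝓡 d) q).left_inv hs).symm
  have h3 := h1.congr h2
  rw [hq] at h3
  exact hasSpVelocityWithinAt_iff.2 ⟨hT.hasDerivWithinAt, h3.hasVelocityWithinAt univ,
    hY.hasDerivWithinAt⟩

/-- A transverse hypersurface is locally the graph of a `C¹` function. -/
theorem IsC1Hypersurface.exists_local_graph (hS : IsC1Hypersurface d S)
    (htr : IsTransversal d S) {t : ℝ} {q : Q} {y : ℝ} (hx : (t, q, y) ∈ S) :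
    ∃ f : ℝ × EuclideanSpace ℝ (Fin d) → ℝ,
      ContDiffAt ℝ 1 f (t, extChartAt (𝓡 d) q q) ∧
      ∀ᶠ p in 𝓝 (t, extChartAt (𝓡 d) q q), (p.1, (extChartAt (𝓡 d) q).symm p.2, f p) ∈ S := by
  obtain ⟨P, y₀, Ψ, L, hP0, hPS, hP, hΨ, hL, hΨP⟩ := hS.exists_parametrization hx
  set φ := extChartAt (𝓡 d) q with hφ
  have hPc : ContinuousAt P y₀ := hP.continuousAt
  have hT : ContDiffAt ℝ 1 (fun y => (P y).1) y₀ := by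
    rw [← contMDiffAt_iff_contDiffAt]
    exact contMDiffAt_fst.comp y₀ hP
  have hPq : ContMDiffAt 𝓘(ℝ, EuclideanSpace ℝ (Fin (d + 1))) (𝓡 d) 1 (fun y => (P y).2.1) y₀ :=
    contMDiffAt_fst.comp y₀ (contMDiffAt_snd.comp y₀ hP)
  have hY : ContDiffAt ℝ 1 (fun y => (P y).2.2) y₀ := by
    rw [← contMDiffAt_iff_contDiffAt]
    exact contMDiffAt_snd.comp y₀ (contMDiffAt_snd.comp y₀ hP)
  have hq0 : (P y₀).2.1 = q := by rw [hP0]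
  have hX : ContDiffAt ℝ 1 (fun y => φ (P y).2.1) y₀ := by
    rw [← contMDiffAt_iff_contDiffAt]
    have h1 : ContMDiffAt (𝓡 d) 𝓘(ℝ, EuclideanSpace ℝ (Fin d)) 1 φ (P y₀).2.1 := by
      rw [hq0]
      exact contMDiffAt_extChartAt
    exact h1.comp y₀ hPq
  set F : EuclideanSpace ℝ (Fin (d + 1)) → ℝ × EuclideanSpace ℝ (Fin d) :=
    fun y => ((P y).1, φ (P y).2.1) with hF
  have hFd : ContDiffAt ℝ 1 F y₀ := hT.prodMk hX
  have hF0 : F y₀ = (t, φ q) := by simp only [hF, hP0]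
  have hFd' := (hFd.differentiableAt one_ne_zero).hasFDerivAt
  -- For w in the kernel, the curve P(y₀ + s w) has velocity (0, 0, η). If η ≠ 0, rescaling makes n
  -- tangent to S, against transversality; if η = 0, composing with Ψ gives L w = 0, hence w = 0.
  have hinj : Function.Injective (fderiv ℝ F y₀) := by
    rw [injective_iff_map_eq_zero]
    intro w hw
    have hline : HasDerivAt (fun s : ℝ => y₀ + s • w) w 0 := by
      simpa using ((hasDerivAt_id (0 : ℝ)).smul_const w).const_add y₀
    have hline0 : y₀ + (0 : ℝ) • w = y₀ := by simp
    have hcomp : ∀ {G : Type} [NormedAddCommGroup G] [NormedSpace ℝ G]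
        {g : EuclideanSpace ℝ (Fin (d + 1)) → G}, DifferentiableAt ℝ g y₀ →
        HasDerivAt (fun s : ℝ => g (y₀ + s • w)) (fderiv ℝ g y₀ w) 0 := by
      intro G _ _ g hg
      have h1 : HasFDerivAt g (fderiv ℝ g y₀) (y₀ + (0 : ℝ) • w) := by
        rw [hline0]
        exact hg.hasFDerivAt
      exact h1.comp_hasDerivAt 0 hline
    have h1 := hcomp (hFd.differentiableAt one_ne_zero)
    rw [hw] at h1
    have hη := hcomp (hY.differentiableAt one_ne_zero)
    set η := fderiv ℝ (fun y => (P y).2.2) y₀ w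
    have hγ0 : P (y₀ + (0 : ℝ) • w) = (t, q, y) := by rw [hline0, hP0]
    have hγc : ContinuousAt (fun s : ℝ => P (y₀ + s • w)) 0 := by
      refine ContinuousAt.comp (g := P) ?_ hline.continuousAt
      rwa [hline0]
    have hv := hasSpVelocityWithinAt_of_chart hγ0 hγc (τ := 0) (ξ := 0) h1.fst h1.snd hη
    rw [map_zero] at hv
    have hη0 : η = 0 := by
      by_contra hne
      refine htr _ hx ?_
      have h2 := smul_mem_tangentVectors hγ0 (Eventually.of_forall fun s => hPS _) hv η⁻¹
      have h3 : η⁻¹ • ((0, 0, η) : ModelSpace d) = (0, 0, 1) := by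
        simp [hne]
      rw [h3] at h2
      exact h2
    rw [hη0] at hv
    have h4 : HasMFDerivAt 𝓘(ℝ, ℝ) (model d) (fun s : ℝ => P (y₀ + s • w)) 0
        (ContinuousLinearMap.toSpanSingleton ℝ (0, 0, 0) : ℝ →L[ℝ] ModelSpace d) :=
      hasMFDerivWithinAt_univ.1 hv
    have h5 : HasMFDerivAt (model d) 𝓘(ℝ, ModelSpace d) Ψ (P (y₀ + (0 : ℝ) • w))
        (mfderiv (model d) 𝓘(ℝ, ModelSpace d) Ψ (P (y₀ + (0 : ℝ) • w))) := by
      rw [hγ0]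
      exact hΨ.hasMFDerivAt
    have h6 := hasMFDerivAt_iff_hasFDerivAt.1 (HasMFDerivAt.comp (0 : ℝ) h5 h4)
    have h7 : HasFDerivAt (fun s : ℝ => L (y₀ + s • w))
        (L.comp (ContinuousLinearMap.toSpanSingleton ℝ w)) 0 :=
      L.hasFDerivAt.comp 0 (hasDerivAt_iff_hasFDerivAt.1 hline)
    have h8 : (fun s : ℝ => L (y₀ + s • w)) =ᶠ[𝓝 0] Ψ ∘ fun s : ℝ => P (y₀ + s • w) := by
      have h9 : Tendsto (fun s : ℝ => y₀ + s • w) (𝓝 0) (𝓝 y₀) := by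
        have := hline.continuousAt.tendsto
        rwa [hline0] at this
      exact (h9.eventually hΨP).mono fun s hs => hs.symm
    have h10 := h7.unique (h6.congr_of_eventuallyEq h8)
    have h11 : L w = 0 := by
      have h12 := congrArg (fun f : ℝ →L[ℝ] ModelSpace d => f 1) h10
      have h13 : L ((1 : ℝ) • w) = (mfderiv (model d) 𝓘(ℝ, ModelSpace d) Ψ (P (y₀ + (0 : ℝ) • w)) :
        ModelSpace d →L[ℝ] ModelSpace d) ((1 : ℝ) • (0 : ModelSpace d)) := h12
      rw [one_smul, smul_zero] at h13
      exact h13.trans (map_zero (mfderiv (model d) 𝓘(ℝ, ModelSpace d) Ψ (P (y₀ + (0 : ℝ) • w))))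
    exact (injective_iff_map_eq_zero L).1 hL w h11
  -- By equality of dimensions the derivative of the projection is invertible; the local graph
  -- function is the y component of P composed with the local inverse of F.
  have hdim : Module.finrank ℝ (EuclideanSpace ℝ (Fin (d + 1))) =
      Module.finrank ℝ (ℝ × EuclideanSpace ℝ (Fin d)) := by simp [add_comm]
  let e := (LinearMap.linearEquivOfInjective (fderiv ℝ F y₀ : _ →ₗ[ℝ] _) hinj
    hdim).toContinuousLinearEquiv
  have he : HasFDerivAt F (e : _ →L[ℝ] ℝ × EuclideanSpace ℝ (Fin d)) y₀ := by
    refine hFd'.congr_fderiv ?_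
    ext v <;> rfl
  have hg := hFd.to_localInverse he one_ne_zero
  have hg0 := hFd.localInverse_apply_image he one_ne_zero
  have hgr : ∀ᶠ p in 𝓝 (F y₀), F (hFd.localInverse he one_ne_zero p) = p :=
    (hFd.hasStrictFDerivAt' he one_ne_zero).eventually_right_inverse
  set g := hFd.localInverse he one_ne_zero
  rw [hF0] at hg hg0 hgr
  refine ⟨fun p => (P (g p)).2.2, ?_, ?_⟩
  · refine ContDiffAt.comp (g := fun y => (P y).2.2) _ ?_ hg
    rw [hg0]
    exact hY
  · have h1 : ∀ᶠ p in 𝓝 (t, φ q), (P (g p)).2.1 ∈ φ.source := by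
      have h2 : ContinuousAt (fun p => (P (g p)).2.1) (t, φ q) := by
        refine ContinuousAt.comp (g := fun y => (P y).2.1) ?_ hg.continuousAt
        rw [hg0]
        exact hPq.continuousAt
      refine h2.eventually_mem ((isOpen_extChartAt_source q).mem_nhds ?_)
      rw [hg0, hq0]
      exact mem_extChartAt_source q
    filter_upwards [h1, hgr] with p hp1 hp2
    have h3 : (P (g p)).1 = p.1 := congrArg Prod.fst hp2
    have h4 : φ (P (g p)).2.1 = p.2 := congrArg Prod.snd hp2
    rw [← h3, ← h4, φ.left_inv hp1]
    exact hPS _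

/-- The single intersection with each line defines u globally, and also forces it to agree with the
C¹ local graph functions. -/
theorem IsC1Hypersurface.exists_graph (hS : IsC1Hypersurface d S) {J : Set ℝ} (hJ : IsOpen J)
    (hSJ : S ⊆ slab J) (hm : MeetsLinesOnce J S) (htr : IsTransversal d S) :
    ∃ u : ℝ × Q → ℝ, IsC1On d J u ∧ S = graphOver J u := by
  classical
  have h1 : ∀ p : ℝ × Q, ∃ y : ℝ, p.1 ∈ J → ((p.1, p.2, y) : Spacetime Q) ∈ S ∧
      ∀ y', ((p.1, p.2, y') : Spacetime Q) ∈ S → y' = y := by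
    intro p
    by_cases hp : p.1 ∈ J
    · obtain ⟨y, hy, hu⟩ := hm p.1 hp p.2
      exact ⟨y, fun _ => ⟨hy, hu⟩⟩
    -- Outside J × Q the value of u is arbitrary.
    · exact ⟨0, fun h => (hp h).elim⟩
  choose u hu using h1
  refine ⟨u, ?_, ?_⟩
  · rintro ⟨t, q⟩ ⟨ht, -⟩
    refine ContMDiffAt.contMDiffWithinAt ?_
    obtain ⟨f, hf, hfS⟩ := hS.exists_local_graph htr (hu (t, q) ht).1
    have h2 : ContMDiffAt (𝓘(ℝ, ℝ).prod (𝓡 d)) 𝓘(ℝ, ℝ × EuclideanSpace ℝ (Fin d)) 1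
        (fun p : ℝ × Q => (p.1, extChartAt (𝓡 d) q p.2)) (t, q) := by
      have h3 : ContMDiffAt (𝓘(ℝ, ℝ).prod (𝓡 d)) 𝓘(ℝ, EuclideanSpace ℝ (Fin d)) 1
          (fun p : ℝ × Q => extChartAt (𝓡 d) q p.2) (t, q) :=
        (contMDiffAt_extChartAt (I := 𝓡 d) (x := q)).comp (t, q) contMDiffAt_snd
      exact ContMDiffAt.prodMk_space contMDiffAt_fst h3
    have h3 : ContMDiffAt (𝓘(ℝ, ℝ).prod (𝓡 d)) 𝓘(ℝ, ℝ) 1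
        (fun p : ℝ × Q => f (p.1, extChartAt (𝓡 d) q p.2)) (t, q) :=
      ContMDiffAt.comp (t, q) (contMDiffAt_iff_contDiffAt.2 hf) h2
    refine h3.congr_of_eventuallyEq ?_
    have h4 := h2.continuousAt.eventually hfS
    have h5 : ∀ᶠ p in 𝓝 (t, q), p ∈ J ×ˢ (extChartAt (𝓡 d) q).source :=
      (hJ.prod (isOpen_extChartAt_source q)).mem_nhds ⟨ht, mem_extChartAt_source q⟩
    filter_upwards [h4, h5] with p hp1 hp2
    simp only [(extChartAt (𝓡 d) q).left_inv hp2.2] at hp1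
    exact ((hu p hp2.1).2 _ hp1).symm
  · ext ⟨t, q, y⟩
    constructor
    · intro hx
      have ht : t ∈ J := hSJ hx
      refine ⟨(t, q), ⟨ht, mem_univ _⟩, ?_⟩
      rw [(hu (t, q) ht).2 y hx]
    · rintro ⟨⟨t', q'⟩, ⟨ht, -⟩, he⟩
      rw [← he]
      exact (hu (t', q') ht).1

end Brinkmann

end

/-! ### Hypersurfaces, graphs and generators: the full statement -/

theorem theorem3p3 {d : ℕ} {Q : Type*} [TopologicalSpace Q]
    [ChartedSpace (EuclideanSpace ℝ (Fin d)) Q] [IsManifold (𝓡 d) 1 Q]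
    [T2Space Q] [ParacompactSpace Q] [ConnectedSpace Q]
    {r : ℕ∞ω} (hr : 2 ≤ r) [IsManifold (𝓡 d) (r + 1) Q]
    (D : MechanicalData d Q r) (J : Set ℝ) (hJ : IsOpen J) (hJ' : IsConnected J) :
    -- hypersurfaces transverse to `n`
    (∀ S : Set (Spacetime Q), S ⊆ slab J → IsC1Hypersurface d S → MeetsLinesOnce J S →
      IsTransversal d S →
      ∃ u : ℝ × Q → ℝ, IsC1On d J u ∧ S = graphOver J u ∧
        (D.IsLightlikeHypersurface S ↔ D.IsHJSolution J u) ∧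
        (D.HasCausalNormals S ↔ D.IsHJSubsolution J u)) ∧
    -- graphs
    (∀ u : ℝ × Q → ℝ, IsC1On d J u →
      IsC1Hypersurface d (graphOver J u) ∧
      (D.IsLightlikeHypersurface (graphOver J u) ↔ D.IsHJSolution J u) ∧
      (D.HasCausalNormals (graphOver J u) ↔ D.IsHJSubsolution J u)) ∧
    -- the lightlike case
    (∀ u : ℝ × Q → ℝ, IsC1On d J u → D.IsLightlikeHypersurface (graphOver J u) →
      D.IsAchronal (graphOver J u) ∧
      (∀ t₀ t₁ : ℝ, t₀ < t₁ → Icc t₀ t₁ ⊆ J → ∀ q₁ : Q,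
        (D.laxOleinikValues u t₀ t₁ q₁).Nonempty ∧ BddBelow (D.laxOleinikValues u t₀ t₁ q₁) ∧
        u (t₁, q₁) ≤ sInf (D.laxOleinikValues u t₀ t₁ q₁)) ∧
      ∀ t₁ ∈ J, ∀ q₁ : Q, ∃ (A : Set ℝ) (c : ℝ → Q), t₁ ∈ A ∧ c t₁ = q₁ ∧
        -- the generator through `(t₁, q₁, u (t₁, q₁))`
        D.IsInextendibleLightlikeGeodesic J A (fun t => (t, c t, u (t, c t))) ∧
        D.IsAchronal ((fun t => ((t, c t, u (t, c t)) : Spacetime Q)) '' A) ∧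
        -- its projection
        D.IsMaximalELSolution J A c ∧
        D.IsActionMinimizing A c ∧
        D.IsCharacteristic J u A c ∧
        -- it is the only maximal characteristic through `(t₁, q₁)`
        (∀ A' c', D.IsCharacteristic J u A' c' → t₁ ∈ A' → c' t₁ = q₁ →
          A' ⊆ A ∧ EqOn c' c A') ∧
        -- the case of equality
        ∀ t₀ < t₁, Icc t₀ t₁ ⊆ J →
          (u (t₁, q₁) ∈ D.laxOleinikValues u t₀ t₁ q₁ ↔ t₀ ∈ A) ∧
          (t₀ ∈ A → u (t₁, q₁) = sInf (D.laxOleinikValues u t₀ t₁ q₁) ∧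
            u (t₁, q₁) = u (t₀, c t₀) + D.action t₀ t₁ c) ∧
          (∀ c' : ℝ → Q, IsC1CurveOn d t₀ t₁ c' → c' t₁ = q₁ →
            u (t₁, q₁) = u (t₀, c' t₀) + D.action t₀ t₁ c' → EqOn c' c (Icc t₀ t₁)) ∧
          (D.IsELCompleteOn J t₀ t₁ → t₀ ∈ A)) := by
  have hJo : J.OrdConnected := hJ'.isPreconnected.ordConnected
  have hlight := fun (u : ℝ × Q → ℝ) (hu : IsC1On d J u) =>
    D.isLightlikeHypersurface_graph_iff hu hJ
  have hcausal := fun (u : ℝ × Q → ℝ) (hu : IsC1On d J u) => D.hasCausalNormals_graph_iff hu hJ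
  refine ⟨fun S hSJ hS hm htr => ?_, fun u hu => ?_, fun u hu hl => ?_⟩
  · obtain ⟨u, hu, rfl⟩ := hS.exists_graph hJ hSJ hm htr
    exact ⟨u, hu, rfl, hlight u hu, hcausal u hu⟩
  · exact ⟨isC1Hypersurface_graph hJ'.nonempty hu hJ, hlight u hu, hcausal u hu⟩
  have h : D.IsHJSolution J u := (hlight u hu).1 hl
  have hach := h.isAchronal_graph hu hJ hJo
  have hlower := fun (t₀ t₁ : ℝ) (h01 : t₀ < t₁) (hI : Icc t₀ t₁ ⊆ J) (q₁ : Q) =>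
    h.mem_lowerBounds_laxOleinikValues hu hJ h01 hI q₁
  refine ⟨hach, fun t₀ t₁ h01 hI q₁ => ⟨D.laxOleinikValues_nonempty u t₀ t₁ q₁,
    ⟨_, hlower t₀ t₁ h01 hI q₁⟩,
    le_csInf (D.laxOleinikValues_nonempty u t₀ t₁ q₁) (hlower t₀ t₁ h01 hI q₁)⟩,
    fun t₁ ht₁ q₁ => ?_⟩
  obtain ⟨A, c, ht₁A, hc₁, hc, hmax⟩ := h.exists_maximal_characteristic hr hu hJ ht₁ q₁
  -- An Euler-Lagrange extension of c is again a characteristic through the same point, so its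
  -- interval lies in A.
  have hmaxEL : D.IsMaximalELSolution J A c := by
    refine ⟨h.isELSolution_of_isCharacteristic hr hu hJ hc, fun A' c' hc' hA heq => ?_⟩
    exact ((hmax A' c' (h.isCharacteristic_of_isELSolution hr hu hJ hc hc' hA heq) (hA ht₁A)
      ((heq ht₁A).symm.trans hc₁)).1).antisymm hA
  refine ⟨A, c, ht₁A, hc₁, h.isInextendibleLightlikeGeodesic hr hu hJ hc hmaxEL, ?_, hmaxEL,
    h.isActionMinimizing hr hu hJ hc, hc, hmax, fun t₀ h01 hI => ?_⟩
  · have hsub : (fun t => ((t, c t, u (t, c t)) : Spacetime Q)) '' A ⊆ graphOver J u := by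
      rintro _ ⟨t, ht, rfl⟩
      exact ⟨(t, c t), ⟨hc.1.2.2.2 ht, mem_univ _⟩, rfl⟩
    exact fun x hx y hy => hach x (hsub hx) y (hsub hy)
  -- Equality forces characteristic velocity on all of [t₀, t₁]. The curve then extends past both
  -- ends to a characteristic, which the maximal one contains.
  have hext : ∀ c' : ℝ → Q, IsC1CurveOn d t₀ t₁ c' → c' t₁ = q₁ →
      u (t₁, q₁) = u (t₀, c' t₀) + D.action t₀ t₁ c' → t₀ ∈ A ∧ EqOn c' c (Icc t₀ t₁) := by
    intro c' hc' h1 heq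
    rw [← h1] at heq
    obtain ⟨A', c'', hc'', hI', heq'⟩ := h.exists_isCharacteristic_of_eq hr hu hJ h01 hI hc' heq
    have h2 := hmax A' c'' hc'' (hI' (right_mem_Icc.2 h01.le))
      ((heq' (right_mem_Icc.2 h01.le)).trans h1)
    exact ⟨h2.1 (hI' (left_mem_Icc.2 h01.le)), fun t ht => (heq' ht).symm.trans (h2.2 (hI' ht))⟩
  have heqA : t₀ ∈ A → u (t₁, q₁) = u (t₀, c t₀) + D.action t₀ t₁ c := by
    intro ht₀
    have h1 := h.eq_action_of_isCharacteristic hr hu hJ hc ht₀ ht₁A h01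
    rwa [hc₁] at h1
  have hmem : t₀ ∈ A → u (t₁, q₁) ∈ D.laxOleinikValues u t₀ t₁ q₁ := fun ht₀ =>
    ⟨c, hc.isC1CurveOn ht₀ ht₁A, hc₁, heqA ht₀⟩
  refine ⟨⟨?_, hmem⟩, fun ht₀ => ⟨?_, heqA ht₀⟩, fun c' hc' h1 heq => (hext c' hc' h1 heq).2,
    fun hcomp => ?_⟩
  · rintro ⟨c', hc', h1, heq⟩
    exact (hext c' hc' h1 heq).1
  · exact (IsLeast.csInf_eq ⟨hmem ht₀, hlower t₀ t₁ h01 hI q₁⟩).symm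
  -- Completeness is applied to c itself, a maximal solution defined at time t₁.
  · exact hcomp A c hmaxEL ⟨t₁, ht₁A, right_mem_Icc.2 h01.le⟩ (left_mem_Icc.2 h01.le)
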